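/- **Setting.** For each sample size $n$ let $d=d_n\ge 1$ and let $X_t=(x_{t,1},\dots,x_{t,d})^\top$, $0\le t\le n$, follow the time-varying VAR(1) model $$X_t=\mathbf A(\tau_t)X_{t-1}+\boldsymbol\Sigma(\tau_t)^{1/2}\varepsilon_t,\qquad \tau_t=t/n,\quad 1\le t\le n,$$ where $\mathbf A(\cdot)=[\alpha_{ij}(\cdot)]$ and $\boldsymbol\Sigma(\cdot)$ are $d\times d$ matrix functions, $(\varepsilon_t)_{t\in\mathbb Z}$ are i.i.d. with mean zero and identity covariance, and $X_t$ is given by its Wold series $X_t=\sum_{k\ge0}\boldsymbol\Phi_{t,k}\boldsymbol\Sigma(\tau_{t-k})^{1/2}\varepsilon_{t-k}$ (almost surely), $\boldsymbol\Phi_{t,0}=\mathbf I$, $\boldsymbol\Phi_{t,k}=\mathbf A(\tau_t)\cdots\mathbf A(\tau_{t-k+1})$. The probability space, $d$, $\mathbf A$, $\boldsymbol\Sigma$ may depend on $n$; for the infinite past, $\mathbf A$ and $\boldsymbol\Sigma$ (positive semidefinite) are also defined at negative times. Put $\boldsymbol\Omega=\boldsymbol\Sigma^{-1}$ on $[0,1]$.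 Unless indexed by $n$, constants do not depend on $n$ or $d$. Let $\mathcal J_i(\tau)=\{j:\alpha_{ij}(\tau)\ne0\}$, $\mathcal J'_i(\tau)=\{j:\alpha'_{ij}(\tau)\neq0\}$, $\mathcal J_i=\bigcup_{t=1}^n\mathcal J_i(\tau_t)$, $\mathcal J_i'=\bigcup_{t=1}^n\mathcal J_i'(\tau_t)$, $s=\max_i|\mathcal J_i|$, and $D_{ij}^2=\sum_{t=1}^n[\alpha_{ij}(\tau_t)-\frac1n\sum_{r=1}^n\alpha_{ij}(\tau_r)]^2$. It is assumed that $s\ge1$ for all large $n$. Let $K_h(u)=h^{-1}K(u/h)$ and $$\mathcal L_i(\alpha,\beta\,|\,\tau)=\frac1n\sum_{t=1}^n\{x_{t,i}-[\alpha+\beta(\tau_t-\tau)]^\top X_{t-1}\}^2K_h(\tau_t-\tau).$$ The preliminary estimates $(\widetilde\alpha_{ij}(\tau_t))_j$ are the $\alpha$-part of any minimiser of $\mathcal L_i(\alpha,\beta|\tau_t)+\lambda_1(|\alpha|_1+h|\beta|_1)$; $\widetilde{\boldsymbol\alpha}_{i,j}=(\widetilde\alpha_{ij}(\tau_1),\dots,\widetilde\alpha_{ij}(\tau_n))$,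 and $\widetilde D_{ij}$ is $D_{ij}$ with $\alpha_{ij}$ replaced by $\widetilde\alpha_{ij}$. For $n\times d$ arrays $\mathbf A=(\alpha_{j|t})$, $\mathbf B=(\beta_{j|t})$ with rows $\boldsymbol\alpha_{\bullet t},\boldsymbol\beta_{\bullet t}$ and columns $\boldsymbol\alpha_j,\boldsymbol\beta_j$ let $$\mathcal Q_i(\mathbf A,\mathbf B)=\sum_{t=1}^n\mathcal L_i(\boldsymbol\alpha_{\bullet t},\boldsymbol\beta_{\bullet t}|\tau_t)+\sum_{j=1}^dp'_{\lambda_2}(\|\widetilde{\boldsymbol\alpha}_{i,j}\|)\|\boldsymbol\alpha_j\|+\sum_{j=1}^dp'_{\lambda_2}(\widetilde D_{ij})\|h\boldsymbol\beta_j\|,$$ with the SCAD derivative $p'_\lambda(z)=\lambda\big[I(z\le\lambda)+\frac{(a_0\lambda-z)_+}{(a_0-1)\lambda}I(z>\lambda)\big]$, $a_0=3.7$. The oracle estimate is the minimiser of $\mathcal Q_i$ over the arrays with $\alpha_{j|t}=0$ for $j\notin\mathcal J_i$ and $\beta_{j|t}=0$ for $j\notin\mathcal J_i'$. **Assumption 1.**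 (i) $\det(\mathbf I-z\mathbf A(\tau))\ne0$ for $\tau\in[0,1]$, $|z|\le1$; there are $C_1>0$, $0<\rho<1$ with $\|\boldsymbol\Phi_{t,k}\|\le C_1\rho^k$ for all $0\le t\le n$, $k\ge0$. The entries of $\mathbf A$ are $C^2$ on $[0,1]$. (ii) $\boldsymbol\Sigma(\tau)$ is positive definite on $[0,1]$, $\boldsymbol\Omega(\tau)\succeq c\,\mathbf I$ there for some $c>0$, $\|\boldsymbol\Sigma(\tau)\|$ is uniformly bounded over $\tau\le1$, and the entries of $\boldsymbol\Sigma$, $\boldsymbol\Omega$ are $C^2$ on $[0,1]$. The entries of $\mathbf A,\boldsymbol\Sigma,\boldsymbol\Omega$ and their first two derivatives on $[0,1]$ are bounded by one constant. (iii) $\mathsf E\exp\{\iota_1(u^\top\varepsilon_t)^2\}\le C_0$ for all unit vectors $u$, for some $\iota_1,C_0>0$. **Assumption 2.** (i) $K$ is a bounded, continuous, symmetric probability density supported in $[-1,1]$. (ii) $h>0$, $nh/\log^2(n\vee d)\to\infty$ and $sh^2\log(n\vee d)\to0$. **Assumption 3.** (i) $\lambda_1>0$, $\zeta_{n,d}:=\log(n\vee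 d)[(nh)^{-1/2}+sh^2]=o(\lambda_1)$ and $\sqrt s\lambda_1/h\to0$. (ii) Let $\boldsymbol\Psi(\tau)=\begin{pmatrix}\boldsymbol\Psi_0&\boldsymbol\Psi_1\\ \boldsymbol\Psi_1&\boldsymbol\Psi_2\end{pmatrix}(\tau)$, $\boldsymbol\Psi_k(\tau)=\frac1n\sum_{t=1}^n(\frac{\tau_t-\tau}h)^kX_{t-1}X_{t-1}^\top K_h(\tau_t-\tau)$. There is $\kappa_0>0$ such that with probability approaching one $u^\top\boldsymbol\Psi(\tau_t)u\ge\kappa_0$ for all $1\le i\le d$, $1\le t\le n$ and all $u=(u_1,u_2)\in\mathbb R^{2d}$ with $\|u_1\|^2+\|u_2\|^2=1$ and $|u_1|_1+|u_2|_1\le3\big(\sum_{j\in\mathcal J_i(\tau_t)}|u_{1,j}|+\sum_{j\in\mathcal J'_i(\tau_t)}|u_{2,j}|\big)$. **Assumption 4.** (i) $\lambda_2>0$ and $\sqrt n\,s\log(n\vee d)\zeta_{n,d}+\sqrt{ns}\,\lambda_1=o(\lambda_2)$. (ii) For all large $n$ and all $i$: $(\sum_{t=1}^n\alpha_{ij}^2(\tau_t))^{1/2}\ge(a_0+1)\lambda_2$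 for $j\in\mathcal J_i$, and $D_{ij}\ge(a_0+1)\lambda_2$ for $j\in\mathcal J'_i$. **Theorem 4.2.** Under Assumptions 1–4, with probability approaching one, simultaneously for all $1\le i\le d$, the objective $\mathcal Q_i$ has a unique minimiser $(\widehat{\mathbf A}_i,\widehat{\mathbf B}_i)$, the oracle estimate exists and is unique, and the two are equal. Moreover, writing $\widehat\alpha_{ij}(\tau_t)$ for the entries of $\widehat{\mathbf A}_i$, $$\max_{1\le i\le d}\frac1n\sum_{t=1}^n\sum_{j=1}^d[\widehat\alpha_{ij}(\tau_t)-\alpha_{ij}(\tau_t)]^2=O_P(s\,\zeta_{n,d}^2).$$ -/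

import Mathlib

open MeasureTheory ProbabilityTheory Filter Topology Asymptotics
open scoped Matrix MatrixOrder

namespace TvVAR

noncomputable section

/-! ### Time-varying VAR(1) array -/

/-- The scaled time `τ_t = t / n` of the integer time `t`. -/
def scaledTime (n : ℕ) (t : ℤ) : ℝ := (t : ℝ) / (n : ℝ)

/-- The Wold coefficient `Φ_{t,k} = A(τ_t) A(τ_{t-1}) ⋯ A(τ_{t-k+1})`, with `Φ_{t,0} = I`. -/
def woldCoef (n : ℕ) {d : ℕ} (A : ℝ → Matrix (Fin d) (Fin d) ℝ) (t : ℤ) :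
    ℕ → Matrix (Fin d) (Fin d) ℝ
  | 0 => 1
  | k + 1 => woldCoef n A t k * A (scaledTime n (t - k))

/-- The innovation `e_t = Σ(τ_t)^{1/2} ε_t`, with the positive semidefinite square root. -/
def innovation (n : ℕ) {d : ℕ} (Sigma : ℝ → Matrix (Fin d) (Fin d) ℝ) (t : ℤ)
    (eps : Fin d → ℝ) : Fin d → ℝ :=
  CFC.sqrt (Sigma (scaledTime n t)) *ᵥ eps

/-- The spectral (Euclidean operator) norm of a real square matrix. -/
def opNorm {d : ℕ} (M : Matrix (Fin d) (Fin d) ℝ) : ℝ := ‖Matrix.toEuclideanCLM (𝕜 := ℝ) M‖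

/-- For every sample size `n`, a `d n`-dimensional time-varying VAR(1) sample `X_0, …, X_n`
satisfying `X_t = A(t/n) X_{t-1} + Σ(t/n)^{1/2} ε_t` and given by its Wold series
`X_t = ∑_k Φ_{t,k} e_{t-k}`, where the `ε_t` are i.i.d. with mean zero and identity covariance.
The coefficient functions matter on `[0, 1]` and, through the infinite past in the Wold series,
at the pre-sample times `t / n`, `t < 0`. -/
structure Model (d : ℕ → ℕ) (Ω : ℕ → Type*) [∀ n, MeasurableSpace (Ω n)]
    (P : ∀ n, Measure (Ω n)) where
  /-- transition matrix function -/
  A : ∀ n, ℝ → Matrix (Fin (d n)) (Fin (d n)) ℝ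
  /-- volatility matrix function -/
  Sigma : ∀ n, ℝ → Matrix (Fin (d n)) (Fin (d n)) ℝ
  /-- standardised innovations -/
  eps : ∀ n, ℤ → Ω n → Fin (d n) → ℝ
  /-- observations -/
  X : ∀ n, ℕ → Ω n → Fin (d n) → ℝ
  Sigma_posSemidef : ∀ n τ, τ ≤ 1 → (Sigma n τ).PosSemidef
  eps_measurable : ∀ n t, Measurable (eps n t)
  eps_indep : ∀ n, iIndepFun (eps n) (P n)
  eps_identDistrib : ∀ n s t, IdentDistrib (eps n s) (eps n t) (P n) (P n)
  eps_mean : ∀ n t j, ∫ ω, eps n t ω j ∂(P n) = 0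
  eps_cov : ∀ n t j k, ∫ ω, eps n t ω j * eps n t ω k ∂(P n) = if j = k then 1 else 0
  X_measurable : ∀ n t, Measurable (X n t)
  X_recursion : ∀ n t, t < n → ∀ᵐ ω ∂(P n),
    X n (t + 1) ω = A n (scaledTime n ((t : ℤ) + 1)) *ᵥ X n t ω
      + innovation n (Sigma n) ((t : ℤ) + 1) (eps n ((t : ℤ) + 1) ω)
  X_wold : ∀ n t, t ≤ n → ∀ᵐ ω ∂(P n),
    HasSum (fun k : ℕ => woldCoef n (A n) (t : ℤ) k *ᵥ
      innovation n (Sigma n) ((t : ℤ) - k) (eps n ((t : ℤ) - k) ω)) (X n t ω)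

/-! ### Index sets of nonzero coefficients -/

/-- The grid point `τ_t`, where the index `t : Fin n` stands for time `t + 1`. -/
def gridPt (n : ℕ) (t : Fin n) : ℝ := (((t : ℕ) : ℝ) + 1) / (n : ℝ)

/-- The derivative `α'_{ij}(τ)` on `[0, 1]` (one-sided at the end points). -/
def coefDeriv {d : ℕ} (A : ℝ → Matrix (Fin d) (Fin d) ℝ) (i j : Fin d) (τ : ℝ) : ℝ :=
  derivWithin (fun x => A x i j) (Set.Icc 0 1) τ

/-- `J_i(τ)` -/
def activeAt {d : ℕ} (A : ℝ → Matrix (Fin d) (Fin d) ℝ) (i : Fin d) (τ : ℝ) : Set (Fin d) :=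
  {j | A τ i j ≠ 0}

/-- `J'_i(τ)` -/
def activeDerivAt {d : ℕ} (A : ℝ → Matrix (Fin d) (Fin d) ℝ) (i : Fin d) (τ : ℝ) :
    Set (Fin d) :=
  {j | coefDeriv A i j τ ≠ 0}

/-- `J_i = ⋃_t J_i(τ_t)` -/
def active (n : ℕ) {d : ℕ} (A : ℝ → Matrix (Fin d) (Fin d) ℝ) (i : Fin d) : Set (Fin d) :=
  ⋃ t : Fin n, activeAt A i (gridPt n t)

/-- `J'_i = ⋃_t J'_i(τ_t)` -/
def activeDeriv (n : ℕ) {d : ℕ} (A : ℝ → Matrix (Fin d) (Fin d) ℝ) (i : Fin d) :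
    Set (Fin d) :=
  ⋃ t : Fin n, activeDerivAt A i (gridPt n t)

/-- The sparsity index `s = max_i |J_i|`. -/
def sparsity (n : ℕ) {d : ℕ} (A : ℝ → Matrix (Fin d) (Fin d) ℝ) : ℕ :=
  Finset.univ.sup fun i : Fin d => (active n A i).ncard

/-! ### Objective functions. Here `x t` is the observed vector at time `t = 0, …, n`. -/

/-- `K_h(u) = K(u / h) / h` -/
def scaledKernel (K : ℝ → ℝ) (h u : ℝ) : ℝ := 1 / h * K (u / h)

/-- The local linear objective `L_i(α, β | τ)`. -/
def localLoss (n : ℕ) {d : ℕ} (K : ℝ → ℝ) (h : ℝ) (x : ℕ → Fin d → ℝ) (i : Fin d) (τ : ℝ)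
    (α β : Fin d → ℝ) : ℝ :=
  1 / (n : ℝ) * ∑ l : Fin n,
    (x ((l : ℕ) + 1) i - (α + (gridPt n l - τ) • β) ⬝ᵥ x l) ^ 2
      * scaledKernel K h (gridPt n l - τ)

/-- The LASSO-penalised local linear objective, as a function of `(α, β)`. -/
def lassoLoss (n : ℕ) {d : ℕ} (K : ℝ → ℝ) (h lam1 : ℝ) (x : ℕ → Fin d → ℝ) (i : Fin d)
    (τ : ℝ) (ab : (Fin d → ℝ) × (Fin d → ℝ)) : ℝ :=
  localLoss n K h x i τ ab.1 ab.2 + lam1 * (∑ j, |ab.1 j| + h * ∑ j, |ab.2 j|)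

/-- The SCAD constant. -/
def a0 : ℝ := 3.7

/-- The derivative of the SCAD penalty. -/
def scadDeriv (lam z : ℝ) : ℝ :=
  lam * ((if z ≤ lam then 1 else 0)
    + max (a0 * lam - z) 0 / ((a0 - 1) * lam) * (if lam < z then 1 else 0))

/-- Euclidean norm of a vector indexed by time. -/
def l2 {n : ℕ} (v : Fin n → ℝ) : ℝ := Real.sqrt (∑ t, v t ^ 2)

/-- Euclidean norm of the deviations from the time average. -/
def devNorm {n : ℕ} (v : Fin n → ℝ) : ℝ := l2 fun t => v t - 1 / (n : ℝ) * ∑ s, v s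

/-- The pairs `(A, B)` of `n × d` arrays, `A t j = α_{j|t}` and `B t j = β_{j|t}`. -/
abbrev Arrays (n d : ℕ) := (Fin n → Fin d → ℝ) × (Fin n → Fin d → ℝ)

/-- The global objective `Q_i(A, B)` with SCAD-weighted group LASSO; the weights are computed
from the preliminary estimates `pre t j` of `α_{ij}(τ_t)`. -/
def groupLoss (n : ℕ) {d : ℕ} (K : ℝ → ℝ) (h lam2 : ℝ) (x : ℕ → Fin d → ℝ) (i : Fin d)
    (pre : Fin n → Fin d → ℝ) (AB : Arrays n d) : ℝ :=
  ∑ t, localLoss n K h x i (gridPt n t) (AB.1 t) (AB.2 t)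
    + ∑ j, scadDeriv lam2 (l2 fun t => pre t j) * l2 (fun t => AB.1 t j)
    + ∑ j, scadDeriv lam2 (devNorm fun t => pre t j) * l2 (fun t => h * AB.2 t j)

/-- The constraint set of the oracle estimate: `α_{j|t} = 0` for `j ∉ J_i` and `β_{j|t} = 0`
for `j ∉ J'_i`. -/
def oracleSet (n : ℕ) {d : ℕ} (A : ℝ → Matrix (Fin d) (Fin d) ℝ) (i : Fin d) :
    Set (Arrays n d) :=
  {AB | (∀ t j, j ∉ active n A i → AB.1 t j = 0) ∧
    (∀ t j, j ∉ activeDeriv n A i → AB.2 t j = 0)}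

/-- The averaged squared error `n⁻¹ ∑_t ∑_j (a t j - α_{ij}(τ_t))²`. -/
def avgSqError (n : ℕ) {d : ℕ} (A : ℝ → Matrix (Fin d) (Fin d) ℝ) (i : Fin d)
    (a : Fin n → Fin d → ℝ) : ℝ :=
  1 / (n : ℝ) * ∑ t, ∑ j, (a t j - A (gridPt n t) i j) ^ 2

/-! ### Restricted eigenvalues -/

/-- `Ψ_k(τ)` -/
def psiBlock (n : ℕ) {d : ℕ} (K : ℝ → ℝ) (h : ℝ) (x : ℕ → Fin d → ℝ) (τ : ℝ) (k : ℕ) :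
    Matrix (Fin d) (Fin d) ℝ :=
  (1 / (n : ℝ)) • ∑ l : Fin n,
    (((gridPt n l - τ) / h) ^ k * scaledKernel K h (gridPt n l - τ)) •
      Matrix.vecMulVec (x l) (x l)

/-- `Ψ(τ)` -/
def psi (n : ℕ) {d : ℕ} (K : ℝ → ℝ) (h : ℝ) (x : ℕ → Fin d → ℝ) (τ : ℝ) :
    Matrix (Fin d ⊕ Fin d) (Fin d ⊕ Fin d) ℝ :=
  Matrix.fromBlocks (psiBlock n K h x τ 0) (psiBlock n K h x τ 1)
    (psiBlock n K h x τ 1) (psiBlock n K h x τ 2)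

/-- The cone section `B_i(τ)`, with `u = (u₁, u₂)`. -/
def cone {d : ℕ} (A : ℝ → Matrix (Fin d) (Fin d) ℝ) (i : Fin d) (τ : ℝ) :
    Set (Fin d ⊕ Fin d → ℝ) :=
  {u | ∑ j, u (Sum.inl j) ^ 2 + ∑ j, u (Sum.inr j) ^ 2 = 1 ∧
    ∑ j, (|u (Sum.inl j)| + |u (Sum.inr j)|) ≤
      3 * (∑ j, (activeAt A i τ).indicator (fun j => |u (Sum.inl j)|) j
        + ∑ j, (activeDerivAt A i τ).indicator (fun j => |u (Sum.inr j)|) j)}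

/-! ### Stochastic order -/

/-- The events `E n` hold with probability approaching one (outer probability, so that no
measurability of `E n` is needed). -/
def Wpa1 {Ω : ℕ → Type*} [∀ n, MeasurableSpace (Ω n)] (P : ∀ n, Measure (Ω n))
    (E : ∀ n, Ω n → Prop) : Prop :=
  Tendsto (fun n => P n {ω | ¬ E n ω}) atTop (𝓝 0)

/-- `Z n = O_P(r n)`. -/
def IsBigOP {Ω : ℕ → Type*} [∀ n, MeasurableSpace (Ω n)] (P : ∀ n, Measure (Ω n))
    (Z : ∀ n, Ω n → ℝ) (r : ℕ → ℝ) : Prop :=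
  ∀ ε : ℝ, 0 < ε → ∃ C : ℝ, 0 < C ∧
    ∀ᶠ n in atTop, P n {ω | C * r n < |Z n ω|} ≤ ENNReal.ofReal ε

/-! ### Conditions -/

variable {d : ℕ → ℕ} {Ω : ℕ → Type*} [∀ n, MeasurableSpace (Ω n)] {P : ∀ n, Measure (Ω n)}

/-- `log (n ∨ d)` -/
def logDim (d : ℕ → ℕ) (n : ℕ) : ℝ := Real.log (max n (d n) : ℕ)

/-- The rate `ζ_{n,d} = log(n ∨ d) [(n h)^{-1/2} + s h²]`. -/
def zeta (M : Model d Ω P) (h : ℕ → ℝ) (n : ℕ) : ℝ :=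
  logDim d n * (1 / Real.sqrt (n * h n) + (sparsity n (M.A n) : ℝ) * h n ^ 2)

/-- Every entry of `F n` is twice continuously differentiable on `[0, 1]`, uniformly: the entries
and their first two derivatives are bounded by one constant for all `n` and all entries. -/
def UnifC2 {d : ℕ → ℕ} (F : ∀ n, ℝ → Matrix (Fin (d n)) (Fin (d n)) ℝ) : Prop :=
  (∀ n i j, ContDiffOn ℝ 2 (fun τ => F n τ i j) (Set.Icc 0 1)) ∧
  ∃ C : ℝ, ∀ n i j, ∀ m ≤ 2, ∀ τ ∈ Set.Icc (0 : ℝ) 1,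
    |iteratedDerivWithin m (fun τ => F n τ i j) (Set.Icc 0 1) τ| ≤ C

/-- Stability, smoothness and sub-Gaussian moments. All constants are uniform in `n` (hence in
the dimension) and in the matrix entries. The precision matrix is `Ω(τ) = Σ(τ)⁻¹`. -/
structure RegularModel (M : Model d Ω P) : Prop where
  stable : ∀ n, ∀ τ ∈ Set.Icc (0 : ℝ) 1, ∀ z : ℂ, ‖z‖ ≤ 1 →
    (1 - z • (M.A n τ).map (fun a : ℝ => (a : ℂ))).det ≠ 0
  wold_decay : ∃ C₁ ρ : ℝ, 0 < C₁ ∧ 0 < ρ ∧ ρ < 1 ∧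
    ∀ (n t : ℕ), t ≤ n → ∀ k : ℕ, opNorm (woldCoef n (M.A n) (t : ℤ) k) ≤ C₁ * ρ ^ k
  A_smooth : UnifC2 M.A
  Sigma_posDef : ∀ n, ∀ τ ∈ Set.Icc (0 : ℝ) 1, (M.Sigma n τ).PosDef
  Omega_unif_posDef : ∃ c : ℝ, 0 < c ∧ ∀ n, ∀ τ ∈ Set.Icc (0 : ℝ) 1,
    ∀ v : Fin (d n) → ℝ, c * (v ⬝ᵥ v) ≤ v ⬝ᵥ ((M.Sigma n τ)⁻¹ *ᵥ v)
  Sigma_bdd : ∃ C : ℝ, ∀ n, ∀ τ ≤ (1 : ℝ), opNorm (M.Sigma n τ) ≤ C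
  Sigma_smooth : UnifC2 M.Sigma
  Omega_smooth : UnifC2 (fun n τ => (M.Sigma n τ)⁻¹)
  subGaussian : ∃ ι₁ C₀ : ℝ, 0 < ι₁ ∧ 0 < C₀ ∧ ∀ n t, ∀ u : Fin (d n) → ℝ, u ⬝ᵥ u = 1 →
    ∫⁻ ω, ENNReal.ofReal (Real.exp (ι₁ * (u ⬝ᵥ M.eps n t ω) ^ 2)) ∂(P n) ≤ ENNReal.ofReal C₀

/-- `K` is a bounded, continuous, symmetric probability density supported in `[-1, 1]`. -/
structure KernelCond (K : ℝ → ℝ) : Prop where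
  nonneg : ∀ x, 0 ≤ K x
  bdd : ∃ C : ℝ, ∀ x, K x ≤ C
  cont : Continuous K
  symm : ∀ x, K (-x) = K x
  integral_one : ∫ x, K x = 1
  support : ∀ x, x ∉ Set.Icc (-1 : ℝ) 1 → K x = 0

/-- Bandwidth conditions. -/
structure BandwidthCond (M : Model d Ω P) (h : ℕ → ℝ) : Prop where
  pos : ∀ n, 0 < h n
  effective_size : Tendsto (fun n : ℕ => n * h n / logDim d n ^ 2) atTop atTop
  small : Tendsto (fun n : ℕ => (sparsity n (M.A n) : ℝ) * h n ^ 2 * logDim d n) atTop (𝓝 0)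

/-- Conditions on the LASSO tuning parameter and the uniform restricted eigenvalue condition. -/
structure LassoCond (M : Model d Ω P) (K : ℝ → ℝ) (h lam1 : ℕ → ℝ) : Prop where
  pos : ∀ n, 0 < lam1 n
  rate : zeta M h =o[atTop] lam1
  small : Tendsto (fun n : ℕ => Real.sqrt (sparsity n (M.A n)) * lam1 n / h n) atTop (𝓝 0)
  restricted_eigenvalue : ∃ κ₀ : ℝ, 0 < κ₀ ∧ Wpa1 P fun n ω =>
    ∀ (i : Fin (d n)) (t : Fin n), ∀ u ∈ cone (M.A n) i (gridPt n t),
      κ₀ ≤ u ⬝ᵥ (psi n K (h n) (fun l => M.X n l ω) (gridPt n t) *ᵥ u)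

/-- Conditions on the SCAD tuning parameter and the minimal signal strength. -/
structure ScadCond (M : Model d Ω P) (h lam1 lam2 : ℕ → ℝ) : Prop where
  pos : ∀ n, 0 < lam2 n
  rate : (fun n : ℕ => Real.sqrt n * (sparsity n (M.A n) : ℝ) * logDim d n * zeta M h n
    + Real.sqrt (n * (sparsity n (M.A n) : ℝ)) * lam1 n) =o[atTop] lam2
  signal : ∀ᶠ n in atTop, ∀ i, ∀ j ∈ active n (M.A n) i,
    (a0 + 1) * lam2 n ≤ l2 fun t : Fin n => M.A n (gridPt n t) i j
  signal_deriv : ∀ᶠ n in atTop, ∀ i, ∀ j ∈ activeDeriv n (M.A n) i,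
    (a0 + 1) * lam2 n ≤ devNorm fun t : Fin n => M.A n (gridPt n t) i j

/-- `(preA n ω i t, preB n ω i t)` are preliminary time-varying LASSO estimates at `τ_t`:
minimisers of the LASSO-penalised local linear objective. -/
def IsPrelim (M : Model d Ω P) (K : ℝ → ℝ) (h lam1 : ℕ → ℝ)
    (preA preB : ∀ n, Ω n → Fin (d n) → Fin n → Fin (d n) → ℝ) : Prop :=
  ∀ n ω i t, IsMinOn
    (lassoLoss n K (h n) (lam1 n) (fun l => M.X n l ω) i (gridPt n t)) Set.univ
    (preA n ω i t, preB n ω i t)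

/-- The random objective `Q_i`. -/
def objective (M : Model d Ω P) (K : ℝ → ℝ) (h lam2 : ℕ → ℝ)
    (preA : ∀ n, Ω n → Fin (d n) → Fin n → Fin (d n) → ℝ) (n : ℕ) (ω : Ω n)
    (i : Fin (d n)) : Arrays n (d n) → ℝ :=
  groupLoss n K (h n) (lam2 n) (fun l => M.X n l ω) i (preA n ω i)

end

end TvVAR

namespace TvVAR

noncomputable section

/-! ### Weighted least squares -/

section WeightedLeastSquares

variable {ι T : Type*} [Fintype ι] [Fintype T]

/-! The proof separates a deterministic statement about one sample (`GoodSample.oracle`) from the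
probability that the sample is good (`RegularModel.wpa1_goodSample`).

Deterministic part. With slopes multiplied by `h`, each local linear fit is a weighted least squares
problem with regressors `x_l` and `((τ_l - τ_t)/h) x_l`, so the objective is a sum of such problems
over `t` plus a weighted group penalty. The restricted eigenvalue condition bounds the LASSO error
by a multiple of `√s λ₁` at each grid point, hence by a multiple of `√(ns) λ₁ = o(λ₂)` for a whole
column. Together with the minimal signal this makes every SCAD weight exactly `0` on the relevant
coordinates `S` and exactly `λ₂` off them. A coefficient whose derivative vanishes on the grid moves
by at most a constant over `n²` per step, so its slope group also receives weight `λ₂`. It remains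
to take the least squares fit restricted to `S` and to check that its score off `S` is below `λ₂/4`
in group norm. The loss is exactly quadratic, so this makes the restricted fit the strict global
minimiser, which gives existence, uniqueness and the oracle property at once.

Sup-norm rate. The score test needs the restricted fit to be within a multiple of `ζ` of the truth
in every coordinate. The expected local Gram form dominates each squared coordinate, because the
diagonal of the precision matrix is bounded and the kernel design is nondegenerate. Hence it has
nonrandom dual vectors on `S` with bounded entries and bounded energy (`exists_dual_vector`).
Testing the score against a dual vector costs no factor `s`. The sample Gram matrix differs from the
expected one by at most `1/(4s)` in these pairings, and since `|S| ≤ 2s` the discrepancy is absorbed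
(`sup_le_of_approx_inverse`). The required smallness of `s log² / √(nh)` is implied by the tuning
condition: active coefficients are bounded, so `λ₂ = O(√n)`.

Probability part. The Wold series is cut after a multiple of `log (n ∨ d)` lags, and the remainder
is sub-Gaussian with geometrically small scale. The truncated process depends on finitely many
innovations, so Gram entries split over residue classes into sums of independent sub-exponential
terms (`SubGInnov.gram_bound`). Noise sums are martingale transforms with truncated predictable
coefficients (`SubGInnov.noise_bound`). All tails are taken at `(n ∨ d)^(-6)`, against a union over
`O((n ∨ d)^5)` events. -/

/-- The weighted sum of squared residuals. -/
def wls (κ : ι → ℝ) (f : ι → T → ℝ) (y : ι → ℝ) (θ : T → ℝ) : ℝ :=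
  ∑ l, κ l * (y l - f l ⬝ᵥ θ) ^ 2

/-- Minus one half of the gradient of `wls`. -/
def score (κ : ι → ℝ) (f : ι → T → ℝ) (y : ι → ℝ) (θ : T → ℝ) (q : T) : ℝ :=
  ∑ l, κ l * (f l q * (y l - f l ⬝ᵥ θ))

/-- The quadratic form of the weighted Gram matrix. -/
def energy (κ : ι → ℝ) (f : ι → T → ℝ) (u : T → ℝ) : ℝ :=
  ∑ l, κ l * (f l ⬝ᵥ u) ^ 2

/-- The weighted Gram matrix applied to a vector. -/
def gram (κ : ι → ℝ) (f : ι → T → ℝ) (u : T → ℝ) (q : T) : ℝ :=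
  ∑ l, κ l * (f l q * (f l ⬝ᵥ u))

lemma sum_mul_score (κ : ι → ℝ) (f : ι → T → ℝ) (y : ι → ℝ) (θ u : T → ℝ) :
    ∑ q, u q * score κ f y θ q = ∑ l, κ l * ((f l ⬝ᵥ u) * (y l - f l ⬝ᵥ θ)) := by
  simp only [score, Finset.mul_sum]
  rw [Finset.sum_comm]
  refine Finset.sum_congr rfl fun l _ => ?_
  simp only [dotProduct, Finset.sum_mul, Finset.mul_sum]
  refine Finset.sum_congr rfl fun q _ => ?_
  ring

lemma sum_mul_gram (κ : ι → ℝ) (f : ι → T → ℝ) (u v : T → ℝ) :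
    ∑ q, v q * gram κ f u q = ∑ l, κ l * ((f l ⬝ᵥ v) * (f l ⬝ᵥ u)) := by
  simp only [gram, Finset.mul_sum]
  rw [Finset.sum_comm]
  refine Finset.sum_congr rfl fun l _ => ?_
  rw [show f l ⬝ᵥ v = ∑ q, f l q * v q from rfl, Finset.sum_mul, Finset.mul_sum]
  refine Finset.sum_congr rfl fun q _ => ?_
  ring

/-- The loss is quadratic, so the second order expansion is exact. Both the LASSO inequality and the
optimality of the oracle fit rest on it, without any subgradient calculus. -/
lemma wls_add (κ : ι → ℝ) (f : ι → T → ℝ) (y : ι → ℝ) (θ u : T → ℝ) :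
    wls κ f y (θ + u) = wls κ f y θ - 2 * ∑ q, u q * score κ f y θ q + energy κ f u := by
  rw [sum_mul_score, wls, wls, energy, Finset.mul_sum, ← Finset.sum_sub_distrib,
    ← Finset.sum_add_distrib]
  refine Finset.sum_congr rfl fun l _ => ?_
  rw [dotProduct_add]
  ring

lemma score_add (κ : ι → ℝ) (f : ι → T → ℝ) (y : ι → ℝ) (θ u : T → ℝ) (q : T) :
    score κ f y (θ + u) q = score κ f y θ q - gram κ f u q := by
  rw [score, score, gram, ← Finset.sum_sub_distrib]
  refine Finset.sum_congr rfl fun l _ => ?_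
  rw [dotProduct_add]
  ring

lemma energy_nonneg {κ : ι → ℝ} (hκ : ∀ l, 0 ≤ κ l) (f : ι → T → ℝ) (u : T → ℝ) :
    0 ≤ energy κ f u :=
  Finset.sum_nonneg fun l _ => mul_nonneg (hκ l) (sq_nonneg _)

lemma energy_smul (κ : ι → ℝ) (f : ι → T → ℝ) (c : ℝ) (u : T → ℝ) :
    energy κ f (c • u) = c ^ 2 * energy κ f u := by
  rw [energy, energy, Finset.mul_sum]
  refine Finset.sum_congr rfl fun l _ => ?_
  rw [dotProduct_smul, smul_eq_mul]
  ring

/-- A vanishing quadratic form forces the Gram matrix to annihilate the vector. -/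
lemma gram_eq_zero_of_energy_eq_zero {κ : ι → ℝ} (hκ : ∀ l, 0 ≤ κ l) {f : ι → T → ℝ}
    {u : T → ℝ} (hu : energy κ f u = 0) (q : T) : gram κ f u q = 0 := by
  have h := (Finset.sum_eq_zero_iff_of_nonneg
    (fun l _ => mul_nonneg (hκ l) (sq_nonneg (f l ⬝ᵥ u)))).1 hu
  refine Finset.sum_eq_zero fun l hl => ?_
  rcases mul_eq_zero.1 (h l hl) with h0 | h0
  · simp [h0]
  · simp [pow_eq_zero_iff (two_ne_zero) |>.1 h0]

/-- Squared `ℓ²` error of the LASSO under a restricted eigenvalue condition. -/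
theorem lasso_l2_error [DecidableEq T] {κ : ι → ℝ} (hκ : ∀ l, 0 ≤ κ l) {f : ι → T → ℝ}
    {y : ι → ℝ} {θ θh : T → ℝ} {lam κ₀ : ℝ} (hκ₀ : 0 < κ₀) (hlam : 0 < lam) (S : Finset T)
    (hθ : ∀ q, q ∉ S → θ q = 0)
    (hmin : wls κ f y θh + lam * ∑ q, |θh q| ≤ wls κ f y θ + lam * ∑ q, |θ q|)
    (hscore : ∀ q, |score κ f y θ q| ≤ lam / 6)
    (hRE : ∀ u : T → ℝ, ∑ q, u q ^ 2 = 1 → ∑ q, |u q| ≤ 3 * ∑ q ∈ S, |u q| →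
      κ₀ ≤ energy κ f u) :
    ∑ q, (θh q - θ q) ^ 2 ≤ 16 / 9 * lam ^ 2 * S.card / κ₀ ^ 2 := by
  set u : T → ℝ := θh - θ with hu
  have hsum : ∀ q, (θh q - θ q) = u q := fun q => rfl
  change ∑ q, u q ^ 2 ≤ _
  have hθh : θh = θ + u := by simp [hu]
  set a := ∑ q ∈ S, |u q| with ha
  set b := ∑ q ∈ Sᶜ, |u q| with hb
  have hab : ∑ q, |u q| = a + b := (Finset.sum_add_sum_compl S _).symm
  have ha0 : 0 ≤ a := Finset.sum_nonneg fun _ _ => abs_nonneg _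
  have hb0 : 0 ≤ b := Finset.sum_nonneg fun _ _ => abs_nonneg _
  have hlin : ∑ q, u q * score κ f y θ q ≤ lam / 6 * (a + b) := by
    rw [← hab, Finset.mul_sum]
    refine Finset.sum_le_sum fun q _ => ?_
    calc u q * score κ f y θ q ≤ |u q * score κ f y θ q| := le_abs_self _
      _ = |score κ f y θ q| * |u q| := by rw [abs_mul, mul_comm]
      _ ≤ lam / 6 * |u q| := by gcongr; exact hscore q
  have hpen : ∑ q, |θ q| - ∑ q, |θh q| ≤ a - b := by
    rw [← Finset.sum_add_sum_compl S, ← Finset.sum_add_sum_compl S (fun q => |θh q|)]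
    have h1 : ∑ q ∈ S, |θ q| - ∑ q ∈ S, |θh q| ≤ a := by
      rw [← Finset.sum_sub_distrib]
      refine Finset.sum_le_sum fun q _ => ?_
      have := abs_sub_abs_le_abs_sub (θ q) (θh q)
      rwa [abs_sub_comm, hsum] at this
    have h2 : ∑ q ∈ Sᶜ, |θ q| = 0 :=
      Finset.sum_eq_zero fun q hq => by rw [hθ q (Finset.mem_compl.1 hq), abs_zero]
    have h3 : ∑ q ∈ Sᶜ, |θh q| = b := by
      refine Finset.sum_congr rfl fun q hq => ?_
      rw [← hsum, hθ q (Finset.mem_compl.1 hq), sub_zero]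
    linarith
  -- The score enters twice, so it costs `lam / 3 * (a + b)`, against a penalty gain of `lam * (a -
  -- b)`. The constant `6` is what turns this into `b ≤ 2 * a`, which is the cone with constant `3`.
  have hen : energy κ f u + 2 / 3 * lam * b ≤ 4 / 3 * lam * a := by
    rw [hθh, wls_add, ← hθh] at hmin
    have := mul_le_mul_of_nonneg_left hpen hlam.le
    nlinarith
  have hen0 := energy_nonneg hκ f u
  have hba : b ≤ 2 * a := by
    have : lam * b ≤ lam * (2 * a) := by nlinarith
    exact le_of_mul_le_mul_left this hlam
  set N := ∑ q, u q ^ 2 with hN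
  have hN0 : 0 ≤ N := Finset.sum_nonneg fun _ _ => sq_nonneg _
  rcases hN0.eq_or_lt with h0 | hNpos
  · rw [← h0]
    exact div_nonneg (mul_nonneg (by positivity) (Nat.cast_nonneg _)) (sq_nonneg _)
  have hr : 0 < Real.sqrt N := Real.sqrt_pos.2 hNpos
  have hrsq : Real.sqrt N ^ 2 = N := Real.sq_sqrt hN0
  -- The eigenvalue condition is given on the unit sphere only. It is applied to `u / √N` and scaled
  -- back by homogeneity.
  have hkey : κ₀ * N ≤ energy κ f u := by
    have h1 := hRE ((Real.sqrt N)⁻¹ • u) ?_ ?_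
    · rw [energy_smul, inv_pow, hrsq, inv_mul_eq_div, le_div_iff₀ hNpos] at h1
      exact h1
    · simp only [Pi.smul_apply, smul_eq_mul, mul_pow, ← Finset.mul_sum]
      rw [inv_pow, hrsq, ← hN, inv_mul_cancel₀ hNpos.ne']
    · simp only [Pi.smul_apply, smul_eq_mul, abs_mul, ← Finset.mul_sum]
      rw [hab, ← ha, abs_of_pos (inv_pos.2 hr), mul_left_comm]
      gcongr
      linarith
  have hcs : a ^ 2 ≤ S.card * N := by
    calc a ^ 2 ≤ S.card * ∑ q ∈ S, |u q| ^ 2 := sq_sum_le_card_mul_sum_sq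
      _ ≤ S.card * N := by
        refine mul_le_mul_of_nonneg_left ?_ (Nat.cast_nonneg _)
        simp only [sq_abs]
        exact Finset.sum_le_sum_of_subset_of_nonneg (Finset.subset_univ _)
          fun _ _ _ => sq_nonneg _
  have h4 : κ₀ * N ≤ 4 / 3 * lam * a := by nlinarith [mul_nonneg hlam.le hb0]
  have h5 : (κ₀ * N) ^ 2 ≤ (4 / 3 * lam * a) ^ 2 := by
    apply pow_le_pow_left₀ (by positivity) h4
  rw [le_div_iff₀ (by positivity)]
  have h6 : (N * κ₀ ^ 2) * N ≤ (16 / 9 * lam ^ 2 * S.card) * N := by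
    calc (N * κ₀ ^ 2) * N = (κ₀ * N) ^ 2 := by ring
      _ ≤ (4 / 3 * lam * a) ^ 2 := h5
      _ = 16 / 9 * lam ^ 2 * a ^ 2 := by ring
      _ ≤ 16 / 9 * lam ^ 2 * (S.card * N) :=
        mul_le_mul_of_nonneg_left hcs (by positivity)
      _ = _ := by ring
  exact le_of_mul_le_mul_right h6 hNpos

/-- If `g q`, `q ∈ S`, are approximate dual vectors for the Gram matrix restricted to `S`, then
the sup norm of a vector supported on `S` is controlled by its image. -/
lemma sup_le_of_approx_inverse {κ : ι → ℝ} {f : ι → T → ℝ} [DecidableEq T] {S : Finset T}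
    {g : T → T → ℝ} {δ : ℝ} (hδ : S.card * δ ≤ 1 / 2)
    (hgram : ∀ q ∈ S, ∀ q' ∈ S, |gram κ f (g q) q' - if q = q' then 1 else 0| ≤ δ)
    {u : T → ℝ} (hu : ∀ q, q ∉ S → u q = 0) {z : ℝ}
    (hz : ∀ q ∈ S, |∑ q', g q q' * gram κ f u q'| ≤ z) : ∀ q ∈ S, |u q| ≤ 2 * z := by
  rcases S.eq_empty_or_nonempty with rfl | hS
  · simp
  -- At the largest coordinate the Gram error is at most `card S * δ * |u q₀| ≤ |u q₀| / 2`, so it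
  -- is absorbed by the left-hand side. This is the source of the factor `2` in the bound.
  obtain ⟨q₀, hq₀, hmax⟩ := S.exists_max_image (fun q => |u q|) hS
  have h1 : ∑ q', g q₀ q' * gram κ f u q' = ∑ q', u q' * gram κ f (g q₀) q' := by
    rw [sum_mul_gram, sum_mul_gram]
    exact Finset.sum_congr rfl fun l _ => by ring
  have h2 : ∑ q', u q' * gram κ f (g q₀) q' - u q₀
      = ∑ q' ∈ S, u q' * (gram κ f (g q₀) q' - if q₀ = q' then 1 else 0) := by
    simp only [mul_sub, Finset.sum_sub_distrib, mul_ite, mul_one, mul_zero,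
      Finset.sum_ite_eq, hq₀, if_true]
    congr 1
    refine (Finset.sum_subset (Finset.subset_univ S) fun q _ hq => ?_).symm
    rw [hu q hq, zero_mul]
  have h3 : |∑ q', u q' * gram κ f (g q₀) q' - u q₀| ≤ |u q₀| / 2 := by
    rw [h2]
    calc |∑ q' ∈ S, u q' * (gram κ f (g q₀) q' - if q₀ = q' then 1 else 0)|
        ≤ ∑ q' ∈ S, |u q₀| * δ := by
          refine (Finset.abs_sum_le_sum_abs _ _).trans (Finset.sum_le_sum fun q' hq' => ?_)
          rw [abs_mul]
          exact mul_le_mul (hmax q' hq') (hgram q₀ hq₀ q' hq') (abs_nonneg _) (abs_nonneg _)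
      _ = |u q₀| * (S.card * δ) := by rw [Finset.sum_const, nsmul_eq_mul]; ring
      _ ≤ |u q₀| * (1 / 2) := by gcongr
      _ = |u q₀| / 2 := by ring
  have h4 := hz q₀ hq₀
  rw [h1] at h4
  have h5 : |u q₀| ≤ 2 * z := by
    rw [abs_le] at h3 h4
    rcases abs_cases (u q₀) with ⟨h, _⟩ | ⟨h, _⟩ <;> rw [h] at h3 ⊢ <;> linarith
  exact fun q hq => (hmax q hq).trans h5

/-- A vector supported on `S` with vanishing quadratic form is zero. -/
lemma eq_zero_of_energy_eq_zero {κ : ι → ℝ} (hκ : ∀ l, 0 ≤ κ l) {f : ι → T → ℝ}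
    [DecidableEq T] {S : Finset T} {g : T → T → ℝ} {δ : ℝ} (hδ : S.card * δ ≤ 1 / 2)
    (hgram : ∀ q ∈ S, ∀ q' ∈ S, |gram κ f (g q) q' - if q = q' then 1 else 0| ≤ δ)
    {u : T → ℝ} (hu : ∀ q, q ∉ S → u q = 0) (h0 : energy κ f u = 0) : u = 0 := by
  funext q
  by_cases hq : q ∈ S
  · have h := sup_le_of_approx_inverse hδ hgram hu (z := 0) (fun q _ => by
      simp [gram_eq_zero_of_energy_eq_zero hκ h0]) q hq
    simpa using h
  · exact hu q hq

/-- Existence and sup-norm error of the least squares estimate restricted to `S`. -/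
theorem exists_restricted_lsq {κ : ι → ℝ} {f : ι → T → ℝ} {y : ι → ℝ}
    [DecidableEq T] {S : Finset T} {g : T → T → ℝ} {δ z : ℝ} (hδ : S.card * δ ≤ 1 / 2)
    (hgsupp : ∀ q ∈ S, ∀ q', q' ∉ S → g q q' = 0)
    (hgram : ∀ q ∈ S, ∀ q' ∈ S, |gram κ f (g q) q' - if q = q' then 1 else 0| ≤ δ)
    {θ : T → ℝ} (hθ : ∀ q, q ∉ S → θ q = 0)
    (hz : ∀ q ∈ S, |∑ q', g q q' * score κ f y θ q'| ≤ z) :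
    ∃ θh : T → ℝ, (∀ q, q ∉ S → θh q = 0) ∧ (∀ q ∈ S, score κ f y θh q = 0) ∧
      ∀ q ∈ S, |θh q - θ q| ≤ 2 * z := by
  let mask : (T → ℝ) →ₗ[ℝ] (T → ℝ) :=
    { toFun := fun u q => if q ∈ S then u q else 0
      map_add' := fun u v => by funext q; simp only [Pi.add_apply]; split_ifs <;> simp
      map_smul' := fun c u => by funext q; simp }
  let gr : (T → ℝ) →ₗ[ℝ] (T → ℝ) :=
    { toFun := fun u q => gram κ f u q
      map_add' := fun u v => by
        funext q
        simp only [gram, Pi.add_apply, ← Finset.sum_add_distrib, dotProduct_add]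
        exact Finset.sum_congr rfl fun l _ => by ring
      map_smul' := fun c u => by
        funext q
        simp only [gram, Pi.smul_apply, smul_eq_mul, Finset.mul_sum, dotProduct_smul,
          RingHom.id_apply]
        exact Finset.sum_congr rfl fun l _ => by ring }
  -- The normal equations on `S`, completed by the identity off `S` so as to be an endomorphism.
  -- Injectivity follows from the sup bound with `z = 0`, and finite dimension then gives
  -- surjectivity.
  let F : (T → ℝ) →ₗ[ℝ] (T → ℝ) := mask ∘ₗ gr ∘ₗ mask + (LinearMap.id - mask)
  have hF : ∀ u q, F u q = if q ∈ S then gram κ f (mask u) q else u q := by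
    intro u q
    simp only [F, mask, gr, LinearMap.add_apply, LinearMap.sub_apply, LinearMap.comp_apply,
      LinearMap.id_apply, LinearMap.coe_mk, AddHom.coe_mk, Pi.add_apply, Pi.sub_apply]
    split_ifs <;> simp
  have hmask : ∀ u q, q ∉ S → mask u q = 0 := fun u q hq => by simp [mask, hq]
  have hmask' : ∀ u q, q ∈ S → mask u q = u q := fun u q hq => by simp [mask, hq]
  have hinj : Function.Injective F := by
    rw [← LinearMap.ker_eq_bot, LinearMap.ker_eq_bot']
    intro u hu
    have hu' : ∀ q, F u q = 0 := fun q => by rw [hu]; rfl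
    have h := sup_le_of_approx_inverse (u := mask u) (z := 0) hδ hgram (hmask u) ?_
    · funext q
      by_cases hq : q ∈ S
      · have := h q hq
        rw [hmask' u q hq] at this
        simpa using this
      · have := hu' q
        rwa [hF, if_neg hq] at this
    · intro q hq
      rw [Finset.sum_eq_zero, abs_zero]
      intro q' _
      by_cases hq' : q' ∈ S
      · have := hu' q'
        rw [hF, if_pos hq'] at this
        rw [this, mul_zero]
      · rw [hgsupp q hq q' hq', zero_mul]
  obtain ⟨u, hu⟩ := (LinearMap.injective_iff_surjective.1 hinj)
    (fun q => if q ∈ S then score κ f y θ q else 0)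
  have hu1 : ∀ q ∈ S, gram κ f (mask u) q = score κ f y θ q := by
    intro q hq
    have := congrFun hu q
    rwa [hF, if_pos hq, if_pos hq] at this
  refine ⟨θ + mask u, fun q hq => ?_, fun q hq => ?_, ?_⟩
  · rw [Pi.add_apply, hθ q hq, hmask u q hq, add_zero]
  · rw [score_add, hu1 q hq, sub_self]
  · have h := sup_le_of_approx_inverse (u := mask u) (z := z) hδ hgram (hmask u) ?_
    · intro q hq
      simpa using h q hq
    · intro q hq
      have : ∑ q', g q q' * gram κ f (mask u) q' = ∑ q', g q q' * score κ f y θ q' := by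
        refine Finset.sum_congr rfl fun q' _ => ?_
        by_cases hq' : q' ∈ S
        · rw [hu1 q' hq']
        · rw [hgsupp q hq q' hq', zero_mul, zero_mul]
      rw [this]
      exact hz q hq

end WeightedLeastSquares

/-! ### Group-penalised least squares -/

section GroupPenalty

variable {ι T : Type*} [Fintype ι] [Fintype T]

lemma l2_nonneg {n : ℕ} (v : Fin n → ℝ) : 0 ≤ l2 v := Real.sqrt_nonneg _

lemma l2_sq {n : ℕ} (v : Fin n → ℝ) : l2 v ^ 2 = ∑ t, v t ^ 2 :=
  Real.sq_sqrt (Finset.sum_nonneg fun _ _ => sq_nonneg _)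

lemma l2_eq_zero {n : ℕ} {v : Fin n → ℝ} (h : l2 v = 0) (t : Fin n) : v t = 0 := by
  have h1 : ∑ t, v t ^ 2 = 0 := by rw [← l2_sq, h]; norm_num
  have := (Finset.sum_eq_zero_iff_of_nonneg (fun t _ => sq_nonneg (v t))).1 h1 t
    (Finset.mem_univ t)
  exact pow_eq_zero_iff (two_ne_zero) |>.1 this

lemma abs_sum_mul_le_l2 {n : ℕ} (u v : Fin n → ℝ) : |∑ t, u t * v t| ≤ l2 u * l2 v := by
  apply abs_le_of_sq_le_sq
  · rw [mul_pow, l2_sq, l2_sq]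
    exact Finset.sum_mul_sq_le_sq_mul_sq _ _ _
  · exact mul_nonneg (l2_nonneg _) (l2_nonneg _)

lemma l2_le_of_abs_le {n : ℕ} {v : Fin n → ℝ} {c : ℝ} (hc : 0 ≤ c) (h : ∀ t, |v t| ≤ c) :
    l2 v ≤ Real.sqrt n * c := by
  apply Real.sqrt_le_iff.2 ⟨by positivity, ?_⟩
  rw [mul_pow, Real.sq_sqrt (Nat.cast_nonneg n)]
  calc ∑ t, v t ^ 2 ≤ ∑ _t : Fin n, c ^ 2 :=
        Finset.sum_le_sum fun t _ => sq_le_sq' (abs_le.1 (h t)).1 (abs_le.1 (h t)).2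
    _ = n * c ^ 2 := by simp

lemma l2_add_le {n : ℕ} (u v : Fin n → ℝ) : l2 (fun t => u t + v t) ≤ l2 u + l2 v := by
  apply Real.sqrt_le_iff.2 ⟨add_nonneg (l2_nonneg _) (l2_nonneg _), ?_⟩
  have h1 := (abs_le.1 (abs_sum_mul_le_l2 u v)).2
  have h2 : ∑ t, (u t + v t) ^ 2 = ∑ t, u t ^ 2 + 2 * ∑ t, u t * v t + ∑ t, v t ^ 2 := by
    rw [Finset.mul_sum, ← Finset.sum_add_distrib, ← Finset.sum_add_distrib]
    exact Finset.sum_congr rfl fun t _ => by ring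
  rw [h2, ← l2_sq, ← l2_sq]
  nlinarith

lemma l2_neg {n : ℕ} (u : Fin n → ℝ) : l2 (fun t => -u t) = l2 u := by
  simp [l2]

lemma abs_l2_sub_l2_le {n : ℕ} (u v : Fin n → ℝ) :
    |l2 u - l2 v| ≤ l2 (fun t => u t - v t) := by
  rw [abs_le]
  constructor
  · have h := l2_add_le (fun t => -(u t - v t)) u
    have e : l2 (fun t => -(u t - v t) + u t) = l2 v := by simp [l2]
    rw [e, l2_neg] at h
    linarith
  · have h := l2_add_le (fun t => (u t - v t)) v
    have e : l2 (fun t => u t - v t + v t) = l2 u := by simp [l2]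
    rw [e] at h
    linarith

/-- Centring at the mean minimises the norm of the deviations. -/
lemma devNorm_le_l2_sub {n : ℕ} (v : Fin n → ℝ) (c : ℝ) : devNorm v ≤ l2 (fun t => v t - c) := by
  rcases Nat.eq_zero_or_pos n with rfl | hn
  · simp [devNorm, l2]
  have hn' : (n : ℝ) ≠ 0 := by positivity
  apply Real.sqrt_le_sqrt
  set m := 1 / (n : ℝ) * ∑ s, v s with hm
  have h0 : ∑ t, (v t - m) = 0 := by
    rw [Finset.sum_sub_distrib, hm]
    simp only [Finset.sum_const, Finset.card_univ, Fintype.card_fin, nsmul_eq_mul]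
    field_simp
    ring
  have h : ∑ t, (v t - c) ^ 2 = ∑ t, (v t - m) ^ 2 + n * (m - c) ^ 2 := by
    have : ∀ t, (v t - c) ^ 2 = (v t - m) ^ 2 + (2 * (m - c) * (v t - m) + (m - c) ^ 2) :=
      fun t => by ring
    simp only [this, Finset.sum_add_distrib, ← Finset.mul_sum, h0]
    simp
  rw [h]
  nlinarith [sq_nonneg (m - c), (Nat.cast_nonneg n : (0 : ℝ) ≤ n)]

/-- Centring is linear and does not increase the norm. One column bound for the preliminary
estimates therefore controls the weights of both the level and the slope groups. -/
lemma abs_devNorm_sub_devNorm_le {n : ℕ} (u v : Fin n → ℝ) :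
    |devNorm u - devNorm v| ≤ l2 (fun t => u t - v t) := by
  refine (abs_l2_sub_l2_le _ _).trans ?_
  have h := devNorm_le_l2_sub (fun t => u t - v t) 0
  simp only [sub_zero] at h
  refine le_trans (le_of_eq ?_) h
  simp only [devNorm, Finset.sum_sub_distrib]
  congr 1
  funext t
  ring

/-- The SCAD-weighted group objective in the stacked parametrisation. -/
def stackedLoss {n : ℕ} (κ : Fin n → ι → ℝ) (f : Fin n → ι → T → ℝ) (y : ι → ℝ) (w : T → ℝ)
    (θ : Fin n → T → ℝ) : ℝ :=
  ∑ t, wls (κ t) (f t) y (θ t) + ∑ q, w q * l2 (fun t => θ t q)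

/-- Strict optimality of the restricted least squares estimate for the weighted group
objective. -/
theorem stackedLoss_strict_min [DecidableEq T] {n : ℕ} {κ : Fin n → ι → ℝ}
    (hκ : ∀ t l, 0 ≤ κ t l) {f : Fin n → ι → T → ℝ} {y : ι → ℝ} {S : Finset T} {w : T → ℝ}
    {lam : ℝ} (hlam : 0 < lam) (hw0 : ∀ q ∈ S, w q = 0) (hw1 : ∀ q, q ∉ S → w q = lam)
    {θh : Fin n → T → ℝ} (hsupp : ∀ t q, q ∉ S → θh t q = 0)
    (hzero : ∀ t, ∀ q ∈ S, score (κ t) (f t) y (θh t) q = 0)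
    (hkkt : ∀ q, q ∉ S → l2 (fun t => score (κ t) (f t) y (θh t) q) ≤ lam / 4)
    (hinj : ∀ t, ∀ u : T → ℝ, (∀ q, q ∉ S → u q = 0) → energy (κ t) (f t) u = 0 → u = 0)
    (θ : Fin n → T → ℝ) (hθ : θ ≠ θh) :
    stackedLoss κ f y w θh < stackedLoss κ f y w θ := by
  set u : Fin n → T → ℝ := fun t => θ t - θh t with hu
  have hθu : ∀ t, θ t = θh t + u t := fun t => by simp [hu]
  -- The linear term lives off `S` only: on `S` the score vanishes, and off `S` the increment `u` is
  -- `θ` itself because `θh` is zero there.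
  have h1 : ∑ t, wls (κ t) (f t) y (θ t) = ∑ t, wls (κ t) (f t) y (θh t)
      - 2 * ∑ q ∈ Sᶜ, ∑ t, θ t q * score (κ t) (f t) y (θh t) q
      + ∑ t, energy (κ t) (f t) (u t) := by
    rw [Finset.sum_comm, Finset.mul_sum, ← Finset.sum_sub_distrib, ← Finset.sum_add_distrib]
    refine Finset.sum_congr rfl fun t _ => ?_
    conv_lhs => rw [hθu t, wls_add]
    congr 3
    symm
    rw [Finset.sum_congr rfl (g := fun q => u t q * score (κ t) (f t) y (θh t) q)]
    · refine Finset.sum_subset (Finset.subset_univ _) fun q _ hq => ?_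
      rw [hzero t q (by simpa using hq), mul_zero]
    · intro q hq
      have : u t q = θ t q := by
        simp [hu, hsupp t q (Finset.mem_compl.1 hq)]
      rw [this]
  have h2 : ∀ φ : Fin n → T → ℝ, ∑ q, w q * l2 (fun t => φ t q)
      = ∑ q ∈ Sᶜ, lam * l2 (fun t => φ t q) := by
    intro φ
    rw [← Finset.sum_add_sum_compl S, Finset.sum_eq_zero (fun q hq => by rw [hw0 q hq, zero_mul]),
      zero_add]
    exact Finset.sum_congr rfl fun q hq => by rw [hw1 q (Finset.mem_compl.1 hq)]
  have h3 : ∑ q ∈ Sᶜ, lam * l2 (fun t => θh t q) = 0 := by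
    refine Finset.sum_eq_zero fun q hq => ?_
    have : (fun t => θh t q) = fun _ => 0 := by
      funext t; exact hsupp t q (Finset.mem_compl.1 hq)
    rw [this]
    simp [l2]
  -- A score of at most `lam / 4` can recover no more than half of the penalty. The other half is
  -- the margin that makes the minimum strict.
  have h4 : ∀ q ∈ Sᶜ, 2 * ∑ t, θ t q * score (κ t) (f t) y (θh t) q
      ≤ lam * l2 (fun t => θ t q) / 2 := by
    intro q hq
    have h5 := (abs_le.1 (abs_sum_mul_le_l2 (fun t => θ t q)
      (fun t => score (κ t) (f t) y (θh t) q))).2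
    have h6 := hkkt q (Finset.mem_compl.1 hq)
    have h7 := mul_le_mul_of_nonneg_left h6 (l2_nonneg fun t => θ t q)
    nlinarith
  have h5 : 2 * ∑ q ∈ Sᶜ, ∑ t, θ t q * score (κ t) (f t) y (θh t) q
      ≤ (∑ q ∈ Sᶜ, lam * l2 (fun t => θ t q)) / 2 := by
    rw [Finset.mul_sum, Finset.sum_div]
    exact Finset.sum_le_sum h4
  have h6 : 0 ≤ ∑ q ∈ Sᶜ, lam * l2 (fun t => θ t q) :=
    Finset.sum_nonneg fun q _ => mul_nonneg hlam.le (l2_nonneg _)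
  have h7 : 0 ≤ ∑ t, energy (κ t) (f t) (u t) :=
    Finset.sum_nonneg fun t _ => energy_nonneg (hκ t) _ _
  simp only [stackedLoss]
  rw [h2, h2, h3, h1]
  -- Without a strict increase both the penalty off `S` and the energy of the difference must
  -- vanish. The difference is then supported on `S`, where the energy is definite.
  by_contra hcon
  have h8 : ∑ q ∈ Sᶜ, lam * l2 (fun t => θ t q) = 0 := by linarith
  have h9 : ∑ t, energy (κ t) (f t) (u t) = 0 := by linarith
  apply hθ
  funext t
  have hsup : ∀ q, q ∉ S → u t q = 0 := by
    intro q hq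
    have h10 := (Finset.sum_eq_zero_iff_of_nonneg
      (fun q _ => mul_nonneg hlam.le (l2_nonneg _))).1 h8 q (Finset.mem_compl.2 hq)
    have h11 : l2 (fun t => θ t q) = 0 := (mul_eq_zero.1 h10).resolve_left hlam.ne'
    simp [hu, hsupp t q hq, l2_eq_zero h11 t]
  have hent : energy (κ t) (f t) (u t) = 0 :=
    (Finset.sum_eq_zero_iff_of_nonneg (fun t _ => energy_nonneg (hκ t) _ _)).1 h9 t
      (Finset.mem_univ t)
  rw [hθu t, hinj t (u t) hsup hent, add_zero]

end GroupPenalty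

/-! ### Sub-Gaussian random variables -/

section SubGaussian

variable {Ω' : Type*} [MeasurableSpace Ω'] {μ : Measure Ω'}

/-- The moment generating function of `Z` is bounded by that of a centred Gaussian variable with
variance `2 v`. -/
def SubG (μ : Measure Ω') (Z : Ω' → ℝ) (v : ℝ) : Prop :=
  ∀ s : ℝ, ∫⁻ ω, ENNReal.ofReal (Real.exp (s * Z ω)) ∂μ ≤ ENNReal.ofReal (Real.exp (v * s ^ 2))

lemma ofReal_exp_add (a b : ℝ) : ENNReal.ofReal (Real.exp (a + b))
    = ENNReal.ofReal (Real.exp a) * ENNReal.ofReal (Real.exp b) := by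
  rw [Real.exp_add, ENNReal.ofReal_mul (Real.exp_nonneg _)]

/-- Chernoff bound. -/
lemma measure_ge_le_exp_of_lintegral {Z : Ω' → ℝ} (hZ : Measurable Z) {a : ℝ} (u : ℝ)
    (h : ∫⁻ ω, ENNReal.ofReal (Real.exp (Z ω)) ∂μ ≤ ENNReal.ofReal (Real.exp a)) :
    μ {ω | u ≤ Z ω} ≤ ENNReal.ofReal (Real.exp (a - u)) := by
  have hm : Measurable fun ω => ENNReal.ofReal (Real.exp (Z ω)) := by fun_prop
  have h1 := (mul_meas_ge_le_lintegral (μ := μ) hm (ENNReal.ofReal (Real.exp u))).trans h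
  have h2 : {ω | u ≤ Z ω} ⊆
      {ω | ENNReal.ofReal (Real.exp u) ≤ ENNReal.ofReal (Real.exp (Z ω))} := fun ω hω =>
    ENNReal.ofReal_le_ofReal (Real.exp_le_exp.2 hω)
  have h3 : ENNReal.ofReal (Real.exp u) * μ {ω | u ≤ Z ω} ≤ ENNReal.ofReal (Real.exp a) :=
    (mul_le_mul_right (measure_mono h2) _).trans h1
  have h4 : μ {ω | u ≤ Z ω} = ENNReal.ofReal (Real.exp (-u)) *
      (ENNReal.ofReal (Real.exp u) * μ {ω | u ≤ Z ω}) := by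
    rw [← mul_assoc, ← ofReal_exp_add]
    simp
  rw [h4]
  calc _ ≤ ENNReal.ofReal (Real.exp (-u)) * ENNReal.ofReal (Real.exp a) := by gcongr
    _ = _ := by rw [← ofReal_exp_add]; ring_nf

lemma SubG.mono {Z : Ω' → ℝ} {v w : ℝ} (h : SubG μ Z v) (hvw : v ≤ w) : SubG μ Z w := fun s =>
  (h s).trans (ENNReal.ofReal_le_ofReal (Real.exp_le_exp.2 (by gcongr)))

lemma SubG.const_mul {Z : Ω' → ℝ} {v : ℝ} (h : SubG μ Z v) (c : ℝ) :
    SubG μ (fun ω => c * Z ω) (c ^ 2 * v) := fun s => by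
  have := h (s * c)
  simp only [mul_assoc] at this
  refine this.trans (le_of_eq ?_)
  ring_nf

/-- Two-sided sub-Gaussian tail bound. -/
lemma SubG.tail {Z : Ω' → ℝ} (hZ : Measurable Z) {v : ℝ} (h : SubG μ Z v) (hv : 0 < v) {x : ℝ}
    (hx : 0 ≤ x) :
    μ {ω | Real.sqrt (4 * x * v) < |Z ω|} ≤ 2 * ENNReal.ofReal (Real.exp (-x)) := by
  -- The optimal Chernoff parameter: `v * r ^ 2 = x`, while the threshold multiplied by `r` is `2 *
  -- x`, so each side contributes `exp (-x)`.
  set r := Real.sqrt (x / v) with hr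
  have hr2 : v * r ^ 2 = x := by
    rw [hr, Real.sq_sqrt (by positivity)]; field_simp
  have hrs : r * Real.sqrt (4 * x * v) = 2 * x := by
    rw [hr, ← Real.sqrt_mul (by positivity)]
    have : x / v * (4 * x * v) = (2 * x) ^ 2 := by field_simp; ring
    rw [this, Real.sqrt_sq (by positivity)]
  have h1 := measure_ge_le_exp_of_lintegral (Z := fun ω => r * Z ω) (by fun_prop) (2 * x) (h r)
  have h2 := measure_ge_le_exp_of_lintegral (Z := fun ω => -r * Z ω) (by fun_prop) (2 * x) (h (-r))
  rw [neg_sq, hr2, show x - 2 * x = -x by ring] at h2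
  rw [hr2, show x - 2 * x = -x by ring] at h1
  have hr0 : 0 ≤ r := Real.sqrt_nonneg _
  have hsub : {ω | Real.sqrt (4 * x * v) < |Z ω|} ⊆
      {ω | 2 * x ≤ r * Z ω} ∪ {ω | 2 * x ≤ -r * Z ω} := by
    intro ω hω
    rw [Set.mem_ofPred_eq] at hω
    rcases lt_abs.1 hω with h3 | h3
    · left
      rw [Set.mem_ofPred_eq, ← hrs]
      gcongr
    · right
      rw [Set.mem_ofPred_eq, ← hrs, neg_mul, ← mul_neg]
      gcongr
  calc _ ≤ _ := measure_mono hsub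
    _ ≤ _ := measure_union_le _ _
    _ ≤ _ := add_le_add h1 h2
    _ = _ := (two_mul _).symm

/-- Sub-Gaussianity passes to almost sure limits. -/
lemma SubG.of_tendsto_ae {Z : ℕ → Ω' → ℝ} {W : Ω' → ℝ} {v : ℝ} (hZ : ∀ k, Measurable (Z k))
    (h : ∀ k, SubG μ (Z k) v) (hlim : ∀ᵐ ω ∂μ, Tendsto (fun k => Z k ω) atTop (𝓝 (W ω))) :
    SubG μ W v := by
  intro s
  have h1 : ∫⁻ ω, ENNReal.ofReal (Real.exp (s * W ω)) ∂μ
      = ∫⁻ ω, liminf (fun k => ENNReal.ofReal (Real.exp (s * Z k ω))) atTop ∂μ := by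
    refine lintegral_congr_ae ?_
    filter_upwards [hlim] with ω hω
    symm
    apply Tendsto.liminf_eq
    exact (ENNReal.continuous_ofReal.tendsto _).comp
      ((Real.continuous_exp.tendsto _).comp (hω.const_mul s))
  rw [h1]
  refine (lintegral_liminf_le fun k => ?_).trans ?_
  · have := hZ k
    fun_prop
  · refine liminf_le_of_frequently_le' (Frequently.of_forall fun k => h k s)

lemma abs_le_sq_add {ι₁ y : ℝ} (hι : 0 < ι₁) (s : ℝ) : s * y ≤ ι₁ * y ^ 2 + s ^ 2 / (4 * ι₁) := by
  have h : 0 ≤ (2 * ι₁ * y - s) ^ 2 / (4 * ι₁) := by positivity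
  have e : (2 * ι₁ * y - s) ^ 2 / (4 * ι₁) = ι₁ * y ^ 2 + s ^ 2 / (4 * ι₁) - s * y := by
    field_simp; ring
  linarith

/-- A Taylor bound that keeps the linear term, which centring then removes. The absolute value in
the exponent makes it valid for both signs. -/
lemma exp_le_one_add_add_sq_mul_exp (x : ℝ) :
    Real.exp x ≤ 1 + x + x ^ 2 * Real.exp |x| := by
  have h1 := Real.add_one_le_exp (-x)
  have h2 := Real.add_one_le_exp x
  have h3 : Real.exp (-x) * Real.exp x = 1 := by rw [← Real.exp_add]; simp
  have hp := Real.exp_pos x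
  have h4 : Real.exp x - 1 ≤ x * Real.exp x := by nlinarith
  rcases le_total 0 x with hx | hx
  · rw [abs_of_nonneg hx]
    nlinarith
  · rw [abs_of_nonpos hx]
    have h5 : 1 ≤ Real.exp (-x) := Real.one_le_exp (by linarith)
    nlinarith [sq_nonneg x]

lemma lintegral_ofReal_exp_abs_integrable {W : Ω' → ℝ} (hW : Measurable W) {C : ℝ}
    (h : ∫⁻ ω, ENNReal.ofReal (Real.exp |W ω|) ∂μ ≤ ENNReal.ofReal C) :
    Integrable (fun ω => Real.exp |W ω|) μ := by
  refine ⟨by fun_prop, ?_⟩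
  rw [hasFiniteIntegral_iff_ofReal (ae_of_all _ fun ω => (Real.exp_pos _).le)]
  exact h.trans_lt ENNReal.ofReal_lt_top

lemma abs_le_exp_abs (x : ℝ) : |x| ≤ Real.exp |x| := by
  have := Real.add_one_le_exp |x|
  linarith

lemma integrable_of_exp_abs {W : Ω' → ℝ} (hW : Measurable W) {C : ℝ}
    (h : ∫⁻ ω, ENNReal.ofReal (Real.exp |W ω|) ∂μ ≤ ENNReal.ofReal C) : Integrable W μ := by
  refine (lintegral_ofReal_exp_abs_integrable hW h).mono' (by fun_prop) (ae_of_all _ fun ω => ?_)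
  rw [Real.norm_eq_abs]
  exact abs_le_exp_abs _

lemma integral_exp_abs_le {W : Ω' → ℝ} (hW : Measurable W) {C : ℝ} (hC : 0 ≤ C)
    (h : ∫⁻ ω, ENNReal.ofReal (Real.exp |W ω|) ∂μ ≤ ENNReal.ofReal C) :
    ∫ ω, Real.exp |W ω| ∂μ ≤ C := by
  rw [integral_eq_lintegral_of_nonneg_ae (ae_of_all _ fun ω => (Real.exp_pos _).le) (by fun_prop)]
  exact ENNReal.toReal_le_of_le_ofReal hC h

/-- A centred variable with an exponential moment is sub-exponential. -/
lemma mgf_le_of_exp_abs [IsProbabilityMeasure μ] {W : Ω' → ℝ} (hW : Measurable W) {C : ℝ}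
    (hC : 0 ≤ C) (h : ∫⁻ ω, ENNReal.ofReal (Real.exp |W ω|) ∂μ ≤ ENNReal.ofReal C)
    (h0 : ∫ ω, W ω ∂μ = 0) {s : ℝ} (hs : |s| ≤ 1 / 2) :
    ∫⁻ ω, ENNReal.ofReal (Real.exp (s * W ω)) ∂μ ≤ ENNReal.ofReal (Real.exp (8 * C * s ^ 2)) := by
  have hi := lintegral_ofReal_exp_abs_integrable hW h
  have hWi := integrable_of_exp_abs hW h
  have hE := integral_exp_abs_le hW hC h
  have hpt : ∀ ω, Real.exp (s * W ω) ≤ 1 + s * W ω + 8 * s ^ 2 * Real.exp |W ω| := by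
    intro ω
    refine (exp_le_one_add_add_sq_mul_exp _).trans ?_
    -- The moment `exp |W|` is split in two halves: one dominates the square, the other dominates
    -- `exp |s W|` because `|s| ≤ 1/2`.
    have h1 : |W ω| ^ 2 ≤ 8 * Real.exp (|W ω| / 2) := by
      have := Real.quadratic_le_exp_of_nonneg (x := |W ω| / 2) (by positivity)
      nlinarith [abs_nonneg (W ω)]
    have h2 : Real.exp |s * W ω| ≤ Real.exp (|W ω| / 2) := by
      rw [Real.exp_le_exp, abs_mul]
      nlinarith [abs_nonneg (W ω)]
    have h3 : Real.exp |W ω| = Real.exp (|W ω| / 2) * Real.exp (|W ω| / 2) := by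
      rw [← Real.exp_add]; ring_nf
    have h4 : (s * W ω) ^ 2 * Real.exp |s * W ω|
        ≤ (s ^ 2 * (8 * Real.exp (|W ω| / 2))) * Real.exp (|W ω| / 2) := by
      rw [mul_pow, ← sq_abs (W ω)]
      gcongr
    rw [h3]
    linarith
  have hG : Integrable (fun ω => 1 + s * W ω + 8 * s ^ 2 * Real.exp |W ω|) μ :=
    ((integrable_const _).add (hWi.const_mul s)).add (hi.const_mul _)
  calc ∫⁻ ω, ENNReal.ofReal (Real.exp (s * W ω)) ∂μ
      ≤ ∫⁻ ω, ENNReal.ofReal (1 + s * W ω + 8 * s ^ 2 * Real.exp |W ω|) ∂μ :=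
        lintegral_mono fun ω => ENNReal.ofReal_le_ofReal (hpt ω)
    _ = ENNReal.ofReal (∫ ω, (1 + s * W ω + 8 * s ^ 2 * Real.exp |W ω|) ∂μ) :=
        (ofReal_integral_eq_lintegral_ofReal hG
          (ae_of_all _ fun ω => (Real.exp_pos _).le.trans (hpt ω))).symm
    _ ≤ _ := by
      apply ENNReal.ofReal_le_ofReal
      have e1 : Integrable (fun ω => 1 + s * W ω) μ :=
        (integrable_const _).add (hWi.const_mul s)
      rw [integral_add e1 (hi.const_mul _), integral_add (integrable_const _) (hWi.const_mul s),
        integral_const_mul,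
        integral_const_mul, h0]
      simp only [integral_const, probReal_univ, smul_eq_mul, mul_one, mul_zero, add_zero]
      have h5 : 8 * s ^ 2 * ∫ ω, Real.exp |W ω| ∂μ ≤ 8 * s ^ 2 * C := by gcongr
      have := Real.add_one_le_exp (8 * C * s ^ 2)
      linarith

/-- A centred variable with a Gaussian-type exponential moment is sub-Gaussian. -/
lemma subG_of_exp_sq [IsProbabilityMeasure μ] {Y : Ω' → ℝ} (hY : Measurable Y) {ι₁ C₀ : ℝ}
    (hι : 0 < ι₁) (hC : 0 ≤ C₀)
    (h : ∫⁻ ω, ENNReal.ofReal (Real.exp (ι₁ * Y ω ^ 2)) ∂μ ≤ ENNReal.ofReal C₀)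
    (h0 : ∫ ω, Y ω ∂μ = 0) :
    SubG μ Y (8 * (C₀ * Real.exp (1 / (4 * ι₁))) + (1 / (4 * ι₁) + 4 * C₀)) := by
  have hbound : ∀ s : ℝ, ∫⁻ ω, ENNReal.ofReal (Real.exp (ι₁ * Y ω ^ 2 + s ^ 2 / (4 * ι₁))) ∂μ
      ≤ ENNReal.ofReal (C₀ * Real.exp (s ^ 2 / (4 * ι₁))) := by
    intro s
    simp only [ofReal_exp_add]
    rw [lintegral_mul_const _ (by fun_prop), ENNReal.ofReal_mul hC]
    gcongr
  intro s
  -- Centring matters only for small `s`. For large `s` the inequality `s y ≤ ι₁ y² + s²/(4ι₁)`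
  -- suffices, since `1 ≤ 4 s²` lets the constant `C₀` be absorbed into the quadratic exponent.
  rcases le_or_gt |s| (1 / 2) with hs | hs
  · have h1 : ∫⁻ ω, ENNReal.ofReal (Real.exp |Y ω|) ∂μ
        ≤ ENNReal.ofReal (C₀ * Real.exp (1 / (4 * ι₁))) := by
      have := hbound 1
      rw [one_pow] at this
      refine le_trans (lintegral_mono fun ω => ?_) this
      apply ENNReal.ofReal_le_ofReal (Real.exp_le_exp.2 _)
      have := abs_le_sq_add (y := |Y ω|) hι 1
      rwa [one_mul, sq_abs, one_pow] at this
    refine (mgf_le_of_exp_abs hY (by positivity) h1 h0 hs).trans ?_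
    apply ENNReal.ofReal_le_ofReal (Real.exp_le_exp.2 _)
    gcongr
    have : 0 ≤ 1 / (4 * ι₁) + 4 * C₀ := by positivity
    linarith
  · refine le_trans (lintegral_mono fun ω => ?_) ((hbound s).trans ?_)
    · exact ENNReal.ofReal_le_ofReal (Real.exp_le_exp.2 (abs_le_sq_add hι s))
    · apply ENNReal.ofReal_le_ofReal
      have h2 : C₀ ≤ Real.exp C₀ := by linarith [Real.add_one_le_exp C₀]
      have h3 : 1 ≤ 4 * s ^ 2 := by
        rw [← sq_abs s]; nlinarith
      calc C₀ * Real.exp (s ^ 2 / (4 * ι₁)) ≤ Real.exp C₀ * Real.exp (s ^ 2 / (4 * ι₁)) := by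
            gcongr
        _ = Real.exp (C₀ + s ^ 2 / (4 * ι₁)) := (Real.exp_add _ _).symm
        _ ≤ _ := by
          apply Real.exp_le_exp.2
          have h4 : C₀ ≤ 4 * C₀ * s ^ 2 := by nlinarith
          have h5 : 0 ≤ 8 * (C₀ * Real.exp (1 / (4 * ι₁))) * s ^ 2 := by positivity
          have h6 : s ^ 2 / (4 * ι₁) = 1 / (4 * ι₁) * s ^ 2 := by ring
          rw [h6]
          linarith

lemma lintegral_ofReal_gaussian {b : ℝ} (hb : 0 < b) (a : ℝ) :
    ∫⁻ x : ℝ, ENNReal.ofReal (Real.exp (-b * (x - a) ^ 2)) = ENNReal.ofReal (√(Real.pi / b)) := by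
  rw [lintegral_sub_right_eq_self (fun x => ENNReal.ofReal (Real.exp (-b * x ^ 2))) a,
    ← integral_gaussian, ofReal_integral_eq_lintegral_ofReal (integrable_exp_neg_mul_sq hb)
      (ae_of_all _ fun x => (Real.exp_pos _).le)]

/-- A sub-Gaussian variable has a Gaussian-type exponential moment. -/
lemma SubG.lintegral_exp_sq_le [SFinite μ] {Z : Ω' → ℝ} (hZ : Measurable Z) {v : ℝ}
    (h : SubG μ Z v) (hv : 0 < v) :
    ∫⁻ ω, ENNReal.ofReal (Real.exp (Z ω ^ 2 / (8 * v))) ∂μ ≤ ENNReal.ofReal 2 := by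
  set c := √(Real.pi / (2 * v)) with hc
  have hc0 : 0 < c := Real.sqrt_pos.2 (by positivity)
  -- Up to the factor `c`, `exp (z² / (8v))` is a mixture of the exponentials `exp (x z)` with
  -- density `exp (-2v x²)`. After swapping the integrals the sub-Gaussian bound applies for each
  -- `x` and leaves `exp (-v x²)`.
  have h1 : ∀ z : ℝ, ENNReal.ofReal c * ENNReal.ofReal (Real.exp (z ^ 2 / (8 * v)))
      = ∫⁻ x : ℝ, ENNReal.ofReal (Real.exp (x * z)) *
          ENNReal.ofReal (Real.exp (-(2 * v) * x ^ 2)) := by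
    intro z
    rw [hc, ← lintegral_ofReal_gaussian (by positivity) (z / (4 * v)),
      ← lintegral_mul_const _ (by fun_prop)]
    refine lintegral_congr fun x => ?_
    rw [← ofReal_exp_add, ← ofReal_exp_add]
    congr 2
    field_simp
    ring
  have h2 : ENNReal.ofReal c * ∫⁻ ω, ENNReal.ofReal (Real.exp (Z ω ^ 2 / (8 * v))) ∂μ
      ≤ ENNReal.ofReal c * ENNReal.ofReal 2 := by
    rw [← lintegral_const_mul _ (by fun_prop)]
    simp only [h1]
    rw [lintegral_lintegral_swap (by fun_prop)]
    calc ∫⁻ x : ℝ, ∫⁻ ω, ENNReal.ofReal (Real.exp (x * Z ω)) *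
          ENNReal.ofReal (Real.exp (-(2 * v) * x ^ 2)) ∂μ
        ≤ ∫⁻ x : ℝ, ENNReal.ofReal (Real.exp (-v * (x - 0) ^ 2)) := by
          refine lintegral_mono fun x => ?_
          rw [lintegral_mul_const _ (by fun_prop)]
          refine (mul_le_mul_left (h x) _).trans (le_of_eq ?_)
          rw [← ofReal_exp_add]
          congr 2
          ring
      _ = ENNReal.ofReal (√(Real.pi / v)) := lintegral_ofReal_gaussian hv 0
      _ ≤ ENNReal.ofReal (c * 2) := by
          apply ENNReal.ofReal_le_ofReal
          apply Real.sqrt_le_iff.2 ⟨by positivity, ?_⟩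
          rw [mul_pow, hc, Real.sq_sqrt (by positivity)]
          have : Real.pi / (2 * v) * 2 ^ 2 = 2 * (Real.pi / v) := by field_simp
          rw [this]
          have : 0 ≤ Real.pi / v := by positivity
          linarith
      _ = _ := by rw [ENNReal.ofReal_mul hc0.le]
  exact (ENNReal.mul_le_mul_iff_right (by simpa using hc0) ENNReal.ofReal_ne_top).1 h2

/-- The exponential moment of a product of two sub-Gaussian variables. -/
lemma lintegral_exp_abs_mul_le [SFinite μ] {Y Z : Ω' → ℝ} (hY : Measurable Y) (hZ : Measurable Z)
    {v w : ℝ} (hv : 0 < v) (hw : 0 < w) (hYv : SubG μ Y v) (hZw : SubG μ Z w) :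
    ∫⁻ ω, ENNReal.ofReal (Real.exp |Y ω * Z ω / (8 * √(v * w))|) ∂μ ≤ ENNReal.ofReal 2 := by
  -- The arithmetic-geometric inequality is used twice: first in the exponent, then for the product
  -- `exp (a/2) * exp (b/2)`. No independence of the two factors is needed.
  have hpt : ∀ ω, Real.exp |Y ω * Z ω / (8 * √(v * w))|
      ≤ (Real.exp (Y ω ^ 2 / (8 * v)) + Real.exp (Z ω ^ 2 / (8 * w))) / 2 := by
    intro ω
    set a := Y ω ^ 2 / (8 * v)
    set b := Z ω ^ 2 / (8 * w)
    have hab : |Y ω * Z ω / (8 * √(v * w))| ≤ a / 2 + b / 2 := by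
      have ha : a = (|Y ω| / √(8 * v)) ^ 2 := by
        rw [div_pow, Real.sq_sqrt (by positivity), sq_abs]
      have hb : b = (|Z ω| / √(8 * w)) ^ 2 := by
        rw [div_pow, Real.sq_sqrt (by positivity), sq_abs]
      have hm : |Y ω * Z ω / (8 * √(v * w))| = (|Y ω| / √(8 * v)) * (|Z ω| / √(8 * w)) := by
        have h8 : 8 * √(v * w) = √(8 * v) * √(8 * w) := by
          rw [← Real.sqrt_mul (by positivity : 0 ≤ 8 * v) (8 * w),
            show 8 * v * (8 * w) = 8 ^ 2 * (v * w) by ring,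
            Real.sqrt_mul (by positivity) (v * w), Real.sqrt_sq (by positivity)]
        have h9 : 0 < √(8 * v) * √(8 * w) :=
          mul_pos (Real.sqrt_pos.2 (by positivity)) (Real.sqrt_pos.2 (by positivity))
        rw [abs_div, abs_mul, h8, abs_of_pos h9, mul_div_mul_comm]
      rw [hm, ha, hb]
      nlinarith [sq_nonneg (|Y ω| / √(8 * v) - |Z ω| / √(8 * w))]
    refine (Real.exp_le_exp.2 hab).trans ?_
    rw [Real.exp_add]
    have ha2 : Real.exp a = Real.exp (a / 2) ^ 2 := by rw [sq, ← Real.exp_add]; ring_nf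
    have hb2 : Real.exp b = Real.exp (b / 2) ^ 2 := by rw [sq, ← Real.exp_add]; ring_nf
    rw [ha2, hb2]
    nlinarith [sq_nonneg (Real.exp (a / 2) - Real.exp (b / 2))]
  calc _ ≤ ∫⁻ ω, ENNReal.ofReal ((Real.exp (Y ω ^ 2 / (8 * v)) +
          Real.exp (Z ω ^ 2 / (8 * w))) / 2) ∂μ :=
        lintegral_mono fun ω => ENNReal.ofReal_le_ofReal (hpt ω)
    _ = (∫⁻ ω, ENNReal.ofReal (Real.exp (Y ω ^ 2 / (8 * v))) ∂μ
        + ∫⁻ ω, ENNReal.ofReal (Real.exp (Z ω ^ 2 / (8 * w))) ∂μ) * ENNReal.ofReal (1 / 2) := by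
      rw [← lintegral_add_left (by fun_prop), ← lintegral_mul_const _ (by fun_prop)]
      refine lintegral_congr fun ω => ?_
      rw [← ENNReal.ofReal_add (by positivity) (by positivity),
        ← ENNReal.ofReal_mul (by positivity)]
      ring_nf
    _ ≤ (ENNReal.ofReal 2 + ENNReal.ofReal 2) * ENNReal.ofReal (1 / 2) := by
      gcongr
      · exact hYv.lintegral_exp_sq_le hY hv
      · exact hZw.lintegral_exp_sq_le hZ hw
    _ = _ := by
      rw [← ENNReal.ofReal_add (by norm_num) (by norm_num), ← ENNReal.ofReal_mul (by norm_num)]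
      norm_num

/-- Bernstein-type bound for the centred product of two sub-Gaussian variables. -/
lemma mgf_centered_mul_le [IsProbabilityMeasure μ] {Y Z : Ω' → ℝ} (hY : Measurable Y)
    (hZ : Measurable Z) {v w : ℝ} (hv : 0 < v) (hw : 0 < w) (hYv : SubG μ Y v)
    (hZw : SubG μ Z w) {s : ℝ} (hs : |s| * √(v * w) ≤ 1 / 16) :
    ∫⁻ ω, ENNReal.ofReal (Real.exp (s * (Y ω * Z ω - ∫ ω', Y ω' * Z ω' ∂μ))) ∂μ
      ≤ ENNReal.ofReal (Real.exp (10000 * (v * w) * s ^ 2)) := by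
  -- Dividing by `c` gives an exponential moment of at most `2`. The centring constant is at most
  -- `2`, and `exp 2 ≤ 7.5` raises the moment to `15`. The final factor is `8 * 15 * 64 = 7680`,
  -- rounded up to `10000`.
  set c := 8 * √(v * w) with hc
  have hc0 : 0 < c := by
    have : 0 < √(v * w) := Real.sqrt_pos.2 (by positivity)
    positivity
  have h2 := lintegral_exp_abs_mul_le hY hZ hv hw hYv hZw
  rw [← hc] at h2
  have hWm : Measurable fun ω => Y ω * Z ω / c := by fun_prop
  have hint := integrable_of_exp_abs hWm h2
  have hE := integral_exp_abs_le hWm (by norm_num) h2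
  set m := ∫ ω', Y ω' * Z ω' ∂μ with hm
  have hmc : ∫ ω, Y ω * Z ω / c ∂μ = m / c := integral_div _ _
  have hmle : |m / c| ≤ 2 := by
    rw [← hmc]
    refine (abs_integral_le_integral_abs).trans (le_trans ?_ hE)
    exact integral_mono hint.abs (lintegral_ofReal_exp_abs_integrable hWm h2)
      fun ω => abs_le_exp_abs _
  have he : Real.exp 2 ≤ 7.5 := by
    have h1 : Real.exp 2 = Real.exp 1 ^ 2 := by rw [← Real.exp_nat_mul]; norm_num
    have h3 := Real.exp_one_lt_d9
    have h4 := Real.exp_pos 1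
    rw [h1]
    nlinarith
  have h3 : ∫⁻ ω, ENNReal.ofReal (Real.exp |Y ω * Z ω / c - m / c|) ∂μ ≤ ENNReal.ofReal 15 := by
    calc _ ≤ ∫⁻ ω, ENNReal.ofReal (Real.exp |Y ω * Z ω / c|) * ENNReal.ofReal (Real.exp 2) ∂μ := by
          refine lintegral_mono fun ω => ?_
          rw [← ofReal_exp_add]
          apply ENNReal.ofReal_le_ofReal (Real.exp_le_exp.2 _)
          exact (abs_sub _ _).trans (by gcongr)
      _ = (∫⁻ ω, ENNReal.ofReal (Real.exp |Y ω * Z ω / c|) ∂μ) * ENNReal.ofReal (Real.exp 2) :=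
          lintegral_mul_const _ (by fun_prop)
      _ ≤ ENNReal.ofReal 2 * ENNReal.ofReal 7.5 := by gcongr
      _ = _ := by rw [← ENNReal.ofReal_mul (by norm_num)]; norm_num
  have h0 : ∫ ω, (Y ω * Z ω / c - m / c) ∂μ = 0 := by
    rw [integral_sub hint (integrable_const _), hmc]
    simp
  have hs' : |s * c| ≤ 1 / 2 := by
    rw [abs_mul, abs_of_pos hc0, hc]
    linarith
  have h4 := mgf_le_of_exp_abs (by fun_prop) (by norm_num) h3 h0 hs'
  have e1 : ∀ ω, s * c * (Y ω * Z ω / c - m / c) = s * (Y ω * Z ω - m) := fun ω => by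
    field_simp
  simp only [e1] at h4
  refine h4.trans (ENNReal.ofReal_le_ofReal (Real.exp_le_exp.2 ?_))
  rw [mul_pow, hc, mul_pow, Real.sq_sqrt (by positivity)]
  have : 0 ≤ v * w * s ^ 2 := by positivity
  nlinarith

end SubGaussian

/-! ### Functions of blocks of independent variables -/

section Blocks

variable {Ω' τ E : Type*} [MeasurableSpace E]

/-- The `σ`-algebra generated by the variables `eps t`, `t ∈ S`. -/
@[reducible] def blockSigma (eps : τ → Ω' → E) (S : Set τ) : MeasurableSpace Ω' :=
  ⨆ t ∈ S, MeasurableSpace.comap (eps t) inferInstance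

lemma blockSigma_mono (eps : τ → Ω' → E) {S S' : Set τ} (h : S ⊆ S') :
    blockSigma eps S ≤ blockSigma eps S' :=
  biSup_mono fun _ ht => h ht

lemma measurable_blockSigma (eps : τ → Ω' → E) {S : Set τ} {t : τ} (ht : t ∈ S) :
    Measurable[blockSigma eps S] (eps t) :=
  (comap_measurable (eps t)).mono
    (le_iSup₂ (f := fun t (_ : t ∈ S) => MeasurableSpace.comap (eps t) inferInstance) t ht) le_rfl

variable [mΩ' : MeasurableSpace Ω'] {μ : Measure Ω'}

lemma blockSigma_le {eps : τ → Ω' → E} (hm : ∀ t, Measurable (eps t)) (S : Set τ) :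
    blockSigma eps S ≤ mΩ' :=
  iSup₂_le fun t _ => (hm t).comap_le

lemma indepFun_of_blockSigma {eps : τ → Ω' → E} (hm : ∀ t, Measurable (eps t))
    (hind : iIndepFun eps μ) {S S' : Set τ} (hS : Disjoint S S') {F G : Type*}
    [MeasurableSpace F] [MeasurableSpace G] {U : Ω' → F} {V : Ω' → G}
    (hU : Measurable[blockSigma eps S] U) (hV : Measurable[blockSigma eps S'] V) :
    IndepFun U V μ := by
  have h := indep_iSup_of_disjoint (m := fun t => MeasurableSpace.comap (eps t) inferInstance)
    (fun t => (hm t).comap_le) ((iIndepFun_iff_iIndep _ _ _).1 hind) hS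
  rw [IndepFun_iff_Indep]
  exact indep_of_indep_of_le_left (indep_of_indep_of_le_right h hV.comap_le) hU.comap_le

/-- Exponential moments of sums of functions of disjoint blocks. -/
lemma lintegral_exp_sum_le [IsProbabilityMeasure μ] {eps : τ → Ω' → E}
    (hm : ∀ t, Measurable (eps t)) (hind : iIndepFun eps μ) {β : Type*} [DecidableEq β]
    (I : Finset β) (S : β → Set τ) (hS : ∀ b ∈ I, ∀ b' ∈ I, b ≠ b' → Disjoint (S b) (S b'))
    (Z : β → Ω' → ℝ) (hZ : ∀ b ∈ I, Measurable[blockSigma eps (S b)] (Z b)) (a : β → ℝ)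
    (ha : ∀ b ∈ I, ∫⁻ ω, ENNReal.ofReal (Real.exp (Z b ω)) ∂μ
      ≤ ENNReal.ofReal (Real.exp (a b))) :
    ∫⁻ ω, ENNReal.ofReal (Real.exp (∑ b ∈ I, Z b ω)) ∂μ
      ≤ ENNReal.ofReal (Real.exp (∑ b ∈ I, a b)) := by
  induction I using Finset.induction_on with
  | empty => simp
  | insert b I hb ih =>
    have hI := ih (fun b' hb' b'' hb'' => hS b' (Finset.mem_insert_of_mem hb') b''
      (Finset.mem_insert_of_mem hb'')) (fun b' hb' => hZ b' (Finset.mem_insert_of_mem hb'))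
      (fun b' hb' => ha b' (Finset.mem_insert_of_mem hb'))
    have hU : Measurable[blockSigma eps (⋃ b' ∈ I, S b')] (fun ω => ∑ b' ∈ I, Z b' ω) :=
      Finset.measurable_fun_sum _ fun b' hb' => (hZ b' (Finset.mem_insert_of_mem hb')).mono
        (blockSigma_mono eps (Set.subset_biUnion_of_mem (u := S) hb')) le_rfl
    have hV := hZ b (Finset.mem_insert_self b I)
    have hdisj : Disjoint (S b) (⋃ b' ∈ I, S b') := by
      rw [Set.disjoint_iUnion₂_right]
      intro b' hb'
      exact hS b (Finset.mem_insert_self b I) b' (Finset.mem_insert_of_mem hb')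
        fun h => hb (h ▸ hb')
    have hexp : Measurable fun x : ℝ => ENNReal.ofReal (Real.exp x) := by fun_prop
    have hindep := (indepFun_of_blockSigma hm hind hdisj hV hU).comp hexp hexp
    simp only [Finset.sum_insert hb, ofReal_exp_add]
    have hVm := hV.mono (blockSigma_le hm _) le_rfl
    have hUm := hU.mono (blockSigma_le hm _) le_rfl
    have := lintegral_mul_eq_lintegral_mul_lintegral_of_indepFun (hexp.comp hVm)
      (hexp.comp hUm) hindep
    simp only [Pi.mul_apply, Function.comp_def] at this
    rw [this]
    exact mul_le_mul' (ha b (Finset.mem_insert_self b I)) hI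

/-- Integrating out an independent sub-Gaussian factor with a predictable coefficient. -/
lemma lintegral_mul_exp_le [IsProbabilityMeasure μ] {f : Ω' → ENNReal} {c e : Ω' → ℝ}
    (hf : Measurable f) (hc : Measurable c) (he : Measurable e)
    (hind : IndepFun (fun ω => (f ω, c ω)) e μ) {v b : ℝ} (hv : 0 ≤ v) (hev : SubG μ e v)
    (hb : ∀ ω, |c ω| ≤ b) :
    ∫⁻ ω, f ω * ENNReal.ofReal (Real.exp (c ω * e ω)) ∂μ
      ≤ ENNReal.ofReal (Real.exp (v * b ^ 2)) * ∫⁻ ω, f ω ∂μ := by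
  have hfc : Measurable fun ω => (f ω, c ω) := hf.prodMk hc
  -- Independence makes the joint law a product, so `e` can be integrated out while `f` and the
  -- coefficient `c` are held fixed.
  have hmap := hind.map_prod_eq_prod_map_map hfc.aemeasurable he.aemeasurable
  let G : (ENNReal × ℝ) × ℝ → ENNReal := fun p =>
    p.1.1 * ENNReal.ofReal (Real.exp (p.1.2 * p.2))
  have hG : Measurable G := by fun_prop
  have : IsProbabilityMeasure (μ.map e) := Measure.isProbabilityMeasure_map he.aemeasurable
  calc ∫⁻ ω, f ω * ENNReal.ofReal (Real.exp (c ω * e ω)) ∂μ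
      = ∫⁻ p, G p ∂(μ.map fun ω => ((f ω, c ω), e ω)) := by
        rw [lintegral_map hG (hfc.prodMk he)]
    _ = ∫⁻ q, ∫⁻ x, G (q, x) ∂(μ.map e) ∂(μ.map fun ω => (f ω, c ω)) := by
        rw [hmap, lintegral_prod _ hG.aemeasurable]
    _ ≤ ∫⁻ q : ENNReal × ℝ, q.1 * ENNReal.ofReal (Real.exp (v * q.2 ^ 2))
          ∂(μ.map fun ω => (f ω, c ω)) := by
        refine lintegral_mono fun q => ?_
        simp only [G]
        rw [lintegral_const_mul _ (by fun_prop), lintegral_map (by fun_prop) he]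
        gcongr
        exact hev q.2
    _ = ∫⁻ ω, f ω * ENNReal.ofReal (Real.exp (v * c ω ^ 2)) ∂μ := by
        rw [lintegral_map (by fun_prop) hfc]
    _ ≤ ∫⁻ ω, ENNReal.ofReal (Real.exp (v * b ^ 2)) * f ω ∂μ := by
        refine lintegral_mono fun ω => ?_
        dsimp only
        rw [mul_comm]
        gcongr ENNReal.ofReal (Real.exp (v * ?_)) * _
        exact sq_le_sq' (by linarith [(abs_le.1 (hb ω)).1]) (abs_le.1 (hb ω)).2
    _ = _ := lintegral_const_mul _ hf

/-- A martingale transform with bounded predictable coefficients is sub-Gaussian. -/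
lemma subG_martingale_transform [IsProbabilityMeasure μ] {E : Type*} [MeasurableSpace E]
    {eps : ℤ → Ω' → E}
    (hm : ∀ t, Measurable (eps t)) (hind : iIndepFun eps μ) {c e : ℕ → Ω' → ℝ} {b : ℕ → ℝ} {v : ℝ}
    (hv : 0 ≤ v)
    (hc : ∀ l : ℕ, Measurable[blockSigma eps (Set.Iic (l : ℤ))] (c l))
    (he : ∀ l : ℕ, Measurable[blockSigma eps {(l : ℤ) + 1}] (e l))
    (hcb : ∀ l ω, |c l ω| ≤ b l) (n : ℕ) (hev : ∀ l < n, SubG μ (e l) v) :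
    SubG μ (fun ω => ∑ l ∈ Finset.range n, c l ω * e l ω)
      (v * ∑ l ∈ Finset.range n, b l ^ 2) := by
  intro s
  have hcm := fun l => (hc l).mono (blockSigma_le hm _) le_rfl
  have hem := fun l => (he l).mono (blockSigma_le hm _) le_rfl
  induction n with
  | zero => simp
  | succ n ih =>
    have hpast : Measurable[blockSigma eps (Set.Iic (n : ℤ))]
        (fun ω => ∑ l ∈ Finset.range n, c l ω * e l ω) := by
      refine Finset.measurable_fun_sum _ fun l hl => ?_
      have hl' := Finset.mem_range.1 hl
      refine Measurable.mul ((hc l).mono (blockSigma_mono eps ?_) le_rfl)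
        ((he l).mono (blockSigma_mono eps ?_) le_rfl)
      · exact Set.Iic_subset_Iic.2 (by omega)
      · rw [Set.singleton_subset_iff, Set.mem_Iic]
        omega
    have hf : Measurable[blockSigma eps (Set.Iic (n : ℤ))] (fun ω => ENNReal.ofReal
        (Real.exp (s * ∑ l ∈ Finset.range n, c l ω * e l ω))) :=
      ENNReal.measurable_ofReal.comp (Real.measurable_exp.comp (hpast.const_mul s))
    have hdis : Disjoint (Set.Iic (n : ℤ)) {(n : ℤ) + 1} := by
      rw [Set.disjoint_singleton_right, Set.mem_Iic]
      omega
    -- The last increment uses the innovation at time `n + 1`, while its coefficient and all earlier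
    -- terms are functions of innovations up to time `n`. The last factor can therefore be peeled
    -- off.
    have hi := indepFun_of_blockSigma hm hind hdis (hf.prodMk ((hc n).const_mul s)) (he n)
    have key := lintegral_mul_exp_le (hf.mono (blockSigma_le hm _) le_rfl)
      ((hcm n).const_mul s) (hem n) hi hv (hev n (Nat.lt_succ_self n)) (b := |s| * b n)
      (fun ω => by rw [abs_mul]; gcongr; exact hcb n ω)
    simp only [Finset.sum_range_succ, mul_add, ofReal_exp_add]
    simp only [mul_assoc] at key ⊢
    refine key.trans ?_
    have ih' := ih fun l hl => hev l (hl.trans (Nat.lt_succ_self n))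
    refine (mul_le_mul_right ih' _).trans (le_of_eq ?_)
    rw [← ofReal_exp_add, mul_pow, sq_abs]
    congr 2
    ring

end Blocks

/-! ### Finite-order linear processes with sub-Gaussian innovations -/

section LinearProcess

variable {Ω' : Type*} {d : ℕ}

/-- The moving average `∑_{k < m} C_{l,k} ε_{l-k}`. -/
def linProc (Cf : ℕ → ℕ → Matrix (Fin d) (Fin d) ℝ) (eps : ℤ → Ω' → Fin d → ℝ) (m l : ℕ)
    (ω : Ω') : Fin d → ℝ :=
  ∑ k ∈ Finset.range m, Cf l k *ᵥ eps ((l : ℤ) - k) ω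

/-- The covariance form of `linProc`. -/
def covForm (Cf : ℕ → ℕ → Matrix (Fin d) (Fin d) ℝ) (m l : ℕ) (u v : Fin d → ℝ) : ℝ :=
  ∑ k ∈ Finset.range m, (u ᵥ* Cf l k) ⬝ᵥ (v ᵥ* Cf l k)

variable {Cf : ℕ → ℕ → Matrix (Fin d) (Fin d) ℝ} {eps : ℤ → Ω' → Fin d → ℝ} {B : ℝ}

lemma dot_linProc (m l : ℕ) (u : Fin d → ℝ) (ω : Ω') :
    u ⬝ᵥ linProc Cf eps m l ω = ∑ k ∈ Finset.range m, (u ᵥ* Cf l k) ⬝ᵥ eps ((l : ℤ) - k) ω := by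
  rw [linProc, dotProduct_sum]
  exact Finset.sum_congr rfl fun k _ => Matrix.dotProduct_mulVec _ _ _

lemma measurable_dot_eps {S : Set ℤ} {t : ℤ} (ht : t ∈ S) (u : Fin d → ℝ) :
    Measurable[blockSigma eps S] (fun ω => u ⬝ᵥ eps t ω) := by
  have h : Measurable fun x : Fin d → ℝ => u ⬝ᵥ x := by
    unfold dotProduct
    fun_prop
  exact h.comp (measurable_blockSigma eps ht)

/-- Only the innovations at the `m` times ending at `l` enter. This gives predictability relative to
time `l + 1`, and independence of values at least `m` apart. -/
lemma measurable_blockSigma_dot_linProc (m l : ℕ) (u : Fin d → ℝ) :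
    Measurable[blockSigma eps (Set.Ioc ((l : ℤ) - m) l)] (fun ω => u ⬝ᵥ linProc Cf eps m l ω) := by
  simp only [dot_linProc]
  refine Finset.measurable_fun_sum _ fun k hk => measurable_dot_eps ?_ _
  have := Finset.mem_range.1 hk
  rw [Set.mem_Ioc]
  omega

variable [mΩ' : MeasurableSpace Ω'] {μ : Measure Ω'}

/-- Independent centred standardised innovations with sub-Gaussian constant `B`. -/
structure SubGInnov (μ : Measure Ω') (eps : ℤ → Ω' → Fin d → ℝ) (B : ℝ) : Prop where
  meas : ∀ t, Measurable (eps t)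
  indep : iIndepFun eps μ
  mean : ∀ t j, ∫ ω, eps t ω j ∂μ = 0
  cov : ∀ t j k, ∫ ω, eps t ω j * eps t ω k ∂μ = if j = k then 1 else 0
  pos : 0 < B
  subG : ∀ t u, SubG μ (fun ω => u ⬝ᵥ eps t ω) (B * (u ⬝ᵥ u))

lemma SubGInnov.measurable_dot (H : SubGInnov μ eps B) (t : ℤ) (u : Fin d → ℝ) :
    Measurable (fun ω => u ⬝ᵥ eps t ω) :=
  (measurable_dot_eps (Set.mem_singleton t) u).mono (blockSigma_le H.meas _) le_rfl

lemma SubGInnov.measurable_dot_linProc (H : SubGInnov μ eps B) (m l : ℕ) (u : Fin d → ℝ) :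
    Measurable (fun ω => u ⬝ᵥ linProc Cf eps m l ω) :=
  (measurable_blockSigma_dot_linProc m l u).mono (blockSigma_le H.meas _) le_rfl

lemma SubGInnov.subG_sum [IsProbabilityMeasure μ] (H : SubGInnov μ eps B) (l : ℤ)
    (I : Finset ℕ) (a : ℕ → Fin d → ℝ) :
    SubG μ (fun ω => ∑ k ∈ I, a k ⬝ᵥ eps (l - k) ω) (B * ∑ k ∈ I, a k ⬝ᵥ a k) := by
  intro s
  have h := lintegral_exp_sum_le H.meas H.indep I (fun k : ℕ => {l - (k : ℤ)})
    (fun b _ b' _ hbb => by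
      rw [Set.disjoint_singleton]
      omega)
    (fun k ω => s * (a k ⬝ᵥ eps (l - k) ω))
    (fun k _ => (measurable_dot_eps (Set.mem_singleton _) (a k)).const_mul s)
    (fun k => B * (a k ⬝ᵥ a k) * s ^ 2) (fun k _ => H.subG _ _ s)
  simp only [← Finset.mul_sum, ← Finset.sum_mul] at h
  exact h

lemma SubGInnov.subG_linProc [IsProbabilityMeasure μ] (H : SubGInnov μ eps B) (m l : ℕ)
    (u : Fin d → ℝ) : SubG μ (fun ω => u ⬝ᵥ linProc Cf eps m l ω) (B * covForm Cf m l u u) := by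
  simp only [dot_linProc]
  exact H.subG_sum l (Finset.range m) fun k => u ᵥ* Cf l k

lemma dotProduct_self_nonneg' (u : Fin d → ℝ) : 0 ≤ u ⬝ᵥ u :=
  Finset.sum_nonneg fun _ _ => mul_self_nonneg _

lemma covForm_self_nonneg (m l : ℕ) (u : Fin d → ℝ) : 0 ≤ covForm Cf m l u u :=
  Finset.sum_nonneg fun _ _ => dotProduct_self_nonneg' _

lemma integrable_mul_of_subG [SFinite μ] {Y Z : Ω' → ℝ} (hY : Measurable Y) (hZ : Measurable Z)
    {v w : ℝ} (hYv : SubG μ Y v) (hZw : SubG μ Z w) :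
    Integrable (fun ω => Y ω * Z ω) μ := by
  -- The proxies are enlarged to `|v| + 1` and `|w| + 1` because the exponential moment bound needs
  -- strictly positive ones.
  have h := integrable_of_exp_abs (by fun_prop) (lintegral_exp_abs_mul_le hY hZ
    (v := |v| + 1) (w := |w| + 1) (by positivity) (by positivity)
    (hYv.mono (by linarith [le_abs_self v])) (hZw.mono (by linarith [le_abs_self w])))
  have h2 := h.mul_const (8 * √((|v| + 1) * (|w| + 1)))
  refine h2.congr (ae_of_all _ fun ω => ?_)
  have : 0 < √((|v| + 1) * (|w| + 1)) := Real.sqrt_pos.2 (by positivity)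
  field_simp

lemma SubGInnov.integrable_mul [IsProbabilityMeasure μ] (H : SubGInnov μ eps B) (s t : ℤ)
    (a b : Fin d → ℝ) : Integrable (fun ω => (a ⬝ᵥ eps s ω) * (b ⬝ᵥ eps t ω)) μ :=
  integrable_mul_of_subG (H.measurable_dot s a) (H.measurable_dot t b) (H.subG s a) (H.subG t b)

lemma SubGInnov.integrable_eps [IsProbabilityMeasure μ] (H : SubGInnov μ eps B) (t : ℤ)
    (j : Fin d) : Integrable (fun ω => eps t ω j) μ := by
  have hsq : Integrable (fun ω => eps t ω j * eps t ω j) μ := by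
    simpa using H.integrable_mul t t (Pi.single j 1) (Pi.single j 1)
  have hm : Measurable fun ω => eps t ω j := (measurable_pi_apply j).comp (H.meas t)
  refine (hsq.add (integrable_const (1 : ℝ))).mono' hm.aestronglyMeasurable
    (ae_of_all _ fun ω => ?_)
  rw [Real.norm_eq_abs]
  change |eps t ω j| ≤ eps t ω j * eps t ω j + 1
  nlinarith [sq_nonneg (|eps t ω j| - 1), abs_mul_abs_self (eps t ω j)]

lemma SubGInnov.integral_mul [IsProbabilityMeasure μ] (H : SubGInnov μ eps B) (s t : ℤ)
    (a b : Fin d → ℝ) :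
    ∫ ω, (a ⬝ᵥ eps s ω) * (b ⬝ᵥ eps t ω) ∂μ = if s = t then a ⬝ᵥ b else 0 := by
  split_ifs with hst
  · subst hst
    have e : ∀ ω, (a ⬝ᵥ eps s ω) * (b ⬝ᵥ eps s ω)
        = ∑ j, ∑ k, a j * b k * (eps s ω j * eps s ω k) := by
      intro ω
      simp only [dotProduct]
      rw [Finset.sum_mul_sum]
      exact Finset.sum_congr rfl fun j _ => Finset.sum_congr rfl fun k _ => by ring
    have hint : ∀ j k, Integrable (fun ω => a j * b k * (eps s ω j * eps s ω k)) μ := by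
      intro j k
      have := H.integrable_mul s s (Pi.single j 1) (Pi.single k 1)
      simp only [single_one_dotProduct] at this
      exact this.const_mul _
    simp only [e]
    rw [integral_finsetSum _ fun j _ => integrable_finsetSum _ fun k _ => hint j k]
    simp only [dotProduct]
    refine Finset.sum_congr rfl fun j _ => ?_
    rw [integral_finsetSum _ fun k _ => hint j k]
    simp only [integral_const_mul, H.cov]
    simp
  · have hi : IndepFun (fun ω => a ⬝ᵥ eps s ω) (fun ω => b ⬝ᵥ eps t ω) μ :=
      indepFun_of_blockSigma H.meas H.indep (Set.disjoint_singleton.2 hst)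
        (measurable_dot_eps (Set.mem_singleton s) a) (measurable_dot_eps (Set.mem_singleton t) b)
    rw [hi.integral_fun_mul_eq_mul_integral (H.measurable_dot s a).aestronglyMeasurable
      (H.measurable_dot t b).aestronglyMeasurable]
    have : ∫ ω, a ⬝ᵥ eps s ω ∂μ = 0 := by
      simp only [dotProduct]
      rw [integral_finsetSum _ fun j _ => (H.integrable_eps s j).const_mul _]
      simp only [integral_const_mul, H.mean, mul_zero, Finset.sum_const_zero]
    rw [this, zero_mul]

/-- Innovations at different times are uncorrelated, so only the diagonal of the double sum
survives. This identifies the centring in the Gram deviation bound. -/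
lemma SubGInnov.integral_linProc_mul [IsProbabilityMeasure μ] (H : SubGInnov μ eps B) (m l : ℕ)
    (u v : Fin d → ℝ) :
    ∫ ω, (u ⬝ᵥ linProc Cf eps m l ω) * (v ⬝ᵥ linProc Cf eps m l ω) ∂μ = covForm Cf m l u v := by
  simp only [dot_linProc, Finset.sum_mul_sum]
  rw [integral_finsetSum _ fun j _ => integrable_finsetSum _ fun k _ => H.integrable_mul _ _ _ _]
  refine Finset.sum_congr rfl fun j hj => ?_
  rw [integral_finsetSum _ fun k _ => H.integrable_mul _ _ _ _]
  simp only [H.integral_mul]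
  rw [Finset.sum_eq_single j]
  · simp
  · intro k _ hkj
    rw [if_neg]
    omega
  · exact fun h => absurd hj h

/-- Tail bound for linear forms of the process. -/
lemma SubGInnov.linProc_tail [IsProbabilityMeasure μ] (H : SubGInnov μ eps B) (m l : ℕ)
    (u : Fin d → ℝ) {σ2 x : ℝ} (hσ : 0 < σ2) (hq : covForm Cf m l u u ≤ σ2) (hx : 0 ≤ x) :
    μ {ω | √(4 * x * (B * σ2)) < |u ⬝ᵥ linProc Cf eps m l ω|}
      ≤ 2 * ENNReal.ofReal (Real.exp (-x)) :=
  ((H.subG_linProc m l u).mono (mul_le_mul_of_nonneg_left hq H.pos.le)).tail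
    (H.measurable_dot_linProc m l u) (mul_pos H.pos hσ) hx

/-- Deviation bound for weighted sums of products of the process with the next innovation. -/
theorem SubGInnov.noise_bound [IsProbabilityMeasure μ] (H : SubGInnov μ eps B) (m n : ℕ)
    (c : ℕ → ℝ) (v r : ℕ → Fin d → ℝ) (σ2 : ℕ → ℝ) {Cw V x : ℝ} (hσ : ∀ l < n, 0 < σ2 l)
    (hq : ∀ l < n, covForm Cf m l (v l) (v l) ≤ σ2 l) (hr : ∀ l < n, r l ⬝ᵥ r l ≤ Cw)
    (hCw : 0 < Cw) (hV : ∑ l ∈ Finset.range n, c l ^ 2 * σ2 l ≤ V) (hV0 : 0 < V) (hx : 0 < x) :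
    μ {ω | 4 * x * B * √(Cw * V) < |∑ l ∈ Finset.range n,
      c l * (v l ⬝ᵥ linProc Cf eps m l ω) * (r l ⬝ᵥ eps ((l : ℤ) + 1) ω)|}
      ≤ (2 * n + 2) * ENNReal.ofReal (Real.exp (-x)) := by
  have hB := H.pos
  -- The predictable coefficients are unbounded, so they are cut at their own tail level. The
  -- transform of the cut coefficients is sub-Gaussian, and it agrees with the original sum outside
  -- `n` events of probability at most `2 exp (-x)` each.
  set b : ℕ → ℝ := fun l => √(4 * x * (B * σ2 l)) with hb
  let p : ℕ → Ω' → ℝ := fun l ω =>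
    c l * (if |v l ⬝ᵥ linProc Cf eps m l ω| ≤ b l then v l ⬝ᵥ linProc Cf eps m l ω else 0)
  have hpm : ∀ l : ℕ, Measurable[blockSigma eps (Set.Iic (l : ℤ))] (p l) := by
    intro l
    have h1 : Measurable fun y : ℝ => c l * (if |y| ≤ b l then y else 0) :=
      (Measurable.ite (measurableSet_le measurable_id.abs measurable_const) measurable_id
        measurable_const).const_mul _
    exact h1.comp ((measurable_blockSigma_dot_linProc m l (v l)).mono
      (blockSigma_mono eps Set.Ioc_subset_Iic_self) le_rfl)
  have hpb : ∀ l ω, |p l ω| ≤ |c l| * b l := by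
    intro l ω
    simp only [p, abs_mul]
    gcongr
    split_ifs with h
    · exact h
    · rw [abs_zero]; exact Real.sqrt_nonneg _
  have hmart := subG_martingale_transform (v := B * Cw) H.meas H.indep (by positivity) hpm
    (fun l => measurable_dot_eps (Set.mem_singleton _) (r l)) hpb n
    (fun l hl => (H.subG _ (r l)).mono (by gcongr; exact hr l hl))
  have hsum : B * Cw * ∑ l ∈ Finset.range n, (|c l| * b l) ^ 2 ≤ 4 * x * B ^ 2 * Cw * V := by
    have : ∀ l ∈ Finset.range n, (|c l| * b l) ^ 2 = 4 * x * B * (c l ^ 2 * σ2 l) := by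
      intro l hl
      have := hσ l (Finset.mem_range.1 hl)
      rw [mul_pow, sq_abs, hb, Real.sq_sqrt (by positivity)]
      ring
    rw [Finset.sum_congr rfl this, ← Finset.mul_sum]
    calc B * Cw * (4 * x * B * ∑ l ∈ Finset.range n, c l ^ 2 * σ2 l)
        ≤ B * Cw * (4 * x * B * V) := by gcongr
      _ = _ := by ring
  have hM : Measurable fun ω => ∑ l ∈ Finset.range n, p l ω * (r l ⬝ᵥ eps ((l : ℤ) + 1) ω) :=
    Finset.measurable_fun_sum _ fun l _ =>
      ((hpm l).mono (blockSigma_le H.meas _) le_rfl).mul (H.measurable_dot _ _)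
  have htail := (hmart.mono hsum).tail hM (by positivity) hx.le
  have he : √(4 * x * (4 * x * B ^ 2 * Cw * V)) = 4 * x * B * √(Cw * V) := by
    rw [show 4 * x * (4 * x * B ^ 2 * Cw * V) = (4 * x * B) ^ 2 * (Cw * V) by ring,
      Real.sqrt_mul (by positivity), Real.sqrt_sq (by positivity)]
  rw [he] at htail
  have hsub : {ω | 4 * x * B * √(Cw * V) < |∑ l ∈ Finset.range n,
      c l * (v l ⬝ᵥ linProc Cf eps m l ω) * (r l ⬝ᵥ eps ((l : ℤ) + 1) ω)|}
      ⊆ (⋃ l ∈ Finset.range n, {ω | b l < |v l ⬝ᵥ linProc Cf eps m l ω|}) ∪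
        {ω | 4 * x * B * √(Cw * V) < |∑ l ∈ Finset.range n,
          p l ω * (r l ⬝ᵥ eps ((l : ℤ) + 1) ω)|} := by
    intro ω hω
    by_cases h : ∃ l ∈ Finset.range n, b l < |v l ⬝ᵥ linProc Cf eps m l ω|
    · left
      simpa using h
    · right
      push Not at h
      have : ∑ l ∈ Finset.range n, p l ω * (r l ⬝ᵥ eps ((l : ℤ) + 1) ω)
          = ∑ l ∈ Finset.range n,
            c l * (v l ⬝ᵥ linProc Cf eps m l ω) * (r l ⬝ᵥ eps ((l : ℤ) + 1) ω) :=
        Finset.sum_congr rfl fun l hl => by simp only [p, if_pos (h l hl)]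
      rw [Set.mem_ofPred_eq, this]
      exact hω
  calc _ ≤ _ := measure_mono hsub
    _ ≤ _ := measure_union_le _ _
    _ ≤ ∑ l ∈ Finset.range n, 2 * ENNReal.ofReal (Real.exp (-x))
        + 2 * ENNReal.ofReal (Real.exp (-x)) := by
      refine add_le_add ((measure_biUnion_finset_le _ _).trans (Finset.sum_le_sum fun l hl => ?_))
        htail
      have hl' := Finset.mem_range.1 hl
      exact H.linProc_tail m l (v l) (hσ l hl') (hq l hl') hx.le
    _ = _ := by
      rw [Finset.sum_const, Finset.card_range, nsmul_eq_mul]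
      ring

/-- Deviation bound for weighted sample covariances of the process. -/
theorem SubGInnov.gram_bound [IsProbabilityMeasure μ] (H : SubGInnov μ eps B) {m : ℕ}
    (hm : 0 < m) (n : ℕ) (c : ℕ → ℝ) (v v' : ℕ → Fin d → ℝ) (σ2 : ℕ → ℝ) {w2 V s u : ℝ}
    (hσ : ∀ l < n, 0 < σ2 l) (hw : 0 < w2)
    (hq : ∀ l < n, covForm Cf m l (v l) (v l) ≤ σ2 l)
    (hq' : ∀ l < n, covForm Cf m l (v' l) (v' l) ≤ w2)
    (hV : ∑ l ∈ Finset.range n, c l ^ 2 * σ2 l ≤ V) (hs : 0 ≤ s)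
    (hsc : ∀ l < n, s * |c l| * (B * √(σ2 l * w2)) ≤ 1 / 16) :
    μ {ω | m * u < |∑ l ∈ Finset.range n, c l * ((v l ⬝ᵥ linProc Cf eps m l ω) *
      (v' l ⬝ᵥ linProc Cf eps m l ω) - covForm Cf m l (v l) (v' l))|}
      ≤ 2 * m * ENNReal.ofReal (Real.exp (10000 * B ^ 2 * w2 * V * s ^ 2 - s * u)) := by
  have hB := H.pos
  set Z : ℕ → Ω' → ℝ := fun l ω => c l * ((v l ⬝ᵥ linProc Cf eps m l ω) *
      (v' l ⬝ᵥ linProc Cf eps m l ω) - covForm Cf m l (v l) (v' l)) with hZ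
  have hZm : ∀ l : ℕ, Measurable[blockSigma eps (Set.Ioc ((l : ℤ) - m) l)] (Z l) := fun l =>
    (((measurable_blockSigma_dot_linProc m l (v l)).mul
      (measurable_blockSigma_dot_linProc m l (v' l))).sub
      measurable_const).const_mul _
  -- Within a residue class modulo `m` the innovation blocks `(l - m, l]` are disjoint, so the
  -- summands are independent. There are `m` classes with two signs each, whence the factor `2 * m`;
  -- if every class sum is at most `u` in absolute value, the total is at most `m * u`.
  let I : ℕ → Finset ℕ := fun r => (Finset.range n).filter fun l => l % m = r
  have hclass : ∀ r, ∀ ε : ℝ, |ε| = 1 →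
      μ {ω | s * u ≤ s * ε * ∑ l ∈ I r, Z l ω}
        ≤ ENNReal.ofReal (Real.exp (10000 * B ^ 2 * w2 * V * s ^ 2 - s * u)) := by
    intro r ε hε
    have hε2 : ε ^ 2 = 1 := by rw [← sq_abs, hε, one_pow]
    have hsum := lintegral_exp_sum_le H.meas H.indep (I r)
      (fun l : ℕ => Set.Ioc ((l : ℤ) - m) l) ?_ (fun l ω => s * ε * Z l ω)
      (fun l _ => (hZm l).const_mul _)
      (fun l => 10000 * ((B * σ2 l) * (B * w2)) * (s * ε * c l) ^ 2) ?_
    · simp only [← Finset.mul_sum] at hsum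
      refine measure_ge_le_exp_of_lintegral ?_ (s * u) (hsum.trans ?_)
      · exact (Finset.measurable_fun_sum _ fun l _ =>
          (hZm l).mono (blockSigma_le H.meas _) le_rfl).const_mul _
      · apply ENNReal.ofReal_le_ofReal (Real.exp_le_exp.2 _)
        have e : ∀ l ∈ I r, 10000 * ((B * σ2 l) * (B * w2)) * (s * ε * c l) ^ 2
            = 10000 * B ^ 2 * w2 * s ^ 2 * (c l ^ 2 * σ2 l) := fun l _ => by
          rw [mul_pow, mul_pow, hε2]; ring
        rw [Finset.sum_congr rfl e, ← Finset.mul_sum]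
        have hle : ∑ l ∈ I r, c l ^ 2 * σ2 l ≤ V :=
          (Finset.sum_le_sum_of_subset_of_nonneg (Finset.filter_subset _ _) fun l hl _ =>
            mul_nonneg (sq_nonneg _) (hσ l (Finset.mem_range.1 hl)).le).trans hV
        calc _ ≤ 10000 * B ^ 2 * w2 * s ^ 2 * V := by gcongr
          _ = _ := by ring
    · intro a ha b hb hab
      have ha' := (Finset.mem_filter.1 ha).2
      have hb' := (Finset.mem_filter.1 hb).2
      rw [Set.disjoint_left]
      intro z hz hz'
      rw [Set.mem_Ioc] at hz hz'
      have hmod : a ≡ b [MOD m] := ha'.trans hb'.symm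
      have hmod' : (m : ℤ) ∣ (b : ℤ) - a := (Nat.modEq_iff_dvd).1 hmod
      have h1 : |(b : ℤ) - a| < m := by rw [abs_lt]; omega
      have h2 := Int.eq_zero_of_abs_lt_dvd hmod' h1
      omega
    · intro l hl
      have hl' := Finset.mem_range.1 (Finset.mem_filter.1 hl).1
      have hσl := hσ l hl'
      have h := mgf_centered_mul_le (s := s * ε * c l) (H.measurable_dot_linProc m l (v l))
        (H.measurable_dot_linProc m l (v' l)) (v := B * σ2 l) (w := B * w2) (by positivity)
        (by positivity)
        ((H.subG_linProc m l (v l)).mono (by gcongr; exact hq l hl'))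
        ((H.subG_linProc m l (v' l)).mono (by gcongr; exact hq' l hl')) ?_
      · rw [H.integral_linProc_mul] at h
        simp only [hZ, ← mul_assoc] at h ⊢
        exact h
      · rw [abs_mul, abs_mul, hε, abs_of_nonneg hs, mul_one,
          show B * σ2 l * (B * w2) = B ^ 2 * (σ2 l * w2) by ring,
          Real.sqrt_mul (by positivity), Real.sqrt_sq hB.le]
        exact hsc l hl'
  have hdecomp : ∀ ω, ∑ l ∈ Finset.range n, Z l ω
      = ∑ r ∈ Finset.range m, ∑ l ∈ I r, Z l ω := fun ω =>
    (Finset.sum_fiberwise_of_maps_to (fun l _ => Finset.mem_range.2 (Nat.mod_lt l hm)) _).symm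
  have hsub : {ω | m * u < |∑ l ∈ Finset.range n, Z l ω|}
      ⊆ ⋃ r ∈ Finset.range m, ({ω | s * u ≤ s * 1 * ∑ l ∈ I r, Z l ω} ∪
        {ω | s * u ≤ s * (-1) * ∑ l ∈ I r, Z l ω}) := by
    intro ω hω
    rw [Set.mem_ofPred_eq, hdecomp] at hω
    by_contra hcon
    simp only [Set.mem_iUnion, not_exists, Set.mem_union, not_or, Set.mem_ofPred_eq] at hcon
    have h1 : ∀ r ∈ Finset.range m, |∑ l ∈ I r, Z l ω| ≤ u := by
      intro r hr
      obtain ⟨h2, h3⟩ := hcon r hr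
      -- For `s = 0` both one-sided events are the whole space, so being outside them forces `s >
      -- 0`.
      have hs0 : 0 < s := by
        rcases hs.eq_or_lt with h | h
        · rw [← h] at h2; simp at h2
        · exact h
      rw [abs_le]
      constructor
      · by_contra h4
        apply h3
        nlinarith
      · by_contra h4
        apply h2
        nlinarith
    have h2 := (Finset.abs_sum_le_sum_abs _ _).trans (Finset.sum_le_sum h1)
    rw [Finset.sum_const, Finset.card_range, nsmul_eq_mul] at h2
    linarith
  calc _ ≤ _ := measure_mono hsub
    _ ≤ ∑ r ∈ Finset.range m,
        (ENNReal.ofReal (Real.exp (10000 * B ^ 2 * w2 * V * s ^ 2 - s * u))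
          + ENNReal.ofReal (Real.exp (10000 * B ^ 2 * w2 * V * s ^ 2 - s * u))) := by
      refine (measure_biUnion_finset_le _ _).trans (Finset.sum_le_sum fun r _ => ?_)
      exact (measure_union_le _ _).trans
        (add_le_add (hclass r 1 (by simp)) (hclass r (-1) (by simp)))
    _ = _ := by
      rw [Finset.sum_const, Finset.card_range, nsmul_eq_mul]
      ring

end LinearProcess

/-! ### Kernel weights -/

section Kernel

/-- The rescaled time difference `(τ_l - τ_t) / h`. -/
def locW (n : ℕ) (h : ℝ) (t l : ℕ) : ℝ := ((l : ℝ) - t) / (n * h)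

/-- The weight `n⁻¹ K_h(τ_l - τ_t)`. -/
def locK (K : ℝ → ℝ) (n : ℕ) (h : ℝ) (t l : ℕ) : ℝ := K (locW n h t l) / (n * h)

variable {K : ℝ → ℝ} {n : ℕ} {h : ℝ}

lemma locK_nonneg (hK : KernelCond K) (hh : 0 < h) (t l : ℕ) : 0 ≤ locK K n h t l :=
  div_nonneg (hK.nonneg _) (by positivity)

lemma locK_le {C : ℝ} (hC : ∀ x, K x ≤ C) (hh : 0 < h) (t l : ℕ) :
    locK K n h t l ≤ C / (n * h) := by
  unfold locK
  gcongr
  exact hC _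

lemma abs_locW_le_one (hK : KernelCond K) {t l : ℕ} (hl : locK K n h t l ≠ 0) :
    |locW n h t l| ≤ 1 := by
  by_contra hcon
  apply hl
  rw [locK, hK.support _ (fun hx => hcon (abs_le.2 hx)), zero_div]

/-- The window contains at most `2 n h + 1 ≤ 3 n h` grid points, each of weight at most `C / (n h)`.
-/
lemma sum_locK_le (hK : KernelCond K) {C : ℝ} (hC : ∀ x, K x ≤ C) (hh : 0 < h)
    (hnh : 1 ≤ n * h) (t : ℕ) : ∑ l ∈ Finset.range n, locK K n h t l ≤ 3 * C := by
  have hpos : 0 < n * h := by linarith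
  have hC0 : 0 ≤ C := (hK.nonneg 0).trans (hC 0)
  set F := ⌊n * h⌋₊ with hF
  have hFle : (F : ℝ) ≤ n * h := Nat.floor_le hpos.le
  have hsub : ((Finset.range n).filter fun l => locK K n h t l ≠ 0)
      ⊆ Finset.Icc (t - F) (t + F) := by
    intro l hl
    have h1 := abs_locW_le_one hK (Finset.mem_filter.1 hl).2
    rw [locW, abs_div, abs_of_pos hpos, div_le_one hpos, abs_le] at h1
    rw [Finset.mem_Icc]
    constructor
    · have h2 : (t : ℝ) - l ≤ n * h := by linarith
      rcases le_total t l with h3 | h3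
      · omega
      · have h4 : ((t - l : ℕ) : ℝ) ≤ n * h := by rw [Nat.cast_sub h3]; exact h2
        have := Nat.le_floor h4
        omega
    · rcases le_total l t with h3 | h3
      · omega
      · have h4 : ((l - t : ℕ) : ℝ) ≤ n * h := by rw [Nat.cast_sub h3]; exact h1.2
        have := Nat.le_floor h4
        omega
  calc ∑ l ∈ Finset.range n, locK K n h t l
      = ∑ l ∈ (Finset.range n).filter (fun l => locK K n h t l ≠ 0), locK K n h t l :=
        (Finset.sum_filter_ne_zero _).symm
    _ ≤ ∑ l ∈ (Finset.range n).filter (fun l => locK K n h t l ≠ 0), C / (n * h) :=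
        Finset.sum_le_sum fun l _ => locK_le hC hh t l
    _ ≤ ∑ l ∈ Finset.Icc (t - F) (t + F), C / (n * h) :=
        Finset.sum_le_sum_of_subset_of_nonneg hsub fun _ _ _ => by positivity
    _ ≤ (2 * F + 1) * (C / (n * h)) := by
        rw [Finset.sum_const, nsmul_eq_mul, Nat.card_Icc]
        gcongr
        have : t + F + 1 - (t - F) ≤ 2 * F + 1 := by omega
        exact_mod_cast this
    _ ≤ (3 * (n * h)) * (C / (n * h)) := by gcongr; linarith
    _ = 3 * C := by rw [mul_assoc, mul_div_cancel₀ _ hpos.ne']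

/-- A nonnegative kernel density is bounded below on an interval of positive reals. -/
lemma KernelCond.exists_lower (hK : KernelCond K) :
    ∃ p q c : ℝ, 0 < p ∧ p < q ∧ 0 < c ∧ ∀ x, p ≤ |x| → |x| ≤ q → c ≤ K x := by
  have hKabs : ∀ x, K |x| = K x := fun x => by
    rcases abs_cases x with ⟨hx, _⟩ | ⟨hx, _⟩ <;> rw [hx]
    exact hK.symm x
  obtain ⟨x₀, hx₀⟩ : ∃ x, 0 < K x := by
    by_contra hcon
    push Not at hcon
    have : K = fun _ => 0 := funext fun x => le_antisymm (hcon x) (hK.nonneg x)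
    have h1 := hK.integral_one
    rw [this] at h1
    simp at h1
  rw [← hKabs] at hx₀
  have hopen := hK.cont.continuousAt.eventually (lt_mem_nhds (half_lt_self hx₀))
  obtain ⟨ε, hε, hball⟩ := Metric.eventually_nhds_iff.1 hopen
  -- The interval is moved to the right of `|x₀|` so that its left end is positive even when `x₀ =
  -- 0`.
  refine ⟨|x₀| + ε / 4, |x₀| + ε / 2, K |x₀| / 2, by positivity, by linarith, by positivity, ?_⟩
  intro x h1 h2
  rw [← hKabs x]
  apply (hball _).le
  rw [Real.dist_eq, abs_lt]
  constructor <;> linarith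

/-- An affine function is determined by its values at two separated points: the difference of the
values gives the slope, and one value then gives the intercept. -/
lemma sq_add_sq_le_of_two_points {a b w w' q δ : ℝ} (hδ : 0 < δ) (hw : |w| ≤ q)
    (hww : δ ≤ |w' - w|) :
    a ^ 2 + b ^ 2 ≤ (2 + (4 * q ^ 2 + 2) / δ ^ 2) * ((a + w * b) ^ 2 + (a + w' * b) ^ 2) := by
  have h1 : b ^ 2 * δ ^ 2 ≤ 2 * ((a + w * b) ^ 2 + (a + w' * b) ^ 2) := by
    have h2 : δ ^ 2 ≤ (w' - w) ^ 2 := by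
      rw [← sq_abs (w' - w)]
      gcongr
    nlinarith [sq_nonneg ((a + w * b) + (a + w' * b)), mul_le_mul_of_nonneg_left h2 (sq_nonneg b)]
  have h2 : b ^ 2 ≤ 2 * ((a + w * b) ^ 2 + (a + w' * b) ^ 2) / δ ^ 2 := by
    rw [le_div_iff₀ (by positivity)]
    exact h1
  have hw2 : w ^ 2 ≤ q ^ 2 := by
    rw [← sq_abs w]
    gcongr
  have h3 : a ^ 2 ≤ 2 * (a + w * b) ^ 2 + 2 * q ^ 2 * b ^ 2 := by
    nlinarith [sq_nonneg (a + w * b + w * b), mul_le_mul_of_nonneg_right hw2 (sq_nonneg b)]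
  have h4 := mul_le_mul_of_nonneg_left h2 (by positivity : 0 ≤ 2 * q ^ 2 + 1)
  have h5 : (2 * q ^ 2 + 1) * (2 * ((a + w * b) ^ 2 + (a + w' * b) ^ 2) / δ ^ 2)
      = (4 * q ^ 2 + 2) / δ ^ 2 * ((a + w * b) ^ 2 + (a + w' * b) ^ 2) := by ring
  nlinarith [sq_nonneg (a + w' * b)]

lemma sum_injOn_le {n G : ℕ} {F : ℕ → ℝ} (hF : ∀ l, 0 ≤ F l) (φ : ℕ → ℕ)
    (hφ : ∀ r < G, φ r < n) (hinj : ∀ r < G, ∀ r' < G, φ r = φ r' → r = r') :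
    ∑ r ∈ Finset.range G, F (φ r) ≤ ∑ l ∈ Finset.range n, F l := by
  rw [← Finset.sum_image (f := F) (g := φ) fun r hr r' hr' =>
    hinj r (by simpa using hr) r' (by simpa using hr')]
  refine Finset.sum_le_sum_of_subset_of_nonneg ?_ fun l _ _ => hF l
  intro l hl
  obtain ⟨r, hr, rfl⟩ := Finset.mem_image.1 hl
  exact Finset.mem_range.2 (hφ r (Finset.mem_range.1 hr))

/-- Uniform lower bound for the local linear design. -/
theorem KernelCond.local_linear_lower (hK : KernelCond K) :
    ∃ c M : ℝ, 0 < c ∧ 0 < M ∧ ∀ (n : ℕ) (h : ℝ), 0 < h → M ≤ n * h → M * h ≤ 1 →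
      ∀ t < n, ∀ a b : ℝ, c * (a ^ 2 + b ^ 2)
        ≤ ∑ l ∈ Finset.range n, locK K n h t l * (a + locW n h t l * b) ^ 2 := by
  obtain ⟨p, q, κ, hp, hpq, hκ, hlow⟩ := hK.exists_lower
  have hq : 0 < q := hp.trans hpq
  set δ := (q - p) / 4 with hδ
  have hδ0 : 0 < δ := by rw [hδ]; linarith
  set D := 2 + (4 * q ^ 2 + 2) / δ ^ 2 with hD
  have hD0 : 0 < D := by positivity
  -- The constant `M` serves twice: `M ≤ n h` yields `n h δ ≥ 2`, which absorbs the rounding of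
  -- indices, and `M h ≤ 1` yields `4 q h ≤ 1`, so the window occupies at most a quarter of the
  -- sample on one side.
  refine ⟨κ * (δ / 2) / (2 * D), 2 / δ + 4 * q, by positivity, by positivity, ?_⟩
  intro n h hh hM hMh t ht a b
  have h2δ : 0 < 2 / δ := by positivity
  have hpos : 0 < n * h := by linarith
  have hnhδ : 2 ≤ n * h * δ := by
    rw [← div_le_iff₀ hδ0]
    linarith
  have hn0 : (0 : ℝ) < n := by
    rcases Nat.eq_zero_or_pos n with h0 | h0
    · omega
    · exact_mod_cast h0
  have hqh : 4 * (q * (n * h)) ≤ n := by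
    have h1 : 4 * q * h ≤ 1 := by nlinarith
    nlinarith
  -- Times at distance `A` up to `A + 3 G` from `t` have rescaled distance in `[p, q]`, where the
  -- kernel is at least `κ`, because `q = p + 4 δ`. Pairing offsets `r` and `r + 2 G` gives two
  -- points separated by at least `δ`.
  set A := ⌈p * (n * h)⌉₊ with hA
  set G := ⌊n * h * δ⌋₊ with hG
  have hA1 : p * (n * h) ≤ A := Nat.le_ceil _
  have hA2 : (A : ℝ) < p * (n * h) + 1 := Nat.ceil_lt_add_one (by positivity)
  have hG1 : (G : ℝ) ≤ n * h * δ := Nat.floor_le (by positivity)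
  have hG2 : n * h * δ < G + 1 := Nat.lt_floor_add_one _
  have hAG : (A : ℝ) + 3 * G + 1 ≤ q * (n * h) := by
    have e : q = p + 4 * δ := by rw [hδ]; ring
    rw [e]; nlinarith
  have key : ∀ e : ℝ, |e| = 1 → ∀ φ : ℕ → ℕ, (∀ r < 3 * G, φ r < n) →
      (∀ r < 3 * G, ∀ r' < 3 * G, φ r = φ r' → r = r') →
      (∀ r < 3 * G, ((φ r : ℝ) - t) = e * (A + r)) →
      κ * (δ / 2) / (2 * D) * (a ^ 2 + b ^ 2)
        ≤ ∑ l ∈ Finset.range n, locK K n h t l * (a + locW n h t l * b) ^ 2 := by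
    intro e he φ hφn hφi hφ
    set F : ℕ → ℝ := fun l => locK K n h t l * (a + locW n h t l * b) ^ 2 with hF
    have hF0 : ∀ l, 0 ≤ F l := fun l => mul_nonneg (locK_nonneg hK hh t l) (sq_nonneg _)
    -- The two families of paired indices are bounded by the full sum separately. This costs the
    -- factor `2` in front of `D`.
    have s1 := sum_injOn_le (n := n) (G := G) hF0 φ (fun r hr => hφn r (by omega))
      (fun r hr r' hr' => hφi r (by omega) r' (by omega))
    have s2 := sum_injOn_le (n := n) (G := G) hF0 (fun r => φ (r + 2 * G))
      (fun r hr => hφn _ (by omega))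
      (fun r hr r' hr' hrr => by
        have := hφi (r + 2 * G) (by omega) (r' + 2 * G) (by omega) hrr
        omega)
    have habs : ∀ r < 3 * G, |locW n h t (φ r)| = (A + r) / (n * h) := by
      intro r hr
      rw [locW, hφ r hr, abs_div, abs_mul, he, one_mul, abs_of_pos hpos,
        abs_of_nonneg (by positivity)]
    have hwq : ∀ r < 3 * G, |locW n h t (φ r)| ≤ q := by
      intro r hr
      rw [habs r hr, div_le_iff₀ hpos]
      have : (r : ℝ) ≤ 3 * G := by exact_mod_cast hr.le
      linarith
    have hker : ∀ r < 3 * G, κ / (n * h) ≤ locK K n h t (φ r) := by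
      intro r hr
      rw [locK]
      gcongr
      refine hlow _ ?_ (hwq r hr)
      rw [habs r hr, le_div_iff₀ hpos]
      have : (0 : ℝ) ≤ r := Nat.cast_nonneg r
      linarith
    have hpair : ∀ r ∈ Finset.range G, κ / (n * h) * ((a ^ 2 + b ^ 2) / D)
        ≤ F (φ r) + F (φ (r + 2 * G)) := by
      intro r hr
      have hr' := Finset.mem_range.1 hr
      have hr1 : r < 3 * G := by omega
      have hr2 : r + 2 * G < 3 * G := by omega
      have hsep : δ ≤ |locW n h t (φ (r + 2 * G)) - locW n h t (φ r)| := by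
        rw [locW, locW, ← sub_div, hφ r hr1, hφ _ hr2, abs_div, abs_of_pos hpos,
          le_div_iff₀ hpos]
        push_cast
        rw [← mul_sub, abs_mul, he, one_mul,
          show (A : ℝ) + (r + 2 * G) - (A + r) = 2 * G by ring, abs_of_nonneg (by positivity)]
        nlinarith
      have h1 := sq_add_sq_le_of_two_points (a := a) (b := b) hδ0 (hwq r hr1) hsep
      have h2 : (a ^ 2 + b ^ 2) / D ≤ (a + locW n h t (φ r) * b) ^ 2
          + (a + locW n h t (φ (r + 2 * G)) * b) ^ 2 := by
        rw [div_le_iff₀ hD0, mul_comm]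
        exact h1
      calc κ / (n * h) * ((a ^ 2 + b ^ 2) / D)
          ≤ κ / (n * h) * ((a + locW n h t (φ r) * b) ^ 2
            + (a + locW n h t (φ (r + 2 * G)) * b) ^ 2) := by gcongr
        _ = κ / (n * h) * (a + locW n h t (φ r) * b) ^ 2
            + κ / (n * h) * (a + locW n h t (φ (r + 2 * G)) * b) ^ 2 := by ring
        _ ≤ _ := by
          simp only [hF]
          exact add_le_add (mul_le_mul_of_nonneg_right (hker r hr1) (sq_nonneg _))
            (mul_le_mul_of_nonneg_right (hker _ hr2) (sq_nonneg _))
    have hsum := Finset.sum_le_sum hpair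
    rw [Finset.sum_const, Finset.card_range, nsmul_eq_mul, Finset.sum_add_distrib] at hsum
    have hGl : δ / 2 ≤ G / (n * h) := by
      rw [le_div_iff₀ hpos]
      linarith
    have hfin : κ * (δ / 2) / D * (a ^ 2 + b ^ 2)
        ≤ G * (κ / (n * h) * ((a ^ 2 + b ^ 2) / D)) := by
      calc κ * (δ / 2) / D * (a ^ 2 + b ^ 2) ≤ κ * (G / (n * h)) / D * (a ^ 2 + b ^ 2) := by
            gcongr
        _ = _ := by ring
    have e2 : κ * (δ / 2) / (2 * D) * (a ^ 2 + b ^ 2)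
        = κ * (δ / 2) / D * (a ^ 2 + b ^ 2) / 2 := by field_simp
    rw [e2]
    linarith
  have hAGn : 4 * (A + 3 * G + 1) ≤ n := by
    have : (4 * (A + 3 * G + 1) : ℝ) ≤ n := by linarith
    exact_mod_cast this
  -- Near an end of the sample only one side of `t` has room. The longer side has at least `n / 2`
  -- times and always suffices.
  rcases le_total (2 * t) n with h2 | h2
  · refine key 1 (by simp) (fun r => t + A + r) (fun r hr => ?_) (fun r _ r' _ hrr => ?_)
      (fun r _ => ?_)
    · omega
    · omega
    · push_cast; ring
  · refine key (-1) (by simp) (fun r => t - (A + r)) (fun r hr => ?_) (fun r _ r' _ hrr => ?_)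
      (fun r _ => ?_)
    · omega
    · omega
    · have : A + r ≤ t := by omega
      rw [Nat.cast_sub this]
      push_cast; ring

end Kernel

/-! ### Dual vectors of a coercive form -/

section Dual

variable {T : Type*} [Fintype T] [DecidableEq T]

/-- A bilinear form that dominates every squared coordinate has, on every coordinate subspace,
dual vectors with bounded entries and energy. -/
lemma exists_dual_vector (Q : (T → ℝ) →ₗ[ℝ] (T → ℝ) →ₗ[ℝ] ℝ) {C : ℝ} (hC : 0 < C)
    (hQ : ∀ u q, u q ^ 2 ≤ C * Q u u) (S : Finset T) {q : T} (hq : q ∈ S) :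
    ∃ g : T → ℝ, (∀ q', q' ∉ S → g q' = 0) ∧
      (∀ v : T → ℝ, (∀ q', q' ∉ S → v q' = 0) → Q g v = v q) ∧
      Q g g ≤ C ∧ ∀ q', |g q'| ≤ C := by
  let mask : (T → ℝ) →ₗ[ℝ] (T → ℝ) :=
    { toFun := fun u q => if q ∈ S then u q else 0
      map_add' := fun u v => by funext q; simp only [Pi.add_apply]; split_ifs <;> simp
      map_smul' := fun c u => by funext q; simp }
  have hmask : ∀ u q, q ∉ S → mask u q = 0 := fun u q hq => by simp [mask, hq]
  have hmask' : ∀ u q, q ∈ S → mask u q = u q := fun u q hq => by simp [mask, hq]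
  let R : (T → ℝ) →ₗ[ℝ] (T → ℝ) :=
    { toFun := fun u q => Q u (Pi.single q 1)
      map_add' := fun u v => by funext q; simp
      map_smul' := fun c u => by funext q; simp }
  -- The form restricted to the coordinates in `S`, completed by the identity. Coercivity makes it
  -- injective, hence onto, and a preimage of the `q`-th unit vector gives the dual vector.
  let F : (T → ℝ) →ₗ[ℝ] (T → ℝ) := mask ∘ₗ R ∘ₗ mask + (LinearMap.id - mask)
  have hF : ∀ u q, F u q = if q ∈ S then Q (mask u) (Pi.single q 1) else u q := by
    intro u q
    simp only [F, mask, R, LinearMap.add_apply, LinearMap.sub_apply, LinearMap.comp_apply,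
      LinearMap.id_apply, LinearMap.coe_mk, AddHom.coe_mk, Pi.add_apply, Pi.sub_apply]
    split_ifs <;> simp
  have hexp : ∀ g v : T → ℝ, (∀ q', q' ∉ S → v q' = 0) →
      Q g v = ∑ q' ∈ S, v q' * Q g (Pi.single q' 1) := by
    intro g v hv
    have e : v = ∑ q' ∈ S, v q' • (Pi.single q' (1 : ℝ) : T → ℝ) := by
      funext q''
      simp only [Finset.sum_apply, Pi.smul_apply, smul_eq_mul, Pi.single_apply, mul_ite, mul_one,
        mul_zero, Finset.sum_ite_eq]
      split_ifs with h
      · rfl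
      · exact hv q'' h
    conv_lhs => rw [e]
    simp only [map_sum, map_smul, smul_eq_mul]
  have hinj : Function.Injective F := by
    rw [← LinearMap.ker_eq_bot, LinearMap.ker_eq_bot']
    intro u hu
    have hu' : ∀ q, F u q = 0 := fun q => by rw [hu]; rfl
    have hzero : Q (mask u) (mask u) = 0 := by
      rw [hexp (mask u) (mask u) (hmask u)]
      refine Finset.sum_eq_zero fun q' hq' => ?_
      have := hu' q'
      rw [hF, if_pos hq'] at this
      rw [this, mul_zero]
    funext q
    by_cases hqS : q ∈ S
    · have h1 := hQ (mask u) q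
      rw [hzero, mul_zero, hmask' u q hqS] at h1
      simpa using le_antisymm h1 (sq_nonneg _)
    · have := hu' q
      rwa [hF, if_neg hqS] at this
  obtain ⟨u, hu⟩ := (LinearMap.injective_iff_surjective.1 hinj) (Pi.single q 1)
  have hdual : ∀ v : T → ℝ, (∀ q', q' ∉ S → v q' = 0) → Q (mask u) v = v q := by
    intro v hv
    rw [hexp _ v hv]
    have e : ∀ q' ∈ S, v q' * Q (mask u) (Pi.single q' 1) = if q' = q then v q' else 0 := by
      intro q' hq'
      have := congrFun hu q'
      rw [hF, if_pos hq', Pi.single_apply] at this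
      rw [this]
      split_ifs <;> simp
    rw [Finset.sum_congr rfl e, Finset.sum_ite_eq' S q, if_pos hq]
  -- Evaluating the dual vector at itself gives `Q g g = g q`. Coercivity then yields `(g q)² ≤ C *
  -- g q`, so the energy is at most `C`, and every other entry is bounded through `Q g g`.
  have hgg : Q (mask u) (mask u) = mask u q := hdual _ (hmask u)
  have hle : mask u q ≤ C := by
    have h1 := hQ (mask u) q
    rw [hgg] at h1
    by_contra hcon
    push Not at hcon
    nlinarith
  refine ⟨mask u, hmask u, hdual, hgg ▸ hle, fun q' => ?_⟩
  have h1 := hQ (mask u) q'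
  rw [hgg] at h1
  apply abs_le_of_sq_le_sq _ hC.le
  nlinarith

end Dual

/-! ### Moving average representation of the model -/

section MatrixBounds

variable {d : ℕ}

lemma opNorm_nonneg (M : Matrix (Fin d) (Fin d) ℝ) : 0 ≤ opNorm M := norm_nonneg _

lemma sqrt_dotProduct_self (x : Fin d → ℝ) : √(x ⬝ᵥ x) = ‖WithLp.toLp 2 x‖ := by
  rw [EuclideanSpace.norm_eq]
  congr 1
  simp [dotProduct, sq]

lemma dotProduct_mulVec_le_opNorm (M : Matrix (Fin d) (Fin d) ℝ) (x y : Fin d → ℝ) :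
    x ⬝ᵥ M *ᵥ y ≤ opNorm M * (√(x ⬝ᵥ x) * √(y ⬝ᵥ y)) := by
  have h1 : x ⬝ᵥ M *ᵥ y = inner ℝ (WithLp.toLp 2 x)
      (Matrix.toEuclideanCLM (𝕜 := ℝ) M (WithLp.toLp 2 y)) := by
    rw [Matrix.toEuclideanCLM_toLp, PiLp.inner_apply]
    simp [dotProduct, mul_comm]
  rw [h1, sqrt_dotProduct_self, sqrt_dotProduct_self]
  calc _ ≤ ‖WithLp.toLp 2 x‖ * ‖Matrix.toEuclideanCLM (𝕜 := ℝ) M (WithLp.toLp 2 y)‖ :=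
        real_inner_le_norm _ _
    _ ≤ ‖WithLp.toLp 2 x‖ * (opNorm M * ‖WithLp.toLp 2 y‖) := by
        gcongr
        exact ContinuousLinearMap.le_opNorm _ _
    _ = _ := by ring

lemma dotProduct_mulVec_self_le (M : Matrix (Fin d) (Fin d) ℝ) (x : Fin d → ℝ) :
    x ⬝ᵥ M *ᵥ x ≤ opNorm M * (x ⬝ᵥ x) := by
  have := dotProduct_mulVec_le_opNorm M x x
  rwa [Real.mul_self_sqrt (dotProduct_self_nonneg' x)] at this

/-- With `z = x ᵥ* M`, `|z|² = x ⬝ᵥ M z ≤ ‖M‖ |x| |z|`, and one factor `|z|` cancels. The norm of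
the transpose is not needed. -/
lemma vecMul_dotProduct_self_le (M : Matrix (Fin d) (Fin d) ℝ) (x : Fin d → ℝ) :
    (x ᵥ* M) ⬝ᵥ (x ᵥ* M) ≤ opNorm M ^ 2 * (x ⬝ᵥ x) := by
  set z := x ᵥ* M with hz
  have h1 : z ⬝ᵥ z = x ⬝ᵥ M *ᵥ z := by rw [Matrix.dotProduct_mulVec]
  have h2 := dotProduct_mulVec_le_opNorm M x z
  rw [← h1] at h2
  have hx := dotProduct_self_nonneg' x
  have hzz := dotProduct_self_nonneg' z
  set a := √(x ⬝ᵥ x)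
  set b := √(z ⬝ᵥ z)
  have ha : a ^ 2 = x ⬝ᵥ x := Real.sq_sqrt hx
  have hb : b ^ 2 = z ⬝ᵥ z := Real.sq_sqrt hzz
  have hb0 : 0 ≤ b := Real.sqrt_nonneg _
  have ha0 : 0 ≤ a := Real.sqrt_nonneg _
  rw [← hb] at h2 ⊢
  rw [← ha]
  have h3 : b ≤ opNorm M * a := by
    by_contra hcon
    push Not at hcon
    have := mul_nonneg (opNorm_nonneg M) ha0
    nlinarith
  rw [← mul_pow]
  exact pow_le_pow_left₀ hb0 h3 2

lemma transpose_sqrt {S : Matrix (Fin d) (Fin d) ℝ} :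
    (CFC.sqrt S)ᵀ = CFC.sqrt S := by
  have h : IsSelfAdjoint (CFC.sqrt S) := (CFC.sqrt_nonneg S).isSelfAdjoint
  rw [← Matrix.conjTranspose_eq_transpose_of_trivial]
  exact h

lemma vecMul_sqrt_dotProduct_self {S : Matrix (Fin d) (Fin d) ℝ} (hS : S.PosSemidef)
    (x : Fin d → ℝ) : (x ᵥ* CFC.sqrt S) ⬝ᵥ (x ᵥ* CFC.sqrt S) = x ⬝ᵥ S *ᵥ x := by
  have h1 : CFC.sqrt S * CFC.sqrt S = S := CFC.sqrt_mul_sqrt_self S hS.nonneg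
  conv_lhs => rw [← Matrix.dotProduct_mulVec]
  conv_rhs => rw [← h1, ← Matrix.mulVec_mulVec]
  congr 2
  rw [← Matrix.mulVec_transpose, transpose_sqrt]

/-- A quadratic form dominates the squared coordinates, with the diagonal of the inverse as
constants. -/
lemma sq_le_of_inv_diag {S : Matrix (Fin d) (Fin d) ℝ} (hS : S.PosDef) {C : ℝ} (hC : 0 < C)
    (j : Fin d) (hj : S⁻¹ j j ≤ C) (v : Fin d → ℝ) : v j ^ 2 ≤ C * (v ⬝ᵥ S *ᵥ v) := by
  set a := S⁻¹ *ᵥ Pi.single j 1 with ha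
  have hdet : IsUnit S.det := (Matrix.isUnit_iff_isUnit_det S).1 hS.isUnit
  have hSa : S *ᵥ a = Pi.single j 1 := by
    rw [ha, Matrix.mulVec_mulVec, Matrix.mul_nonsing_inv _ hdet, Matrix.one_mulVec]
  have haj : a j = S⁻¹ j j := by simp [ha]
  have hsymm : a ⬝ᵥ S *ᵥ v = v j := by
    have : Sᵀ = S := by
      rw [← Matrix.conjTranspose_eq_transpose_of_trivial]
      exact hS.isHermitian
    rw [Matrix.dotProduct_mulVec, ← Matrix.mulVec_transpose, this, hSa]
    simp
  -- With `a = S⁻¹ e_j`, positivity of the form at `v - (v_j / C) a` is the completed square that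
  -- gives the bound.
  have h0 := hS.posSemidef.dotProduct_mulVec_nonneg (v - (v j / C) • a)
  simp only [star_trivial, Matrix.mulVec_sub, Matrix.mulVec_smul, sub_dotProduct, dotProduct_sub,
    smul_dotProduct, dotProduct_smul, hSa, hsymm, smul_eq_mul] at h0
  simp only [dotProduct_single, mul_one, haj] at h0
  have h1 : v j / C * (v j / C * S⁻¹ j j) ≤ v j / C * (v j / C * C) := by
    rw [← mul_assoc, ← mul_assoc]
    exact mul_le_mul_of_nonneg_left hj (mul_self_nonneg _)
  have h2 : v j / C * (v j / C * C) = v j ^ 2 / C := by field_simp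
  have h3 : v j / C * v j = v j ^ 2 / C := by ring
  have h4 : v j ^ 2 / C ≤ v ⬝ᵥ S *ᵥ v := by linarith
  rw [div_le_iff₀ hC] at h4
  linarith

end MatrixBounds

/-- The moving average coefficients of the Wold series in terms of the standardised
innovations. -/
def maCoef (n : ℕ) {d : ℕ} (A Sigma : ℝ → Matrix (Fin d) (Fin d) ℝ) (l k : ℕ) :
    Matrix (Fin d) (Fin d) ℝ :=
  woldCoef n A (l : ℤ) k * CFC.sqrt (Sigma (scaledTime n ((l : ℤ) - k)))

/-- The coefficient vector of the `i`-th innovation at time `l + 1`. -/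
def innovRow (n : ℕ) {d : ℕ} (Sigma : ℝ → Matrix (Fin d) (Fin d) ℝ) (i : Fin d) (l : ℕ) :
    Fin d → ℝ :=
  Pi.single i 1 ᵥ* CFC.sqrt (Sigma (scaledTime n ((l : ℤ) + 1)))

lemma innovation_apply (n : ℕ) {d : ℕ} (Sigma : ℝ → Matrix (Fin d) (Fin d) ℝ) (l : ℕ)
    (eps : Fin d → ℝ) (i : Fin d) :
    innovation n Sigma ((l : ℤ) + 1) eps i = innovRow n Sigma i l ⬝ᵥ eps := by
  rw [innovRow, ← Matrix.dotProduct_mulVec, single_one_dotProduct]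
  rfl

lemma scaledTime_le_one {n : ℕ} {t : ℤ} (ht : t ≤ n) : scaledTime n t ≤ 1 := by
  unfold scaledTime
  apply div_le_one_of_le₀ _ (Nat.cast_nonneg n)
  exact_mod_cast ht

lemma scaledTime_mem {n l : ℕ} (hl : l ≤ n) : scaledTime n (l : ℤ) ∈ Set.Icc (0 : ℝ) 1 :=
  ⟨by unfold scaledTime; positivity, scaledTime_le_one (by exact_mod_cast hl)⟩

/-! ### Uniform constants of the model and the truncation error of the Wold series. -/

section ModelFacts

variable {d : ℕ → ℕ} {Ω : ℕ → Type*} [∀ n, MeasurableSpace (Ω n)] {P : ∀ n, Measure (Ω n)}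

/-- A unit direction is centred and has a square-exponential moment, hence is sub-Gaussian; other
directions follow by scaling. The constant depends only on `ι₁` and `C₀`, so it serves every sample
size and dimension. -/
lemma RegularModel.subGInnov [∀ n, IsProbabilityMeasure (P n)] {M : Model d Ω P}
    (hM : RegularModel M) : ∃ B : ℝ, ∀ n, SubGInnov (P n) (M.eps n) B := by
  obtain ⟨ι₁, C₀, hι, hC₀, hexp⟩ := hM.subGaussian
  set B := 8 * (C₀ * Real.exp (1 / (4 * ι₁))) + (1 / (4 * ι₁) + 4 * C₀) with hB
  have hB0 : 0 < B := by positivity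
  refine ⟨B, fun n => ?_⟩
  have hmeas : ∀ t u, Measurable fun ω => u ⬝ᵥ M.eps n t ω := by
    intro t u
    have h : Measurable fun x : Fin (d n) → ℝ => u ⬝ᵥ x := by
      unfold dotProduct
      fun_prop
    exact h.comp (M.eps_measurable n t)
  have hint : ∀ t j, Integrable (fun ω => M.eps n t ω j) (P n) := by
    intro t j
    have h1 := hexp n t (Pi.single j 1) (by simp)
    simp only [single_one_dotProduct] at h1
    have hm : Measurable fun ω => M.eps n t ω j :=
      (measurable_pi_apply j).comp (M.eps_measurable n t)
    refine integrable_of_exp_abs hm (C := C₀ * Real.exp (1 / (4 * ι₁))) ?_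
    rw [ENNReal.ofReal_mul hC₀.le]
    calc _ ≤ ∫⁻ ω, ENNReal.ofReal (Real.exp (ι₁ * M.eps n t ω j ^ 2)) *
          ENNReal.ofReal (Real.exp (1 / (4 * ι₁))) ∂(P n) := by
          refine lintegral_mono fun ω => ?_
          rw [← ofReal_exp_add]
          apply ENNReal.ofReal_le_ofReal (Real.exp_le_exp.2 _)
          have := abs_le_sq_add (y := |M.eps n t ω j|) hι 1
          rwa [one_mul, sq_abs, one_pow] at this
      _ = _ := lintegral_mul_const _ (by fun_prop)
      _ ≤ _ := by gcongr
  have hzero : ∀ t u, ∫ ω, u ⬝ᵥ M.eps n t ω ∂(P n) = 0 := by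
    intro t u
    simp only [dotProduct]
    rw [integral_finsetSum _ fun j _ => (hint t j).const_mul _]
    simp only [integral_const_mul, M.eps_mean, mul_zero, Finset.sum_const_zero]
  refine ⟨M.eps_measurable n, M.eps_indep n, M.eps_mean n, M.eps_cov n, hB0, fun t u => ?_⟩
  rcases (dotProduct_self_nonneg' u).eq_or_lt with h0 | hpos
  · have hu : u = 0 := dotProduct_self_eq_zero.1 h0.symm
    subst hu
    intro s
    simp
  · have hr : 0 < √(u ⬝ᵥ u) := Real.sqrt_pos.2 hpos
    have hr2 : √(u ⬝ᵥ u) ^ 2 = u ⬝ᵥ u := Real.sq_sqrt hpos.le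
    set w := (√(u ⬝ᵥ u))⁻¹ • u with hw
    have hw1 : w ⬝ᵥ w = 1 := by
      rw [hw, smul_dotProduct, dotProduct_smul, smul_eq_mul, smul_eq_mul, ← mul_assoc, ← sq,
        inv_pow, hr2, inv_mul_cancel₀ hpos.ne']
    have h1 := (subG_of_exp_sq (hmeas t w) hι hC₀.le (hexp n t w hw1) (hzero t w)).const_mul
      (√(u ⬝ᵥ u))
    have e : ∀ ω, √(u ⬝ᵥ u) * (w ⬝ᵥ M.eps n t ω) = u ⬝ᵥ M.eps n t ω := by
      intro ω
      rw [hw, smul_dotProduct, smul_eq_mul, ← mul_assoc, mul_inv_cancel₀ hr.ne', one_mul]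
    simp only [e] at h1
    rw [hr2, mul_comm] at h1
    exact h1

/-- Uniform bounds on the moving average coefficients. -/
structure CoefBounds {n d : ℕ} (A Sigma : ℝ → Matrix (Fin d) (Fin d) ℝ) (D ρ : ℝ) : Prop where
  decay : ∀ l ≤ n, ∀ k u, (u ᵥ* maCoef n A Sigma l k) ⬝ᵥ (u ᵥ* maCoef n A Sigma l k)
    ≤ D * (ρ ^ 2) ^ k * (u ⬝ᵥ u)
  lower : ∀ l ≤ n, ∀ m, 0 < m → ∀ u j, u j ^ 2 ≤ D * covForm (maCoef n A Sigma) m l u u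
  row : ∀ l < n, ∀ i, innovRow n Sigma i l ⬝ᵥ innovRow n Sigma i l ≤ D

/-- Decay comes from the Wold coefficients and the bounded volatility. The lower bound uses the
zeroth lag alone: it contributes `u ⬝ᵥ Σ u`, which dominates squared coordinates because the
diagonal of the precision matrix is bounded. A single constant covers all three bounds. -/
lemma RegularModel.coefBounds {M : Model d Ω P} (hM : RegularModel M) :
    ∃ D ρ : ℝ, 0 < D ∧ 0 < ρ ∧ ρ < 1 ∧ ∀ n, CoefBounds (n := n) (M.A n) (M.Sigma n) D ρ := by
  obtain ⟨C₁, ρ, hC₁, hρ, hρ1, hwold⟩ := hM.wold_decay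
  obtain ⟨C₂, hS⟩ := hM.Sigma_bdd
  obtain ⟨C₃, hO⟩ := hM.Omega_smooth.2
  have hC2 : |C₂| ≤ |C₂| * (C₁ ^ 2 + 1) := by nlinarith [abs_nonneg C₂, sq_nonneg C₁]
  set D := |C₂| * (C₁ ^ 2 + 1) + |C₃| + 1 with hD
  have hD0 : 0 < D := by positivity
  refine ⟨D, ρ, hD0, hρ, hρ1, fun n => ⟨?_, ?_, ?_⟩⟩
  · intro l hl k u
    have hle : ((l : ℤ) - k) ≤ n := by omega
    have h1 := scaledTime_le_one hle
    have hps := M.Sigma_posSemidef n _ h1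
    unfold maCoef
    rw [← Matrix.vecMul_vecMul, vecMul_sqrt_dotProduct_self hps]
    have hx := dotProduct_self_nonneg' u
    calc _ ≤ opNorm (M.Sigma n (scaledTime n ((l : ℤ) - k))) *
          ((u ᵥ* woldCoef n (M.A n) l k) ⬝ᵥ (u ᵥ* woldCoef n (M.A n) l k)) :=
          dotProduct_mulVec_self_le _ _
      _ ≤ |C₂| * (opNorm (woldCoef n (M.A n) l k) ^ 2 * (u ⬝ᵥ u)) := by
          gcongr
          · exact dotProduct_self_nonneg' _
          · exact (hS n _ h1).trans (le_abs_self _)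
          · exact vecMul_dotProduct_self_le _ _
      _ ≤ |C₂| * ((C₁ * ρ ^ k) ^ 2 * (u ⬝ᵥ u)) := by
          gcongr
          · exact opNorm_nonneg _
          · exact hwold n l hl k
      _ = (|C₂| * C₁ ^ 2) * ((ρ ^ 2) ^ k * (u ⬝ᵥ u)) := by ring
      _ ≤ D * ((ρ ^ 2) ^ k * (u ⬝ᵥ u)) := by
          gcongr
          rw [hD]
          nlinarith [abs_nonneg C₂, abs_nonneg C₃]
      _ = _ := by ring
  · intro l hl m hm u j
    have h1 := scaledTime_mem hl
    have hpd := hM.Sigma_posDef n _ h1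
    have hOj : (M.Sigma n (scaledTime n l))⁻¹ j j ≤ D := by
      have := hO n j j 0 (by norm_num) _ h1
      rw [iteratedDerivWithin_zero] at this
      have h2 := (le_abs_self _).trans (this.trans (le_abs_self _))
      refine h2.trans ?_
      rw [hD]
      nlinarith [abs_nonneg C₂, sq_nonneg C₁]
    refine (sq_le_of_inv_diag hpd hD0 j hOj u).trans ?_
    gcongr
    have e : u ⬝ᵥ M.Sigma n (scaledTime n l) *ᵥ u
        = (u ᵥ* maCoef n (M.A n) (M.Sigma n) l 0) ⬝ᵥ (u ᵥ* maCoef n (M.A n) (M.Sigma n) l 0) := by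
      rw [maCoef, woldCoef, one_mul, Nat.cast_zero, sub_zero,
        vecMul_sqrt_dotProduct_self hpd.posSemidef]
    rw [e]
    exact Finset.single_le_sum (f := fun k => (u ᵥ* maCoef n (M.A n) (M.Sigma n) l k) ⬝ᵥ
      (u ᵥ* maCoef n (M.A n) (M.Sigma n) l k)) (fun k _ => dotProduct_self_nonneg' _)
      (Finset.mem_range.2 hm)
  · intro l hl i
    have hle : ((l : ℤ) + 1) ≤ n := by omega
    have h1 := scaledTime_le_one hle
    unfold innovRow
    rw [vecMul_sqrt_dotProduct_self (M.Sigma_posSemidef n _ h1)]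
    refine (dotProduct_mulVec_self_le _ _).trans ?_
    rw [single_one_dotProduct, Pi.single_eq_same, mul_one]
    refine (hS n _ h1).trans ?_
    rw [hD]
    linarith [le_abs_self C₂, abs_nonneg C₃]

variable {n : ℕ} {dd : ℕ} {A Sigma : ℝ → Matrix (Fin dd) (Fin dd) ℝ} {D ρ : ℝ}

lemma sum_sq_geom_le (hρ : 0 < ρ) (hρ1 : ρ < 1) (I : Finset ℕ) (m : ℕ) (hI : ∀ k ∈ I, m ≤ k) :
    ∑ k ∈ I, (ρ ^ 2) ^ k ≤ (ρ ^ 2) ^ m / (1 - ρ ^ 2) := by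
  have hr : ρ ^ 2 < 1 := by nlinarith
  have hr0 : 0 < ρ ^ 2 := by positivity
  have hinj : Set.InjOn (fun k => k - m) I := by
    intro a ha b hb hab
    have h1 := hI a ha
    have h2 := hI b hb
    simp only at hab
    omega
  have e : ∑ k ∈ I, (ρ ^ 2) ^ k = (ρ ^ 2) ^ m * ∑ k ∈ I.image (fun k => k - m), (ρ ^ 2) ^ k := by
    rw [Finset.sum_image hinj, Finset.mul_sum]
    refine Finset.sum_congr rfl fun k hk => ?_
    rw [← pow_add, Nat.add_sub_cancel' (hI k hk)]
  rw [e, div_eq_mul_inv, ← tsum_geometric_of_lt_one hr0.le hr]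
  gcongr
  exact (summable_geometric_of_lt_one hr0.le hr).sum_le_tsum _ fun _ _ => by positivity

lemma CoefBounds.covForm_le (hb : CoefBounds (n := n) A Sigma D ρ) (hD : 0 < D) (hρ : 0 < ρ)
    (hρ1 : ρ < 1) {l : ℕ} (hl : l ≤ n) (m : ℕ) (u : Fin dd → ℝ) :
    covForm (maCoef n A Sigma) m l u u ≤ D / (1 - ρ ^ 2) * (u ⬝ᵥ u) := by
  have hu := dotProduct_self_nonneg' u
  calc _ ≤ ∑ k ∈ Finset.range m, D * (ρ ^ 2) ^ k * (u ⬝ᵥ u) :=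
        Finset.sum_le_sum fun k _ => hb.decay l hl k u
    _ = D * (∑ k ∈ Finset.range m, (ρ ^ 2) ^ k) * (u ⬝ᵥ u) := by
        rw [← Finset.sum_mul, ← Finset.mul_sum]
    _ ≤ D * ((ρ ^ 2) ^ 0 / (1 - ρ ^ 2)) * (u ⬝ᵥ u) := by
        gcongr
        exact sum_sq_geom_le hρ hρ1 _ 0 fun _ _ => Nat.zero_le _
    _ = _ := by ring

/-- The remainder of the truncated Wold series is small. -/
lemma wold_remainder_tail {M : Model d Ω P} [IsProbabilityMeasure (P n)] {B : ℝ}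
    (H : SubGInnov (P n) (M.eps n) B) (hb : CoefBounds (n := n) (M.A n) (M.Sigma n) D ρ)
    (hD : 0 < D) (hρ : 0 < ρ) (hρ1 : ρ < 1) {l : ℕ} (hl : l ≤ n) (m : ℕ) (j : Fin (d n)) {x : ℝ}
    (hx : 0 ≤ x) :
    P n {ω | √(4 * x * (B * (D * ((ρ ^ 2) ^ m / (1 - ρ ^ 2))))) <
      |M.X n l ω j - linProc (maCoef n (M.A n) (M.Sigma n)) (M.eps n) m l ω j|}
      ≤ 2 * ENNReal.ofReal (Real.exp (-x)) := by
  have hB := H.pos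
  have hr : ρ ^ 2 < 1 := by nlinarith
  have hr' : 0 < 1 - ρ ^ 2 := by linarith
  have hlm : Measurable fun ω =>
      linProc (maCoef n (M.A n) (M.Sigma n)) (M.eps n) m l ω j := by
    have := H.measurable_dot_linProc (Cf := maCoef n (M.A n) (M.Sigma n)) m l (Pi.single j 1)
    simpa only [single_one_dotProduct] using this
  have hXm : Measurable fun ω => M.X n l ω j := (measurable_pi_apply j).comp (M.X_measurable n l)
  refine SubG.tail (hXm.sub hlm) ?_ (by positivity) hx
  -- The remainder is the almost sure limit of the blocks of lags `m, …, m + p - 1`, whose proxies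
  -- are bounded by the same geometric tail for all `p`.
  refine SubG.of_tendsto_ae (Z := fun p ω => ∑ k ∈ Finset.Ico m (m + p),
    (Pi.single j 1 ᵥ* maCoef n (M.A n) (M.Sigma n) l k) ⬝ᵥ M.eps n ((l : ℤ) - k) ω) ?_ ?_ ?_
  · intro p
    exact Finset.measurable_fun_sum _ fun k _ => H.measurable_dot _ _
  · intro p
    refine (H.subG_sum l (Finset.Ico m (m + p))
      fun k => Pi.single j 1 ᵥ* maCoef n (M.A n) (M.Sigma n) l k).mono ?_
    gcongr
    calc _ ≤ ∑ k ∈ Finset.Ico m (m + p), D * (ρ ^ 2) ^ k := by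
          refine Finset.sum_le_sum fun k _ => ?_
          have := hb.decay l hl k (Pi.single j 1)
          rwa [single_one_dotProduct, Pi.single_eq_same, mul_one] at this
      _ = D * ∑ k ∈ Finset.Ico m (m + p), (ρ ^ 2) ^ k := by rw [Finset.mul_sum]
      _ ≤ _ := by
          gcongr
          exact sum_sq_geom_le hρ hρ1 _ m fun k hk => (Finset.mem_Ico.1 hk).1
  · filter_upwards [M.X_wold n l hl] with ω hω
    have h1 := (Pi.hasSum.1 hω j).tendsto_sum_nat
    have h2 := (h1.comp (tendsto_add_atTop_nat m)).sub_const
      (linProc (maCoef n (M.A n) (M.Sigma n)) (M.eps n) m l ω j)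
    refine h2.congr fun p => ?_
    have e : ∀ k, (woldCoef n (M.A n) (l : ℤ) k *ᵥ innovation n (M.Sigma n) ((l : ℤ) - k)
        (M.eps n ((l : ℤ) - k) ω)) j
        = (Pi.single j 1 ᵥ* maCoef n (M.A n) (M.Sigma n) l k) ⬝ᵥ M.eps n ((l : ℤ) - k) ω := by
      intro k
      rw [← Matrix.dotProduct_mulVec, single_one_dotProduct, maCoef, innovation,
        Matrix.mulVec_mulVec]
    have e2 : linProc (maCoef n (M.A n) (M.Sigma n)) (M.eps n) m l ω j
        = ∑ k ∈ Finset.range m,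
          (Pi.single j 1 ᵥ* maCoef n (M.A n) (M.Sigma n) l k) ⬝ᵥ M.eps n ((l : ℤ) - k) ω := by
      rw [← dot_linProc, single_one_dotProduct]
    simp only [Function.comp_apply, e, e2]
    rw [add_comm p m, ← Finset.sum_range_add_sum_Ico _ (Nat.le_add_right m p)]
    ring

end ModelFacts

/-! ### Local linear design -/

section Design

variable {d : ℕ}

/-- The stacked regressors `(x_l, h⁻¹ (τ_l - τ_t) x_l)` of the local linear fit at `τ_t`. -/
def locF (n : ℕ) (h : ℝ) (x : ℕ → Fin d → ℝ) (t l : ℕ) : Fin d ⊕ Fin d → ℝ :=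
  Sum.elim (x l) fun j => locW n h t l * x l j

/-- The coefficient vector that a stacked vector induces at time `l`. -/
def comb (n : ℕ) (h : ℝ) (t l : ℕ) : (Fin d ⊕ Fin d → ℝ) →ₗ[ℝ] (Fin d → ℝ) where
  toFun u j := u (Sum.inl j) + locW n h t l * u (Sum.inr j)
  map_add' u v := by funext j; simp only [Pi.add_apply]; ring
  map_smul' c u := by funext j; simp only [Pi.smul_apply, smul_eq_mul, RingHom.id_apply]; ring

lemma comb_apply (n : ℕ) (h : ℝ) (t l : ℕ) (u : Fin d ⊕ Fin d → ℝ) (j : Fin d) :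
    comb n h t l u j = u (Sum.inl j) + locW n h t l * u (Sum.inr j) := rfl

lemma locF_dotProduct (n : ℕ) (h : ℝ) (x : ℕ → Fin d → ℝ) (t l : ℕ) (u : Fin d ⊕ Fin d → ℝ) :
    locF n h x t l ⬝ᵥ u = comb n h t l u ⬝ᵥ x l := by
  simp only [dotProduct, Fintype.sum_sum_type, locF, Sum.elim_inl, Sum.elim_inr, comb_apply]
  rw [← Finset.sum_add_distrib]
  exact Finset.sum_congr rfl fun j _ => by ring

/-- The factor multiplying the regressor of coordinate `q`. -/
def locC (n : ℕ) (h : ℝ) (t l : ℕ) (q : Fin d ⊕ Fin d) : ℝ :=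
  Sum.elim (fun _ => 1) (fun _ => locW n h t l) q

/-- The variable underlying coordinate `q`. -/
def baseIdx (q : Fin d ⊕ Fin d) : Fin d := Sum.elim id id q

lemma locF_apply (n : ℕ) (h : ℝ) (x : ℕ → Fin d → ℝ) (t l : ℕ) (q : Fin d ⊕ Fin d) :
    locF n h x t l q = locC n h t l q * x l (baseIdx q) := by
  cases q <;> simp [locF, locC, baseIdx]

lemma comb_single (n : ℕ) (h : ℝ) (t l : ℕ) (q : Fin d ⊕ Fin d) :
    comb n h t l (Pi.single q 1) = locC n h t l q • (Pi.single (baseIdx q) 1 : Fin d → ℝ) := by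
  funext j
  cases q with
  | inl k => simp [comb_apply, locC, baseIdx, Pi.single_apply]
  | inr k => simp [comb_apply, locC, baseIdx, Pi.single_apply]

lemma abs_locC_le {n : ℕ} {h : ℝ} {t l : ℕ} (hw : |locW n h t l| ≤ 1) (q : Fin d ⊕ Fin d) :
    |locC n h t l q| ≤ 1 := by
  cases q <;> simp [locC, hw]

lemma abs_locK_mul_locC_le {K : ℝ → ℝ} (hK : KernelCond K) {n : ℕ} {h : ℝ} (hh : 0 < h)
    (t l : ℕ) (q : Fin d ⊕ Fin d) : |locK K n h t l * locC n h t l q| ≤ locK K n h t l := by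
  by_cases h0 : locK K n h t l = 0
  · simp [h0]
  · rw [abs_mul, abs_of_nonneg (locK_nonneg hK hh t l)]
    exact mul_le_of_le_one_right (locK_nonneg hK hh t l) (abs_locC_le (abs_locW_le_one hK h0) q)

lemma sum_abs_comb_le {n : ℕ} {h : ℝ} {t l : ℕ} (hw : |locW n h t l| ≤ 1)
    (u : Fin d ⊕ Fin d → ℝ) : ∑ j, |comb n h t l u j| ≤ ∑ q, |u q| := by
  rw [Fintype.sum_sum_type, ← Finset.sum_add_distrib]
  refine Finset.sum_le_sum fun j _ => ?_
  rw [comb_apply]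
  refine (abs_add_le _ _).trans (add_le_add le_rfl ?_)
  rw [abs_mul]
  exact mul_le_of_le_one_left (abs_nonneg _) hw

lemma comb_dotProduct_self_le {n : ℕ} {h : ℝ} {t l : ℕ} (hw : |locW n h t l| ≤ 1)
    (u : Fin d ⊕ Fin d → ℝ) : comb n h t l u ⬝ᵥ comb n h t l u ≤ 2 * ∑ q, u q ^ 2 := by
  rw [Fintype.sum_sum_type, ← Finset.sum_add_distrib, Finset.mul_sum]
  refine Finset.sum_le_sum fun j _ => ?_
  rw [comb_apply]
  have : locW n h t l ^ 2 ≤ 1 := by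
    rw [← sq_abs]; exact pow_le_one₀ (abs_nonneg _) hw
  nlinarith [sq_nonneg (u (Sum.inl j) - locW n h t l * u (Sum.inr j)),
    mul_le_mul_of_nonneg_right this (sq_nonneg (u (Sum.inr j)))]

lemma covForm_add_left (Cf : ℕ → ℕ → Matrix (Fin d) (Fin d) ℝ) (m l : ℕ) (u v w : Fin d → ℝ) :
    covForm Cf m l (u + v) w = covForm Cf m l u w + covForm Cf m l v w := by
  simp only [covForm, Matrix.add_vecMul, add_dotProduct, Finset.sum_add_distrib]

lemma covForm_smul_left (Cf : ℕ → ℕ → Matrix (Fin d) (Fin d) ℝ) (m l : ℕ) (c : ℝ)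
    (u w : Fin d → ℝ) : covForm Cf m l (c • u) w = c * covForm Cf m l u w := by
  simp only [covForm, Matrix.smul_vecMul, smul_dotProduct, smul_eq_mul, Finset.mul_sum]

lemma covForm_comm (Cf : ℕ → ℕ → Matrix (Fin d) (Fin d) ℝ) (m l : ℕ) (u v : Fin d → ℝ) :
    covForm Cf m l u v = covForm Cf m l v u := by
  simp only [covForm, dotProduct_comm]

lemma covForm_add_right (Cf : ℕ → ℕ → Matrix (Fin d) (Fin d) ℝ) (m l : ℕ) (u v w : Fin d → ℝ) :
    covForm Cf m l u (v + w) = covForm Cf m l u v + covForm Cf m l u w := by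
  rw [covForm_comm, covForm_add_left, covForm_comm, covForm_comm _ _ _ w]

lemma covForm_smul_right (Cf : ℕ → ℕ → Matrix (Fin d) (Fin d) ℝ) (m l : ℕ) (c : ℝ)
    (u w : Fin d → ℝ) : covForm Cf m l u (c • w) = c * covForm Cf m l u w := by
  rw [covForm_comm, covForm_smul_left, covForm_comm]

/-- The expected local Gram form of the truncated process. -/
def locForm (K : ℝ → ℝ) (n : ℕ) (h : ℝ) (Cf : ℕ → ℕ → Matrix (Fin d) (Fin d) ℝ) (m t : ℕ) :
    (Fin d ⊕ Fin d → ℝ) →ₗ[ℝ] (Fin d ⊕ Fin d → ℝ) →ₗ[ℝ] ℝ :=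
  LinearMap.mk₂ ℝ
    (fun u v => ∑ l ∈ Finset.range n,
      locK K n h t l * covForm Cf m l (comb n h t l u) (comb n h t l v))
    (fun u v w => by
      simp only [map_add, covForm_add_left, mul_add, Finset.sum_add_distrib])
    (fun c u w => by
      simp only [map_smul, covForm_smul_left, smul_eq_mul, Finset.mul_sum]
      exact Finset.sum_congr rfl fun l _ => by ring)
    (fun u v w => by
      simp only [map_add, covForm_add_right, mul_add, Finset.sum_add_distrib])
    (fun c u w => by
      simp only [map_smul, covForm_smul_right, smul_eq_mul, Finset.mul_sum]
      exact Finset.sum_congr rfl fun l _ => by ring)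

lemma locForm_apply (K : ℝ → ℝ) (n : ℕ) (h : ℝ) (Cf : ℕ → ℕ → Matrix (Fin d) (Fin d) ℝ)
    (m t : ℕ) (u v : Fin d ⊕ Fin d → ℝ) :
    locForm K n h Cf m t u v = ∑ l ∈ Finset.range n,
      locK K n h t l * covForm Cf m l (comb n h t l u) (comb n h t l v) := rfl

lemma locForm_single (K : ℝ → ℝ) (n : ℕ) (h : ℝ) (Cf : ℕ → ℕ → Matrix (Fin d) (Fin d) ℝ)
    (m t : ℕ) (u : Fin d ⊕ Fin d → ℝ) (q : Fin d ⊕ Fin d) :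
    locForm K n h Cf m t u (Pi.single q 1) = ∑ l ∈ Finset.range n,
      locK K n h t l * locC n h t l q *
        covForm Cf m l (comb n h t l u) (Pi.single (baseIdx q) 1) := by
  rw [locForm_apply]
  refine Finset.sum_congr rfl fun l _ => ?_
  rw [comb_single, covForm_smul_right, mul_assoc]

/-- A dual vector for coordinate `q` relative to the expected local Gram form, with bounded
entries and energy. -/
structure IsLocDual (K : ℝ → ℝ) (n : ℕ) (h : ℝ) (Cf : ℕ → ℕ → Matrix (Fin d) (Fin d) ℝ)
    (m t : ℕ) (S : Finset (Fin d ⊕ Fin d)) (C : ℝ) (q : Fin d ⊕ Fin d)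
    (g : Fin d ⊕ Fin d → ℝ) : Prop where
  supp : ∀ q', q' ∉ S → g q' = 0
  bdd : ∀ q', |g q'| ≤ C
  energy_le : ∑ l ∈ Finset.range n,
    locK K n h t l * covForm Cf m l (comb n h t l g) (comb n h t l g) ≤ C
  dual : q ∈ S → ∀ q' ∈ S, ∑ l ∈ Finset.range n,
      locK K n h t l * locC n h t l q' *
        covForm Cf m l (comb n h t l g) (Pi.single (baseIdx q') 1) = if q = q' then 1 else 0

/-- The covariance form dominates each squared coordinate at every time, and the kernel design
dominates the squared intercept and slope. Their product is coercivity with constant `D / c`,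
independent of the dimension and of `S`. -/
lemma exists_isLocDual {K : ℝ → ℝ} (hK : KernelCond K) {n : ℕ} {h : ℝ} (hh : 0 < h)
    {A Sigma : ℝ → Matrix (Fin d) (Fin d) ℝ} {D ρ : ℝ}
    (hb : CoefBounds (n := n) A Sigma D ρ) (hD : 0 < D) {m : ℕ} (hm : 0 < m) {c : ℝ} (hc : 0 < c)
    {t : ℕ} (hlow : ∀ a b : ℝ, c * (a ^ 2 + b ^ 2)
        ≤ ∑ l ∈ Finset.range n, locK K n h t l * (a + locW n h t l * b) ^ 2)
    (S : Finset (Fin d ⊕ Fin d)) (q : Fin d ⊕ Fin d) :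
    ∃ g, IsLocDual K n h (maCoef n A Sigma) m t S (D / c) q g := by
  by_cases hq : q ∈ S
  · have hQ : ∀ (u : Fin d ⊕ Fin d → ℝ) (q : Fin d ⊕ Fin d),
        u q ^ 2 ≤ D / c * locForm K n h (maCoef n A Sigma) m t u u := by
      intro u q
      set j := baseIdx q with hj
      have h5 : u q ^ 2 ≤ u (Sum.inl j) ^ 2 + u (Sum.inr j) ^ 2 := by
        cases q with
        | inl k => exact le_add_of_nonneg_right (sq_nonneg _)
        | inr k => exact le_add_of_nonneg_left (sq_nonneg _)
      have h6 : c * u q ^ 2 ≤ D * locForm K n h (maCoef n A Sigma) m t u u := by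
        calc c * u q ^ 2 ≤ c * (u (Sum.inl j) ^ 2 + u (Sum.inr j) ^ 2) := by gcongr
          _ ≤ _ := hlow _ _
          _ ≤ ∑ l ∈ Finset.range n, D * (locK K n h t l *
              covForm (maCoef n A Sigma) m l (comb n h t l u) (comb n h t l u)) := by
            refine Finset.sum_le_sum fun l hl => ?_
            rw [mul_left_comm]
            refine mul_le_mul_of_nonneg_left ?_ (locK_nonneg hK hh t l)
            exact hb.lower l (Finset.mem_range.1 hl).le m hm (comb n h t l u) j
          _ = _ := by rw [locForm_apply, Finset.mul_sum]
      rw [div_mul_eq_mul_div, le_div_iff₀ hc, mul_comm]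
      exact h6
    obtain ⟨g, h1, h2, h3, h4⟩ := exists_dual_vector (locForm K n h (maCoef n A Sigma) m t)
      (C := D / c) (by positivity) hQ S hq
    refine ⟨g, h1, h4, h3, fun _ q' hq' => ?_⟩
    rw [← locForm_single, h2]
    · rw [Pi.single_apply]
    · intro q'' hq''
      rw [Pi.single_apply, if_neg]
      rintro rfl
      exact hq'' hq'
  -- The zero vector is a default off `S`, where no duality is required. It allows a choice of dual
  -- vectors indexed by all coordinates.
  · exact ⟨0, fun _ _ => rfl, fun _ => by simp; positivity, by simp [covForm]; positivity,
      fun h => absurd h hq⟩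

end Design

/-! ### Good samples -/

section GoodSample

variable {d : ℕ}

/-- A sample `x` with noise `e` that is well behaved for the local linear regressions. The sets
`S i` contain the relevant coordinates of the `i`-th equation. -/
structure GoodSample (K : ℝ → ℝ) (n : ℕ) (h : ℝ) (x e : ℕ → Fin d → ℝ)
    (S : Fin d → Finset (Fin d ⊕ Fin d)) (b r δ : ℝ) : Prop where
  bdd : ∀ l < n, ∀ j, |x l j| ≤ b
  noise : ∀ i, ∀ t < n, ∀ q,
    |∑ l ∈ Finset.range n, locK K n h t l * (locF n h x t l q * e l i)| ≤ r
  dual : ∀ i, ∀ t < n, ∃ g : Fin d ⊕ Fin d → Fin d ⊕ Fin d → ℝ, ∀ q ∈ S i,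
    (∀ q', q' ∉ S i → g q q' = 0) ∧
    |∑ l ∈ Finset.range n, locK K n h t l * ((locF n h x t l ⬝ᵥ g q) * e l i)| ≤ r ∧
    ∑ l ∈ Finset.range n, locK K n h t l * |locF n h x t l ⬝ᵥ g q| ≤ b ∧
    ∀ q' ∈ S i, |∑ l ∈ Finset.range n,
      locK K n h t l * (locF n h x t l q' * (locF n h x t l ⬝ᵥ g q)) - if q = q' then 1 else 0| ≤ δ

/-- The corresponding properties of the truncated process `y`, with fixed dual vectors. -/
structure GoodTrunc (K : ℝ → ℝ) (n : ℕ) (h : ℝ) (Cf : ℕ → ℕ → Matrix (Fin d) (Fin d) ℝ) (m : ℕ)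
    (x y e : ℕ → Fin d → ℝ)
    (g : Fin d → Fin n → Fin d ⊕ Fin d → Fin d ⊕ Fin d → ℝ) (η b₀ b₁ r₀ u : ℝ) : Prop where
  close : ∀ l : Fin n, ∀ j, |x l j - y l j| ≤ η
  bdd : ∀ l : Fin n, ∀ j, |y l j| ≤ b₀
  innov : ∀ l : Fin n, ∀ i, |e l i| ≤ b₀
  noise : ∀ i, ∀ t : Fin n, ∀ q, |∑ l ∈ Finset.range n,
    locK K n h t l * locC n h t l q * (Pi.single (baseIdx q) 1 ⬝ᵥ y l) * e l i| ≤ r₀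
  dual_noise : ∀ i, ∀ t : Fin n, ∀ q, |∑ l ∈ Finset.range n,
    locK K n h t l * (comb n h t l (g i t q) ⬝ᵥ y l) * e l i| ≤ r₀
  dual_tail : ∀ i, ∀ t : Fin n, ∀ q, ∀ l : Fin n, |comb n h t l (g i t q) ⬝ᵥ y l|
    ≤ b₁ * √(covForm Cf m l (comb n h t l (g i t q)) (comb n h t l (g i t q)) + 1)
  gram : ∀ i, ∀ t : Fin n, ∀ q q', |∑ l ∈ Finset.range n,
    locK K n h t l * locC n h t l q' * ((comb n h t l (g i t q) ⬝ᵥ y l) *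
      (Pi.single (baseIdx q') 1 ⬝ᵥ y l)
        - covForm Cf m l (comb n h t l (g i t q)) (Pi.single (baseIdx q') 1))| ≤ u

lemma abs_dotProduct_le {v z : Fin d → ℝ} {c : ℝ} (hz : ∀ j, |z j| ≤ c) :
    |v ⬝ᵥ z| ≤ (∑ j, |v j|) * c := by
  rw [Finset.sum_mul]
  refine (Finset.abs_sum_le_sum_abs _ _).trans (Finset.sum_le_sum fun j _ => ?_)
  rw [abs_mul]
  gcongr
  exact hz j

/-- Transfer from the truncated process to the observed one. -/
theorem GoodTrunc.goodSample {K : ℝ → ℝ} (hK : KernelCond K) {n : ℕ} {h : ℝ} (hh : 0 < h)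
    {Cf : ℕ → ℕ → Matrix (Fin d) (Fin d) ℝ} {m : ℕ} {x y e : ℕ → Fin d → ℝ}
    {S : Fin d → Finset (Fin d ⊕ Fin d)} {C k₁ s : ℝ}
    (hk₁ : ∀ t, ∑ l ∈ Finset.range n, locK K n h t l ≤ k₁) (hs : ∀ i, ((S i).card : ℝ) ≤ 2 * s)
    {g : Fin d → Fin n → Fin d ⊕ Fin d → Fin d ⊕ Fin d → ℝ}
    (hg : ∀ i (t : Fin n) q, IsLocDual K n h Cf m t (S i) C q (g i t q)) (hC : 0 ≤ C)
    {η b₀ b₁ r₀ u : ℝ} (hη : 0 ≤ η) (hb₀ : 0 ≤ b₀) (hb₁ : 0 ≤ b₁) (hs0 : 0 ≤ s)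
    (G : GoodTrunc K n h Cf m x y e g η b₀ b₁ r₀ u) :
    GoodSample K n h x e S
      (max (b₀ + η) (b₁ * (C + 2 * k₁) + k₁ * (2 * s * C * η)))
      (r₀ + k₁ * (η * (1 + 2 * s * C) * b₀))
      (u + k₁ * (2 * s * C * η * (2 * b₀ + η))) := by
  -- This crude bound grows with `s`, but it only ever multiplies the truncation error `η`, which is
  -- made polynomially small.
  have hgsum : ∀ i t q, ∑ q', |g i t q q'| ≤ 2 * s * C := by
    intro i t q
    calc ∑ q', |g i t q q'| = ∑ q' ∈ S i, |g i t q q'| :=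
          (Finset.sum_subset (Finset.subset_univ _) fun q' _ hq' => by
            rw [(hg i t q).supp q' hq', abs_zero]).symm
      _ ≤ ∑ _q' ∈ S i, C := Finset.sum_le_sum fun q' _ => (hg i t q).bdd q'
      _ = (S i).card * C := by rw [Finset.sum_const, nsmul_eq_mul]
      _ ≤ 2 * s * C := by gcongr; exact hs i
  have hκ := fun t l => locK_nonneg (n := n) hK hh t l
  -- a weighted sum is controlled by a bound valid wherever the weight is positive
  have hw : ∀ (t : ℕ) (F : ℕ → ℝ) (c : ℝ), 0 ≤ c →
      (∀ l < n, locK K n h t l ≠ 0 → |F l| ≤ c) →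
      ∑ l ∈ Finset.range n, |locK K n h t l * F l| ≤ k₁ * c := by
    intro t F c hc hF
    calc _ ≤ ∑ l ∈ Finset.range n, locK K n h t l * c := by
          refine Finset.sum_le_sum fun l hl => ?_
          by_cases h0 : locK K n h t l = 0
          · simp [h0]
          · rw [abs_mul, abs_of_nonneg (hκ t l)]
            exact mul_le_mul_of_nonneg_left (hF l (Finset.mem_range.1 hl) h0) (hκ t l)
      _ ≤ k₁ * c := by
          rw [← Finset.sum_mul]
          exact mul_le_mul_of_nonneg_right (hk₁ t) hc
  have hcd : ∀ i (t : Fin n) q, ∀ l < n, locK K n h t l ≠ 0 →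
      |comb n h t l (g i t q) ⬝ᵥ x l - comb n h t l (g i t q) ⬝ᵥ y l| ≤ 2 * s * C * η := by
    intro i t q l hl h0
    rw [← dotProduct_sub]
    refine (abs_dotProduct_le (c := η) fun j => G.close ⟨l, hl⟩ j).trans ?_
    gcongr
    exact (sum_abs_comb_le (abs_locW_le_one hK h0) _).trans (hgsum i t q)
  have hcy : ∀ i (t : Fin n) q, ∀ l < n, locK K n h t l ≠ 0 →
      |comb n h t l (g i t q) ⬝ᵥ y l| ≤ 2 * s * C * b₀ := by
    intro i t q l hl h0
    refine (abs_dotProduct_le (c := b₀) fun j => G.bdd ⟨l, hl⟩ j).trans ?_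
    gcongr
    exact (sum_abs_comb_le (abs_locW_le_one hK h0) _).trans (hgsum i t q)
  have hxb : ∀ l < n, ∀ j, |x l j| ≤ b₀ + η := by
    intro l hl j
    have h1 := G.close ⟨l, hl⟩ j
    have h2 := G.bdd ⟨l, hl⟩ j
    have h3 : x l j = y l j + (x l j - y l j) := by ring
    rw [h3]
    exact (abs_add_le _ _).trans (add_le_add h2 h1)
  refine ⟨fun l hl j => (hxb l hl j).trans (le_max_left _ _), ?_, ?_⟩
  · intro i t ht q
    have h1 := G.noise i ⟨t, ht⟩ q
    have h2 : ∑ l ∈ Finset.range n, locK K n h t l * (locF n h x t l q * e l i)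
        = ∑ l ∈ Finset.range n, locK K n h t l * locC n h t l q *
            (Pi.single (baseIdx q) 1 ⬝ᵥ y l) * e l i
          + ∑ l ∈ Finset.range n, locK K n h t l * (locC n h t l q *
            (x l (baseIdx q) - y l (baseIdx q)) * e l i) := by
      rw [← Finset.sum_add_distrib]
      refine Finset.sum_congr rfl fun l _ => ?_
      rw [locF_apply, single_one_dotProduct]
      ring
    rw [h2]
    refine (abs_add_le _ _).trans (add_le_add h1 ?_)
    refine (Finset.abs_sum_le_sum_abs _ _).trans (hw t _ _ (by positivity) ?_)
    intro l hl h0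
    rw [abs_mul, abs_mul]
    calc _ ≤ 1 * η * b₀ := by
          gcongr
          · exact abs_locC_le (abs_locW_le_one hK h0) q
          · exact G.close ⟨l, hl⟩ _
          · exact G.innov ⟨l, hl⟩ i
      _ ≤ _ := by
          rw [one_mul]
          have : 0 ≤ η * b₀ * (2 * s * C) := by positivity
          nlinarith
  · intro i t ht
    refine ⟨g i ⟨t, ht⟩, fun q hq => ⟨(hg i ⟨t, ht⟩ q).supp, ?_, ?_, fun q' hq' => ?_⟩⟩
    · have h1 := G.dual_noise i ⟨t, ht⟩ q
      have h2 : ∑ l ∈ Finset.range n,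
          locK K n h t l * ((locF n h x t l ⬝ᵥ g i ⟨t, ht⟩ q) * e l i)
          = ∑ l ∈ Finset.range n, locK K n h t l * (comb n h t l (g i ⟨t, ht⟩ q) ⬝ᵥ y l) * e l i
            + ∑ l ∈ Finset.range n, locK K n h t l * ((comb n h t l (g i ⟨t, ht⟩ q) ⬝ᵥ x l
              - comb n h t l (g i ⟨t, ht⟩ q) ⬝ᵥ y l) * e l i) := by
        rw [← Finset.sum_add_distrib]
        refine Finset.sum_congr rfl fun l _ => ?_
        rw [locF_dotProduct]
        ring
      rw [h2]
      refine (abs_add_le _ _).trans (add_le_add h1 ?_)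
      refine (Finset.abs_sum_le_sum_abs _ _).trans (hw t _ _ (by positivity) ?_)
      intro l hl h0
      rw [abs_mul]
      calc _ ≤ 2 * s * C * η * b₀ := by
            gcongr
            · exact hcd i ⟨t, ht⟩ q l hl h0
            · exact G.innov ⟨l, hl⟩ i
        _ ≤ _ := by
            have : 0 ≤ η * b₀ := by positivity
            nlinarith
    · refine le_trans ?_ (le_max_right _ _)
      have h1 : ∀ l ∈ Finset.range n, locK K n h t l * |locF n h x t l ⬝ᵥ g i ⟨t, ht⟩ q|
          ≤ b₁ * (locK K n h t l * covForm Cf m l (comb n h t l (g i ⟨t, ht⟩ q))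
              (comb n h t l (g i ⟨t, ht⟩ q)))
            + (b₁ * 2 + 2 * s * C * η) * locK K n h t l := by
        intro l hl
        have hl' := Finset.mem_range.1 hl
        by_cases h0 : locK K n h t l = 0
        · simp [h0]
        set cv := covForm Cf m l (comb n h t l (g i ⟨t, ht⟩ q)) (comb n h t l (g i ⟨t, ht⟩ q))
          with hcv
        have hcv0 : 0 ≤ cv := covForm_self_nonneg _ _ _
        have h2 := G.dual_tail i ⟨t, ht⟩ q ⟨l, hl'⟩
        simp only at h2
        rw [← hcv] at h2
        -- Replacing the standard deviation by the variance lets the kernel-weighted sum be bounded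
        -- by the energy of the dual vector. The result is free of `s`, unlike a bound through the
        -- `ℓ¹` norm.
        have h3 : √(cv + 1) ≤ cv + 2 := by
          rw [Real.sqrt_le_left (by linarith)]
          nlinarith
        have h4 := hcd i ⟨t, ht⟩ q l hl' h0
        have h5 : |locF n h x t l ⬝ᵥ g i ⟨t, ht⟩ q| ≤ b₁ * (cv + 2) + 2 * s * C * η := by
          rw [locF_dotProduct]
          have e1 : comb n h t l (g i ⟨t, ht⟩ q) ⬝ᵥ x l = comb n h t l (g i ⟨t, ht⟩ q) ⬝ᵥ y l
            + (comb n h t l (g i ⟨t, ht⟩ q) ⬝ᵥ x l - comb n h t l (g i ⟨t, ht⟩ q) ⬝ᵥ y l) := by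
            ring
          rw [e1]
          refine (abs_add_le _ _).trans (add_le_add (h2.trans ?_) h4)
          gcongr
        calc _ ≤ locK K n h t l * (b₁ * (cv + 2) + 2 * s * C * η) :=
              mul_le_mul_of_nonneg_left h5 (hκ t l)
          _ = _ := by ring
      refine (Finset.sum_le_sum h1).trans ?_
      rw [Finset.sum_add_distrib, ← Finset.mul_sum, ← Finset.mul_sum]
      have h6 := mul_le_mul_of_nonneg_left (hg i ⟨t, ht⟩ q).energy_le hb₁
      have h7 := mul_le_mul_of_nonneg_left (hk₁ t)
        (by positivity : 0 ≤ b₁ * 2 + 2 * s * C * η)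
      simp only at h6
      linarith
    · have h1 := G.gram i ⟨t, ht⟩ q q'
      simp only [mul_sub, Finset.sum_sub_distrib] at h1
      have h3 := (hg i ⟨t, ht⟩ q).dual hq q' hq'
      simp only at h3
      rw [h3] at h1
      have h2 : ∑ l ∈ Finset.range n,
          locK K n h t l * (locF n h x t l q' * (locF n h x t l ⬝ᵥ g i ⟨t, ht⟩ q))
          = ∑ l ∈ Finset.range n, locK K n h t l * locC n h t l q' *
              ((comb n h t l (g i ⟨t, ht⟩ q) ⬝ᵥ y l) * (Pi.single (baseIdx q') 1 ⬝ᵥ y l))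
            + ∑ l ∈ Finset.range n, locK K n h t l * (locC n h t l q' *
              ((comb n h t l (g i ⟨t, ht⟩ q) ⬝ᵥ x l - comb n h t l (g i ⟨t, ht⟩ q) ⬝ᵥ y l)
                * x l (baseIdx q')
              + (comb n h t l (g i ⟨t, ht⟩ q) ⬝ᵥ y l) *
                (x l (baseIdx q') - y l (baseIdx q')))) := by
        rw [← Finset.sum_add_distrib]
        refine Finset.sum_congr rfl fun l _ => ?_
        rw [locF_dotProduct, locF_apply, single_one_dotProduct]
        ring
      rw [h2, add_sub_right_comm]
      refine (abs_add_le _ _).trans (add_le_add h1 ?_)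
      refine (Finset.abs_sum_le_sum_abs _ _).trans (hw t _ _ (by positivity) ?_)
      intro l hl h0
      rw [abs_mul]
      calc _ ≤ 1 * (2 * s * C * η * (b₀ + η) + 2 * s * C * b₀ * η) := by
            refine mul_le_mul (abs_locC_le (abs_locW_le_one hK h0) q') ?_ (abs_nonneg _)
              zero_le_one
            refine (abs_add_le _ _).trans ?_
            rw [abs_mul, abs_mul]
            gcongr
            · exact hcd i ⟨t, ht⟩ q l hl h0
            · exact hxb l hl _
            · exact hcy i ⟨t, ht⟩ q l hl h0
            · exact G.close ⟨l, hl⟩ _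
        _ = _ := by ring

end GoodSample

/-! ### Probability of a good sample -/

section Probability

lemma measure_not_forall_le {Ω' ι : Type*} [MeasurableSpace Ω'] [Fintype ι] {μ : Measure Ω'}
    {p : ι → Ω' → Prop} {c : ENNReal} (h : ∀ i, μ {ω | ¬ p i ω} ≤ c) :
    μ {ω | ¬ ∀ i, p i ω} ≤ Fintype.card ι * c := by
  have e : {ω | ¬ ∀ i, p i ω} = ⋃ i, {ω | ¬ p i ω} := by
    ext ω
    simp
  rw [e]
  calc _ ≤ ∑ i, μ {ω | ¬ p i ω} := measure_iUnion_fintype_le _ _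
    _ ≤ ∑ _i : ι, c := Finset.sum_le_sum fun i _ => h i
    _ = _ := by simp

lemma measure_not_and_le {Ω' : Type*} [MeasurableSpace Ω'] {μ : Measure Ω'}
    {p q : Ω' → Prop} {a b : ENNReal} (hp : μ {ω | ¬ p ω} ≤ a) (hq : μ {ω | ¬ q ω} ≤ b) :
    μ {ω | ¬ (p ω ∧ q ω)} ≤ a + b := by
  have e : {ω | ¬ (p ω ∧ q ω)} = {ω | ¬ p ω} ∪ {ω | ¬ q ω} := by
    ext ω
    simp only [Set.mem_ofPred_eq, Set.mem_union]
    tauto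
  rw [e]
  exact (measure_union_le _ _).trans (add_le_add hp hq)

variable {d : ℕ → ℕ} {Ω : ℕ → Type*} [∀ n, MeasurableSpace (Ω n)] {P : ∀ n, Measure (Ω n)}

/-- The truncated Wold series. -/
def truncX (M : Model d Ω P) (m n l : ℕ) (ω : Ω n) : Fin (d n) → ℝ :=
  linProc (maCoef n (M.A n) (M.Sigma n)) (M.eps n) m l ω

/-- The noise entering at time `l + 1`. -/
def noiseAt (M : Model d Ω P) (n l : ℕ) (ω : Ω n) (i : Fin (d n)) : ℝ :=
  innovRow n (M.Sigma n) i l ⬝ᵥ M.eps n ((l : ℤ) + 1) ω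

-- A union bound over the seven requirements, each at level `exp (-x)`. The dual vectors are
-- nonrandom, so the noise and Gram bounds apply to them directly. The free parameters `sP` and `u₀`
-- are those of the Bernstein argument for the Gram entries.
set_option maxHeartbeats 2000000 in
theorem measure_not_goodTrunc_le {M : Model d Ω P} {n : ℕ} [IsProbabilityMeasure (P n)]
    {B D ρ : ℝ} (H : SubGInnov (P n) (M.eps n) B)
    (hb : CoefBounds (n := n) (M.A n) (M.Sigma n) D ρ) (hD : 0 < D) (hρ : 0 < ρ) (hρ1 : ρ < 1)
    {K : ℝ → ℝ} (hK : KernelCond K) {CK : ℝ} (hCK : ∀ x, K x ≤ CK) (hCK0 : 0 < CK) {h : ℝ}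
    (hh : 0 < h) (hnh : 1 ≤ n * h)
    {S : Fin (d n) → Finset (Fin (d n) ⊕ Fin (d n))} {C s : ℝ} (hC : 0 < C)
    (hS : ∀ i, ((S i).card : ℝ) ≤ 2 * s) {m : ℕ} (hm : 0 < m)
    {g : Fin (d n) → Fin n → Fin (d n) ⊕ Fin (d n) → Fin (d n) ⊕ Fin (d n) → ℝ}
    (hg : ∀ i (t : Fin n) q,
      IsLocDual K n h (maCoef n (M.A n) (M.Sigma n)) m t (S i) C q (g i t q))
    {x sP u₀ D' V : ℝ} (hx : 0 < x) (hD' : D' = D / (1 - ρ ^ 2))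
    (hV : V = CK / (n * h) * (D' * (3 * CK) + C + 3 * CK)) (hsP : 0 ≤ sP)
    (hsc : sP * (CK / (n * h)) * (B * √((D' * (4 * s * C ^ 2) + 1) * D')) ≤ 1 / 16)
    (hexp : 10000 * B ^ 2 * D' * V * sP ^ 2 - sP * u₀ ≤ -x) :
    P n {ω | ¬ GoodTrunc K n h (maCoef n (M.A n) (M.Sigma n)) m (fun l => M.X n l ω)
        (fun l => truncX M m n l ω) (fun l => noiseAt M n l ω) g
        (√(4 * x * (B * (D * ((ρ ^ 2) ^ m / (1 - ρ ^ 2)))))) (√(4 * x * (B * D')))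
        (√(4 * x * B)) (4 * x * B * √(D * V)) (m * u₀)}
      ≤ ((n * (d n * 2) + (n * (d n * 2) + (n * (d n * 2)
          + (d n * (n * ((d n + d n) * (2 * n + 2))) + (d n * (n * ((d n + d n) * (2 * n + 2)))
          + (d n * (n * ((d n + d n) * (n * 2)))
          + d n * (n * ((d n + d n) * ((d n + d n) * (2 * m))))))))) : ℕ) : ENNReal)
        * ENNReal.ofReal (Real.exp (-x)) := by
  have hB := H.pos
  have hr : 0 < 1 - ρ ^ 2 := by nlinarith
  have hnh0 : 0 < n * h := by linarith
  have hD'0 : 0 < D' := by rw [hD']; positivity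
  have hDD' : D ≤ D' := by
    rw [hD', le_div_iff₀ hr]
    nlinarith [sq_nonneg ρ]
  have hV0 : 0 < V := by rw [hV]; positivity
  have hκ := fun t l => locK_nonneg (n := n) hK hh t l
  have hκ' := fun t l => locK_le (n := n) hCK hh t l
  have hcf := fun l (hl : l < n) u => hb.covForm_le hD hρ hρ1 hl.le m u
  rw [← hD'] at hcf
  have hcs : ∀ l < n, ∀ j : Fin (d n),
      covForm (maCoef n (M.A n) (M.Sigma n)) m l (Pi.single j 1) (Pi.single j 1) ≤ D' := by
    intro l hl j
    have := hcf l hl (Pi.single j 1)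
    rwa [single_one_dotProduct, Pi.single_eq_same, mul_one] at this
  have hsumK := fun t => sum_locK_le hK hCK hh hnh t
  -- variance proxies
  have hvar : ∀ (t : ℕ) (c σ2 : ℕ → ℝ) (R : ℝ), (∀ l, |c l| ≤ locK K n h t l) →
      (∀ l < n, 0 ≤ σ2 l) → ∑ l ∈ Finset.range n, locK K n h t l * σ2 l ≤ R →
      ∑ l ∈ Finset.range n, c l ^ 2 * σ2 l ≤ CK / (n * h) * R := by
    intro t c σ2 R hc hσ hR
    calc _ ≤ ∑ l ∈ Finset.range n, CK / (n * h) * (locK K n h t l * σ2 l) := by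
          refine Finset.sum_le_sum fun l hl => ?_
          rw [← mul_assoc]
          refine mul_le_mul_of_nonneg_right ?_ (hσ l (Finset.mem_range.1 hl))
          -- One factor of the weight is bounded by its maximum `CK / (n h)`, which supplies the
          -- effective sample size; the other is kept for the weighted sum.
          rw [← sq_abs, sq]
          exact mul_le_mul ((hc l).trans (hκ' t l)) (hc l) (abs_nonneg _) (by positivity)
      _ = CK / (n * h) * ∑ l ∈ Finset.range n, locK K n h t l * σ2 l := by rw [Finset.mul_sum]
      _ ≤ _ := by gcongr
  have hcK : ∀ t l, |locK K n h t l| ≤ locK K n h t l := fun t l => (abs_of_nonneg (hκ t l)).le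
  have hdualV : ∀ i (t : Fin n) q, ∑ l ∈ Finset.range n, locK K n h t l *
      (covForm (maCoef n (M.A n) (M.Sigma n)) m l (comb n h t l (g i t q))
        (comb n h t l (g i t q)) + 1) ≤ C + 3 * CK := by
    intro i t q
    simp only [mul_add, mul_one, Finset.sum_add_distrib]
    exact add_le_add (hg i t q).energy_le (hsumK t)
  have hVle : ∀ R, R ≤ D' * (3 * CK) + C + 3 * CK → CK / (n * h) * R ≤ V := by
    intro R hR
    rw [hV]
    gcongr
  have hsq : ∀ σ : ℝ, √(4 * x * (B * σ)) = √(4 * x * B) * √σ := by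
    intro σ
    rw [← mul_assoc, Real.sqrt_mul (by positivity)]
  have hcv0 := fun l u => covForm_self_nonneg (Cf := maCoef n (M.A n) (M.Sigma n)) m l u
  set ε := ENNReal.ofReal (Real.exp (-x)) with hε
  -- the individual events
  have b1 : P n {ω | ¬ ∀ l : Fin n, ∀ j, |M.X n l ω j - truncX M m n l ω j|
      ≤ √(4 * x * (B * (D * ((ρ ^ 2) ^ m / (1 - ρ ^ 2)))))} ≤ n * (d n * (2 * ε)) := by
    have := measure_not_forall_le (μ := P n) (ι := Fin n) (c := d n * (2 * ε))
      (p := fun l ω => ∀ j, |M.X n l ω j - truncX M m n l ω j|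
        ≤ √(4 * x * (B * (D * ((ρ ^ 2) ^ m / (1 - ρ ^ 2)))))) (fun l => ?_)
    · simpa using this
    · have := measure_not_forall_le (μ := P n) (ι := Fin (d n)) (c := 2 * ε)
        (p := fun j ω => |M.X n l ω j - truncX M m n l ω j|
        ≤ √(4 * x * (B * (D * ((ρ ^ 2) ^ m / (1 - ρ ^ 2)))))) (fun j => ?_)
      · simpa using this
      · simp only [not_le]
        exact wold_remainder_tail H hb hD hρ hρ1 l.2.le m j hx.le
  have b2 : P n {ω | ¬ ∀ l : Fin n, ∀ j, |truncX M m n l ω j| ≤ √(4 * x * (B * D'))}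
      ≤ n * (d n * (2 * ε)) := by
    have := measure_not_forall_le (μ := P n) (ι := Fin n) (c := d n * (2 * ε))
      (p := fun l ω => ∀ j, |truncX M m n l ω j| ≤ √(4 * x * (B * D'))) (fun l => ?_)
    · simpa using this
    · have := measure_not_forall_le (μ := P n) (ι := Fin (d n)) (c := 2 * ε)
        (p := fun j ω => |truncX M m n l ω j| ≤ √(4 * x * (B * D'))) (fun j => ?_)
      · simpa using this
      · simp only [not_le]
        have h1 := H.linProc_tail (Cf := maCoef n (M.A n) (M.Sigma n)) m l (Pi.single j 1) hD'0
          (hcs l l.2 j) hx.le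
        simp only [single_one_dotProduct] at h1
        exact h1
  have b3 : P n {ω | ¬ ∀ l : Fin n, ∀ i, |noiseAt M n l ω i| ≤ √(4 * x * (B * D'))}
      ≤ n * (d n * (2 * ε)) := by
    have := measure_not_forall_le (μ := P n) (ι := Fin n) (c := d n * (2 * ε))
      (p := fun l ω => ∀ i, |noiseAt M n l ω i| ≤ √(4 * x * (B * D'))) (fun l => ?_)
    · simpa using this
    · have := measure_not_forall_le (μ := P n) (ι := Fin (d n)) (c := 2 * ε)
        (p := fun i ω => |noiseAt M n l ω i| ≤ √(4 * x * (B * D'))) (fun i => ?_)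
      · simpa using this
      · simp only [not_le]
        exact ((H.subG _ _).mono (mul_le_mul_of_nonneg_left
          ((hb.row l l.2 i).trans hDD') hB.le)).tail (H.measurable_dot _ _) (by positivity) hx.le
  have b4 : P n {ω | ¬ ∀ i, ∀ t : Fin n, ∀ q, |∑ l ∈ Finset.range n,
      locK K n h t l * locC n h t l q * (Pi.single (baseIdx q) 1 ⬝ᵥ truncX M m n l ω)
        * noiseAt M n l ω i| ≤ 4 * x * B * √(D * V)}
      ≤ d n * (n * ((d n + d n) * ((2 * n + 2) * ε))) := by
    have := measure_not_forall_le (μ := P n) (ι := Fin (d n))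
      (c := n * ((d n + d n) * ((2 * n + 2) * ε)))
      (p := fun i ω => ∀ t : Fin n, ∀ q, |∑ l ∈ Finset.range n,
      locK K n h t l * locC n h t l q * (Pi.single (baseIdx q) 1 ⬝ᵥ truncX M m n l ω)
        * noiseAt M n l ω i| ≤ 4 * x * B * √(D * V)) (fun i => ?_)
    · simpa using this
    have := measure_not_forall_le (μ := P n) (ι := Fin n)
      (c := (d n + d n) * ((2 * n + 2) * ε))
      (p := fun t ω => ∀ q, |∑ l ∈ Finset.range n,
      locK K n h t l * locC n h t l q * (Pi.single (baseIdx q) 1 ⬝ᵥ truncX M m n l ω)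
        * noiseAt M n l ω i| ≤ 4 * x * B * √(D * V)) (fun t => ?_)
    · simpa using this
    have := measure_not_forall_le (μ := P n) (ι := Fin (d n) ⊕ Fin (d n))
      (c := (2 * n + 2) * ε)
      (p := fun q ω => |∑ l ∈ Finset.range n,
      locK K n h t l * locC n h t l q * (Pi.single (baseIdx q) 1 ⬝ᵥ truncX M m n l ω)
        * noiseAt M n l ω i| ≤ 4 * x * B * √(D * V)) (fun q => ?_)
    · simpa using this
    simp only [not_le]
    refine H.noise_bound m n (fun l => locK K n h t l * locC n h t l q)
      (fun _ => Pi.single (baseIdx q) 1) (fun l => innovRow n (M.Sigma n) i l) (fun _ => D')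
      (fun _ _ => hD'0) (fun l hl => hcs l hl _) (fun l hl => hb.row l hl i) hD ?_ hV0 hx
    refine (hvar t _ _ (D' * (3 * CK)) (fun l => abs_locK_mul_locC_le hK hh t l q)
      (fun _ _ => hD'0.le) ?_).trans (hVle _ (by linarith))
    rw [← Finset.sum_mul, mul_comm]
    gcongr
    exact hsumK t
  have b5 : P n {ω | ¬ ∀ i, ∀ t : Fin n, ∀ q, |∑ l ∈ Finset.range n,
      locK K n h t l * (comb n h t l (g i t q) ⬝ᵥ truncX M m n l ω) * noiseAt M n l ω i|
        ≤ 4 * x * B * √(D * V)}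
      ≤ d n * (n * ((d n + d n) * ((2 * n + 2) * ε))) := by
    have := measure_not_forall_le (μ := P n) (ι := Fin (d n))
      (c := n * ((d n + d n) * ((2 * n + 2) * ε)))
      (p := fun i ω => ∀ t : Fin n, ∀ q, |∑ l ∈ Finset.range n,
      locK K n h t l * (comb n h t l (g i t q) ⬝ᵥ truncX M m n l ω) * noiseAt M n l ω i|
        ≤ 4 * x * B * √(D * V)) (fun i => ?_)
    · simpa using this
    have := measure_not_forall_le (μ := P n) (ι := Fin n)
      (c := (d n + d n) * ((2 * n + 2) * ε))
      (p := fun t ω => ∀ q, |∑ l ∈ Finset.range n,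
      locK K n h t l * (comb n h t l (g i t q) ⬝ᵥ truncX M m n l ω) * noiseAt M n l ω i|
        ≤ 4 * x * B * √(D * V)) (fun t => ?_)
    · simpa using this
    have := measure_not_forall_le (μ := P n) (ι := Fin (d n) ⊕ Fin (d n))
      (c := (2 * n + 2) * ε)
      (p := fun q ω => |∑ l ∈ Finset.range n,
      locK K n h t l * (comb n h t l (g i t q) ⬝ᵥ truncX M m n l ω) * noiseAt M n l ω i|
        ≤ 4 * x * B * √(D * V)) (fun q => ?_)
    · simpa using this
    simp only [not_le]
    -- The added `1` keeps the variance proxy positive when the covariance form vanishes, at the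
    -- price of the term `3 * CK` in `V`.
    refine H.noise_bound m n (fun l => locK K n h t l)
      (fun l => comb n h t l (g i t q)) (fun l => innovRow n (M.Sigma n) i l)
      (fun l => covForm (maCoef n (M.A n) (M.Sigma n)) m l (comb n h t l (g i t q))
        (comb n h t l (g i t q)) + 1)
      (fun l _ => by linarith [hcv0 l (comb n h t l (g i t q))])
      (fun l hl => by linarith) (fun l hl => hb.row l hl i) hD ?_ hV0 hx
    refine (hvar t _ _ (C + 3 * CK) (fun l => hcK t l)
      (fun l _ => by linarith [hcv0 l (comb n h t l (g i t q))]) (hdualV i t q)).trans (hVle _ ?_)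
    have : 0 ≤ D' * (3 * CK) := by positivity
    linarith
  have b6 : P n {ω | ¬ ∀ i, ∀ t : Fin n, ∀ q, ∀ l : Fin n,
      |comb n h t l (g i t q) ⬝ᵥ truncX M m n l ω| ≤ √(4 * x * B) *
        √(covForm (maCoef n (M.A n) (M.Sigma n)) m l (comb n h t l (g i t q))
          (comb n h t l (g i t q)) + 1)}
      ≤ d n * (n * ((d n + d n) * (n * (2 * ε)))) := by
    have := measure_not_forall_le (μ := P n) (ι := Fin (d n))
      (c := n * ((d n + d n) * (n * (2 * ε))))
      (p := fun i ω => ∀ t : Fin n, ∀ q, ∀ l : Fin n,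
      |comb n h t l (g i t q) ⬝ᵥ truncX M m n l ω| ≤ √(4 * x * B) *
        √(covForm (maCoef n (M.A n) (M.Sigma n)) m l (comb n h t l (g i t q))
          (comb n h t l (g i t q)) + 1)) (fun i => ?_)
    · simpa using this
    have := measure_not_forall_le (μ := P n) (ι := Fin n)
      (c := (d n + d n) * (n * (2 * ε)))
      (p := fun t ω => ∀ q, ∀ l : Fin n,
      |comb n h t l (g i t q) ⬝ᵥ truncX M m n l ω| ≤ √(4 * x * B) *
        √(covForm (maCoef n (M.A n) (M.Sigma n)) m l (comb n h t l (g i t q))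
          (comb n h t l (g i t q)) + 1)) (fun t => ?_)
    · simpa using this
    have := measure_not_forall_le (μ := P n) (ι := Fin (d n) ⊕ Fin (d n))
      (c := n * (2 * ε))
      (p := fun q ω => ∀ l : Fin n,
      |comb n h t l (g i t q) ⬝ᵥ truncX M m n l ω| ≤ √(4 * x * B) *
        √(covForm (maCoef n (M.A n) (M.Sigma n)) m l (comb n h t l (g i t q))
          (comb n h t l (g i t q)) + 1)) (fun q => ?_)
    · simpa using this
    have := measure_not_forall_le (μ := P n) (ι := Fin n) (c := 2 * ε)
      (p := fun l ω => |comb n h t l (g i t q) ⬝ᵥ truncX M m n l ω| ≤ √(4 * x * B) *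
        √(covForm (maCoef n (M.A n) (M.Sigma n)) m l (comb n h t l (g i t q))
          (comb n h t l (g i t q)) + 1)) (fun l => ?_)
    · simpa using this
    simp only [not_le, ← hsq]
    exact H.linProc_tail m l _
      (by linarith [hcv0 l (comb n h t l (g i t q))]) (by linarith) hx.le
  have b7 : P n {ω | ¬ ∀ i, ∀ t : Fin n, ∀ q q', |∑ l ∈ Finset.range n,
      locK K n h t l * locC n h t l q' * ((comb n h t l (g i t q) ⬝ᵥ truncX M m n l ω) *
        (Pi.single (baseIdx q') 1 ⬝ᵥ truncX M m n l ω)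
          - covForm (maCoef n (M.A n) (M.Sigma n)) m l (comb n h t l (g i t q))
            (Pi.single (baseIdx q') 1))| ≤ m * u₀}
      ≤ d n * (n * ((d n + d n) * ((d n + d n) * (2 * m * ε)))) := by
    have := measure_not_forall_le (μ := P n) (ι := Fin (d n))
      (c := n * ((d n + d n) * ((d n + d n) * (2 * m * ε))))
      (p := fun i ω => ∀ t : Fin n, ∀ q q', |∑ l ∈ Finset.range n,
      locK K n h t l * locC n h t l q' * ((comb n h t l (g i t q) ⬝ᵥ truncX M m n l ω) *
        (Pi.single (baseIdx q') 1 ⬝ᵥ truncX M m n l ω)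
          - covForm (maCoef n (M.A n) (M.Sigma n)) m l (comb n h t l (g i t q))
            (Pi.single (baseIdx q') 1))| ≤ m * u₀) (fun i => ?_)
    · simpa using this
    have := measure_not_forall_le (μ := P n) (ι := Fin n)
      (c := (d n + d n) * ((d n + d n) * (2 * m * ε)))
      (p := fun t ω => ∀ q q', |∑ l ∈ Finset.range n,
      locK K n h t l * locC n h t l q' * ((comb n h t l (g i t q) ⬝ᵥ truncX M m n l ω) *
        (Pi.single (baseIdx q') 1 ⬝ᵥ truncX M m n l ω)
          - covForm (maCoef n (M.A n) (M.Sigma n)) m l (comb n h t l (g i t q))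
            (Pi.single (baseIdx q') 1))| ≤ m * u₀) (fun t => ?_)
    · simpa using this
    have := measure_not_forall_le (μ := P n) (ι := Fin (d n) ⊕ Fin (d n))
      (c := (d n + d n) * (2 * m * ε))
      (p := fun q ω => ∀ q', |∑ l ∈ Finset.range n,
      locK K n h t l * locC n h t l q' * ((comb n h t l (g i t q) ⬝ᵥ truncX M m n l ω) *
        (Pi.single (baseIdx q') 1 ⬝ᵥ truncX M m n l ω)
          - covForm (maCoef n (M.A n) (M.Sigma n)) m l (comb n h t l (g i t q))
            (Pi.single (baseIdx q') 1))| ≤ m * u₀) (fun q => ?_)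
    · simpa using this
    have := measure_not_forall_le (μ := P n) (ι := Fin (d n) ⊕ Fin (d n))
      (c := 2 * m * ε)
      (p := fun q' ω => |∑ l ∈ Finset.range n,
      locK K n h t l * locC n h t l q' * ((comb n h t l (g i t q) ⬝ᵥ truncX M m n l ω) *
        (Pi.single (baseIdx q') 1 ⬝ᵥ truncX M m n l ω)
          - covForm (maCoef n (M.A n) (M.Sigma n)) m l (comb n h t l (g i t q))
            (Pi.single (baseIdx q') 1))| ≤ m * u₀) (fun q' => ?_)
    · simpa using this
    simp only [not_le]
    refine (H.gram_bound hm n (fun l => locK K n h t l * locC n h t l q')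
      (fun l => comb n h t l (g i t q)) (fun _ => Pi.single (baseIdx q') 1)
      (fun l => covForm (maCoef n (M.A n) (M.Sigma n)) m l (comb n h t l (g i t q))
        (comb n h t l (g i t q)) + 1) (w2 := D') (V := V) (s := sP) (u := u₀)
      (fun l _ => by linarith [hcv0 l (comb n h t l (g i t q))]) hD'0 (fun l hl => by linarith)
      (fun l hl => hcs l hl _) ?_ hsP ?_).trans ?_
    · refine (hvar t _ _ (C + 3 * CK) (fun l => abs_locK_mul_locC_le hK hh t l q')
        (fun l _ => by linarith [hcv0 l (comb n h t l (g i t q))]) (hdualV i t q)).trans (hVle _ ?_)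
      have : 0 ≤ D' * (3 * CK) := by positivity
      linarith
    · intro l hl
      by_cases h0 : locK K n h t l = 0
      · simp [h0]
      refine le_trans ?_ hsc
      have hw := abs_locW_le_one hK h0
      -- The pointwise variance of a dual combination can be of order `s`. It only limits the
      -- admissible range of `sP`; the variance `V` itself uses the averaged energy.
      have hg2 : ∑ q'', g i t q q'' ^ 2 ≤ 2 * s * C ^ 2 := by
        calc ∑ q'', g i t q q'' ^ 2 = ∑ q'' ∈ S i, g i t q q'' ^ 2 :=
              (Finset.sum_subset (Finset.subset_univ _) fun q'' _ hq'' => by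
                rw [(hg i t q).supp q'' hq'']; simp).symm
          _ ≤ ∑ _q'' ∈ S i, C ^ 2 := Finset.sum_le_sum fun q'' _ => by
              rw [← sq_abs]
              exact pow_le_pow_left₀ (abs_nonneg _) ((hg i t q).bdd q'') 2
          _ = (S i).card * C ^ 2 := by rw [Finset.sum_const, nsmul_eq_mul]
          _ ≤ _ := by gcongr; exact hS i
      have hcv : covForm (maCoef n (M.A n) (M.Sigma n)) m l (comb n h t l (g i t q))
          (comb n h t l (g i t q)) ≤ D' * (4 * s * C ^ 2) := by
        refine (hcf l hl _).trans ?_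
        gcongr
        refine (comb_dotProduct_self_le hw _).trans ?_
        linarith
      gcongr
      exact (abs_locK_mul_locC_le hK hh t l q').trans (hκ' t l)
    · rw [hε]
      gcongr
  refine le_trans (measure_mono ?_) ((measure_not_and_le b1 (measure_not_and_le b2
    (measure_not_and_le b3 (measure_not_and_le b4 (measure_not_and_le b5
      (measure_not_and_le b6 b7)))))).trans (le_of_eq ?_))
  · intro ω hω hcon
    obtain ⟨c1, c2, c3, c4, c5, c6, c7⟩ := hcon
    exact hω ⟨c1, c2, c3, c4, c5, c6, c7⟩
  · push_cast
    ring

end Probability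

/-! ### Choice of truncation order and deviation levels. -/

section GoodSampleProbability

variable {d : ℕ → ℕ} {Ω : ℕ → Type*} [∀ n, MeasurableSpace (Ω n)] {P : ∀ n, Measure (Ω n)}

lemma GoodSample.mono {d : ℕ} {K : ℝ → ℝ} {n : ℕ} {h : ℝ} {x e : ℕ → Fin d → ℝ}
    {S : Fin d → Finset (Fin d ⊕ Fin d)} {b r δ b' r' δ' : ℝ} (G : GoodSample K n h x e S b r δ)
    (hb : b ≤ b') (hr : r ≤ r') (hδ : δ ≤ δ') : GoodSample K n h x e S b' r' δ' := by
  refine ⟨fun l hl j => (G.bdd l hl j).trans hb, fun i t ht q => (G.noise i t ht q).trans hr,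
    fun i t ht => ?_⟩
  obtain ⟨g, hg⟩ := G.dual i t ht
  exact ⟨g, fun q hq => ⟨(hg q hq).1, (hg q hq).2.1.trans hr, (hg q hq).2.2.1.trans hb,
    fun q' hq' => ((hg q hq).2.2.2 q' hq').trans hδ⟩⟩

/-- A number of lags proportional to `L` turns geometric decay into a prescribed power of `exp
(-L)`, that is, of `1 / (n ∨ d)` when `L = log (n ∨ d)`. -/
lemma exists_pow_le_exp_neg {ρ : ℝ} (hρ : 0 < ρ) (hρ1 : ρ < 1) (k : ℝ) (hk : 0 ≤ k) :
    ∃ a : ℝ, 0 < a ∧ ∀ L : ℝ, 1 ≤ L → ∃ m : ℕ, 0 < m ∧ (m : ℝ) ≤ a * L ∧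
      ρ ^ m ≤ Real.exp (-(k * L)) := by
  have hlog : 0 < -Real.log ρ := neg_pos.2 (Real.log_neg hρ hρ1)
  refine ⟨k / (-Real.log ρ) + 2, by positivity, fun L hL => ⟨⌈k / (-Real.log ρ) * L⌉₊ + 1,
    Nat.succ_pos _, ?_, ?_⟩⟩
  · have := (Nat.ceil_lt_add_one (a := k / (-Real.log ρ) * L) (by positivity)).le
    push_cast
    linarith
  · have h1 : k / (-Real.log ρ) * L ≤ ((⌈k / (-Real.log ρ) * L⌉₊ + 1 : ℕ) : ℝ) := by
      push_cast
      linarith [Nat.le_ceil (k / (-Real.log ρ) * L)]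
    rw [← Real.exp_log (pow_pos hρ _), Real.log_pow]
    refine Real.exp_le_exp.2 ?_
    have h2 := mul_le_mul_of_nonneg_right h1 hlog.le
    have h3 : k / (-Real.log ρ) * L * (-Real.log ρ) = k * L := by
      rw [div_mul_eq_mul_div, div_mul_cancel₀ _ hlog.ne']
    linarith

-- All constants are fixed before the model and the sample size are introduced, which is what makes
-- `C'` uniform. The hypothesis with `s * L ^ 2 / √(n h)` serves both the Bernstein range and the
-- Gram error.
set_option maxHeartbeats 2000000 in
theorem exists_measure_not_goodSample_le {B D ρ c CK : ℝ} (hB : 0 < B) (hD : 0 < D) (hρ : 0 < ρ)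
    (hρ1 : ρ < 1) (hc : 0 < c) (hCK0 : 0 < CK) {K : ℝ → ℝ} (hK : KernelCond K)
    (hCK : ∀ x, K x ≤ CK) :
    ∃ C' : ℝ, 0 < C' ∧ ∀ {d : ℕ → ℕ} {Ω : ℕ → Type*} [∀ n, MeasurableSpace (Ω n)]
      {P : ∀ n, Measure (Ω n)} (M : Model d Ω P) (n N : ℕ) [IsProbabilityMeasure (P n)],
      SubGInnov (P n) (M.eps n) B → CoefBounds (n := n) (M.A n) (M.Sigma n) D ρ →
      ∀ h : ℝ, 0 < h → 1 ≤ n * h →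
      (∀ t < n, ∀ a b : ℝ, c * (a ^ 2 + b ^ 2)
        ≤ ∑ l ∈ Finset.range n, locK K n h t l * (a + locW n h t l * b) ^ 2) →
      ∀ (S : Fin (d n) → Finset (Fin (d n) ⊕ Fin (d n))) (s L : ℝ),
      (∀ i, ((S i).card : ℝ) ≤ 2 * s) → 1 ≤ s → s ≤ N → L = Real.log N → 1 ≤ L → n ≤ N →
      d n ≤ N → √(n * h) ≤ N → C' * (s * L ^ 2 / √(n * h)) ≤ 1 →
      P n {ω | ¬ GoodSample K n h (fun l => M.X n l ω) (fun l => noiseAt M n l ω) S (C' * √L)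
        (C' * (L / √(n * h))) (1 / (4 * s))} ≤ ENNReal.ofReal (C' * Real.exp (-L)) := by
  obtain ⟨a, ha, ham⟩ := exists_pow_le_exp_neg hρ hρ1 5 (by norm_num)
  have hr : 0 < 1 - ρ ^ 2 := by nlinarith
  set D' := D / (1 - ρ ^ 2) with hD'
  have hD'0 : 0 < D' := by positivity
  set C := D / c with hC
  have hC0 : 0 < C := by positivity
  set k₁ := 3 * CK with hk₁
  have hk₁0 : 0 < k₁ := by positivity
  set v := CK * (D' * (3 * CK) + C + 3 * CK) with hv
  have hv0 : 0 < v := by positivity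
  -- With parameter `√(nh) √L` and deviation `U √L / √(nh)` the Bernstein exponent is `(10000 B² D'
  -- v - U) L = -6 L`.
  set U := 6 + 10000 * B ^ 2 * D' * v with hU
  have hU0 : 0 < U := by positivity
  set w := √((4 * D' * C ^ 2 + 1) * D') with hw
  -- One constant for each requirement: size of the sample, noise level, Bernstein range, Gram error
  -- and number of events. Their sum serves all of them.
  set e₁ := √(24 * B * D') * (2 + 2 * k₁ * C) + √(24 * B) * (C + 2 * k₁) with he₁
  set e₂ := 24 * B * √(D * v) + k₁ * (1 + 2 * C) * (24 * B * D') with he₂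
  set e₃ := 16 * (CK * B * w) with he₃
  set e₄ := 4 * (a * U + 144 * k₁ * C * B * D') with he₄
  set e₅ := 26 + 8 * a with he₅
  have he₁0 : 0 ≤ e₁ := by positivity
  have he₂0 : 0 ≤ e₂ := by positivity
  have he₃0 : 0 ≤ e₃ := by positivity
  have he₄0 : 0 ≤ e₄ := by positivity
  have he₅0 : 0 < e₅ := by positivity
  refine ⟨e₁ + e₂ + e₃ + e₄ + e₅, by positivity, ?_⟩
  intro d Ω _ P M n N _ H hb h hh hnh hlow S s L hS hs1 hsN hL hL1 hnN hdN hrN hψ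
  obtain ⟨m, hm, hma, hmρ⟩ := ham L hL1
  have hs0 : 0 < s := by linarith
  have hN0 : (0 : ℝ) < N := by linarith
  have hN1 : (1 : ℝ) ≤ N := hs1.trans hsN
  have hexpL : Real.exp (-L) = 1 / N := by
    rw [Real.exp_neg, hL, Real.exp_log hN0, one_div]
  have hexpk : ∀ k : ℕ, Real.exp (-(k * L)) = 1 / (N : ℝ) ^ k := by
    intro k
    rw [← mul_neg, Real.exp_nat_mul, hexpL, div_pow, one_pow]
  have hmρ' : ρ ^ m ≤ 1 / (N : ℝ) ^ 5 := by
    have := hexpk 5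
    push_cast at this
    rwa [this] at hmρ
  have hLN : L ≤ N := by
    rw [hL]
    linarith [Real.log_le_sub_one_of_pos hN0]
  have hnh0 : 0 < n * h := by linarith
  set r := √(n * h) with hrdef
  have hr0 : 0 < r := Real.sqrt_pos.2 hnh0
  have hr2 : r ^ 2 = n * h := Real.sq_sqrt hnh0.le
  set p := √L with hp
  have hp2 : p ^ 2 = L := Real.sq_sqrt (by linarith)
  have hp1 : 1 ≤ p := Real.one_le_sqrt.2 hL1
  have hp0 : 0 < p := by linarith
  have hpL : p ≤ L := by
    rw [← hp2, sq]
    exact le_mul_of_one_le_left hp0.le hp1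
  have hLL : L ≤ L * L := le_mul_of_one_le_left (by linarith) hL1
  set ψ := s * L ^ 2 / r with hψdef
  have hψ0 : 0 < ψ := by positivity
  have hψ3 : e₃ * ψ ≤ 1 := (mul_le_mul_of_nonneg_right (by linarith) hψ0.le).trans hψ
  have hψ4 : e₄ * ψ ≤ 1 := (mul_le_mul_of_nonneg_right (by linarith) hψ0.le).trans hψ
  choose g hg using fun i (t : Fin n) q => exists_isLocDual hK hh hb hD hm hc (hlow t t.2) (S i) q
  set V := CK / (n * h) * (D' * (3 * CK) + C + 3 * CK) with hV
  have hV' : V = v / r ^ 2 := by rw [hV, hv, hr2]; ring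
  have hx : 0 < 6 * L := by linarith
  have hps : p * s ≤ s * L ^ 2 := by
    rw [mul_comm, sq]
    gcongr
    exact hpL.trans hLL
  have hsc : r * p * (CK / (n * h)) * (B * √((D' * (4 * s * C ^ 2) + 1) * D')) ≤ 1 / 16 := by
    have h1 : √((D' * (4 * s * C ^ 2) + 1) * D') ≤ s * w := by
      rw [hw]
      refine Real.sqrt_le_iff.2 ⟨by positivity, ?_⟩
      rw [mul_pow, Real.sq_sqrt (by positivity)]
      have h2 : D' * (4 * s * C ^ 2) + 1 ≤ s ^ 2 * (4 * D' * C ^ 2 + 1) := by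
        have h3 : s ≤ s ^ 2 := le_self_pow₀ hs1 two_ne_zero
        have h4 : 0 ≤ D' * (4 * C ^ 2) := by positivity
        have h5 := mul_le_mul_of_nonneg_right h3 h4
        linarith
      calc _ ≤ s ^ 2 * (4 * D' * C ^ 2 + 1) * D' := by gcongr
        _ = _ := by ring
    calc _ ≤ r * p * (CK / (n * h)) * (B * (s * w)) := by gcongr
      _ = (CK * B * w) * (p * s / r) := by
          rw [← hr2]
          field_simp
      _ ≤ (CK * B * w) * ψ := by
          rw [hψdef]
          gcongr
      _ ≤ 1 / 16 := by rw [he₃] at hψ3; linarith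
  have hexp : 10000 * B ^ 2 * D' * V * (r * p) ^ 2 - r * p * (U * p / r) ≤ -(6 * L) := by
    have h1 : 10000 * B ^ 2 * D' * V * (r * p) ^ 2 = 10000 * B ^ 2 * D' * v * L := by
      rw [hV', ← hp2]
      field_simp
    have h2 : r * p * (U * p / r) = U * L := by
      rw [← hp2]
      field_simp
    rw [h1, h2, hU]
    linarith
  have hprob := measure_not_goodTrunc_le H hb hD hρ hρ1 hK hCK hCK0 hh hnh hC0 hS hm hg hx hD' hV
    (by positivity) hsc hexp
  have hρm0 : 0 < ρ ^ m := pow_pos hρ m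
  -- the individual bounds
  set b₀ := √(4 * (6 * L) * (B * D')) with hb₀
  have hb₀' : b₀ = √(24 * B * D') * p := by
    rw [hb₀, hp, ← Real.sqrt_mul (by positivity)]
    congr 1
    ring
  have hb₀0 : 0 < b₀ := by rw [hb₀]; positivity
  have hb₀2 : b₀ ^ 2 = 24 * B * D' * L := by
    rw [hb₀, Real.sq_sqrt (by positivity)]
    ring
  have hη : √(4 * (6 * L) * (B * (D * ((ρ ^ 2) ^ m / (1 - ρ ^ 2))))) = b₀ * ρ ^ m := by
    have : 4 * (6 * L) * (B * (D * ((ρ ^ 2) ^ m / (1 - ρ ^ 2))))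
        = 4 * (6 * L) * (B * D') * (ρ ^ m) ^ 2 := by
      rw [hD', ← pow_mul, ← pow_mul, mul_comm 2 m]
      ring
    rw [this, Real.sqrt_mul (by positivity), Real.sqrt_sq hρm0.le]
  have hb₁ : √(4 * (6 * L) * B) = √(24 * B) * p := by
    rw [hp, ← Real.sqrt_mul (by positivity)]
    congr 1
    ring
  have hr₀ : 4 * (6 * L) * B * √(D * V) = 24 * B * √(D * v) * (L / r) := by
    rw [hV', ← mul_div_assoc, Real.sqrt_div (by positivity), Real.sqrt_sq hr0.le]
    ring
  rw [hη, hb₁, hr₀] at hprob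
  have hNpow : ∀ k : ℕ, 1 ≤ k → (N : ℝ) ≤ N ^ k := fun k hk => le_self_pow₀ hN1 (by omega)
  have hρ1' : ρ ^ m ≤ 1 := pow_le_one₀ hρ.le hρ1.le
  have hsρ : s * ρ ^ m ≤ 1 / N := by
    calc s * ρ ^ m ≤ N * (1 / (N : ℝ) ^ 5) := by gcongr
      _ = 1 / (N : ℝ) ^ 4 := by field_simp
      _ ≤ _ := by gcongr; exact hNpow 4 (by norm_num)
  have hsρ1 : s * ρ ^ m ≤ 1 := hsρ.trans (by rw [div_le_one hN0]; exact hN1)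
  have hNr : 1 / (N : ℝ) ≤ 1 / r := by gcongr
  have hE1 : max (b₀ + b₀ * ρ ^ m) (√(24 * B) * p * (C + 2 * k₁) + k₁ * (2 * s * C * (b₀ * ρ ^ m)))
      ≤ e₁ * p := by
    have t1 : k₁ * (2 * s * C * (b₀ * ρ ^ m)) ≤ 2 * k₁ * C * b₀ := by
      calc _ = 2 * k₁ * C * b₀ * (s * ρ ^ m) := by ring
        _ ≤ 2 * k₁ * C * b₀ * 1 := by gcongr
        _ = _ := mul_one _
    have t2 : b₀ * ρ ^ m ≤ b₀ := mul_le_of_le_one_right hb₀0.le hρ1'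
    have t3 : 0 ≤ √(24 * B) * (C + 2 * k₁) * p := by positivity
    have t4 : 0 ≤ 2 * k₁ * C * b₀ := by positivity
    have t5 : e₁ * p = 2 * b₀ + 2 * k₁ * C * b₀ + √(24 * B) * (C + 2 * k₁) * p := by
      rw [he₁, hb₀']
      ring
    rw [t5]
    refine max_le ?_ ?_ <;> linarith
  have hE2 : 24 * B * √(D * v) * (L / r) + k₁ * (b₀ * ρ ^ m * (1 + 2 * s * C) * b₀)
      ≤ e₂ * (L / r) := by
    have t1 : ρ ^ m * (1 + 2 * s * C) ≤ (1 + 2 * C) * (s * ρ ^ m) := by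
      have := mul_le_mul_of_nonneg_right hs1 hρm0.le
      linarith
    have t2 : k₁ * (b₀ * ρ ^ m * (1 + 2 * s * C) * b₀)
        ≤ k₁ * (1 + 2 * C) * (24 * B * D') * (L / r) := by
      calc _ = k₁ * b₀ ^ 2 * (ρ ^ m * (1 + 2 * s * C)) := by ring
        _ ≤ k₁ * b₀ ^ 2 * ((1 + 2 * C) * (1 / r)) := by
            refine mul_le_mul_of_nonneg_left (t1.trans ?_) (by positivity)
            exact mul_le_mul_of_nonneg_left (hsρ.trans hNr) (by positivity)
        _ = _ := by rw [hb₀2]; ring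
    rw [he₂, add_mul]
    linarith
  -- The target `1 / (4 s)` is what `card S ≤ 2 s` requires for the approximate inverse. The number
  -- of lags gives one `L`, and the deviation `√L` is crudely bounded by a second, whence `s L² /
  -- √(nh)`.
  have hE3 : m * (U * p / r) + k₁ * (2 * s * C * (b₀ * ρ ^ m) * (2 * b₀ + b₀ * ρ ^ m))
      ≤ 1 / (4 * s) := by
    rw [le_div_iff₀ (by positivity)]
    have t1 : s * (m * (U * p / r)) ≤ a * U * ψ := by
      calc s * (m * (U * p / r)) ≤ s * (a * L * (U * L / r)) := by
            gcongr
        _ = a * U * ψ := by rw [hψdef]; ring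
    have t2 : s * (k₁ * (2 * s * C * (b₀ * ρ ^ m) * (2 * b₀ + b₀ * ρ ^ m)))
        ≤ 144 * k₁ * C * B * D' * ψ := by
      have u1 : s * (s * ρ ^ m) * L ≤ ψ := by
        calc s * (s * ρ ^ m) * L ≤ s * (1 / r) * (L * L) := by
              gcongr
              exact hsρ.trans hNr
          _ = ψ := by rw [hψdef]; ring
      have u2 : 2 * b₀ + b₀ * ρ ^ m ≤ 3 * b₀ := by linarith [mul_le_of_le_one_right hb₀0.le hρ1']
      calc _ ≤ s * (k₁ * (2 * s * C * (b₀ * ρ ^ m) * (3 * b₀))) := by gcongr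
        _ = 6 * k₁ * C * (s * (s * ρ ^ m)) * b₀ ^ 2 := by ring
        _ = 144 * k₁ * C * B * D' * (s * (s * ρ ^ m) * L) := by rw [hb₀2]; ring
        _ ≤ _ := by gcongr
    rw [he₄] at hψ4
    linarith
  refine (measure_mono ?_).trans (hprob.trans ?_)
  · intro ω hω hG
    refine hω ((GoodTrunc.goodSample hK hh (fun t => sum_locK_le hK hCK hh hnh t) hS hg hC0.le
      (by positivity) hb₀0.le (by positivity) hs0.le hG).mono ?_ ?_ ?_)
    · refine hE1.trans ?_
      gcongr
      linarith
    · refine hE2.trans ?_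
      gcongr
      linarith
    · exact hE3
  · rw [← ENNReal.ofReal_natCast, ← ENNReal.ofReal_mul (by positivity)]
    refine ENNReal.ofReal_le_ofReal ?_
    have hn' : (n : ℝ) ≤ N := by exact_mod_cast hnN
    have hd' : (d n : ℝ) ≤ N := by exact_mod_cast hdN
    have hm' : (m : ℝ) ≤ a * N := hma.trans (by gcongr)
    have h6 : Real.exp (-(6 * L)) = 1 / (N : ℝ) ^ 6 := by
      have := hexpk 6
      push_cast at this
      exact this
    rw [h6, hexpL]
    -- The Gram events dominate: one equation index, one time, two stacked coordinates and the
    -- number of residue classes give five powers of `N`. Against `N⁻⁶` this leaves `1 / N = exp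
    -- (-L)`.
    have hcount : ((n * (d n * 2) + (n * (d n * 2) + (n * (d n * 2)
          + (d n * (n * ((d n + d n) * (2 * n + 2))) + (d n * (n * ((d n + d n) * (2 * n + 2)))
          + (d n * (n * ((d n + d n) * (n * 2)))
          + d n * (n * ((d n + d n) * ((d n + d n) * (2 * m))))))))) : ℕ) : ℝ) ≤ e₅ * N ^ 5 := by
      push_cast
      have hN2 : (N : ℝ) ^ 2 ≤ N ^ 5 := pow_le_pow_right₀ hN1 (by norm_num)
      have hN4 : (N : ℝ) ^ 4 ≤ N ^ 5 := pow_le_pow_right₀ hN1 (by norm_num)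
      calc _ ≤ (N : ℝ) * (N * 2) + (N * (N * 2) + (N * (N * 2)
          + (N * (N * ((N + N) * (2 * N + 2 * N))) + (N * (N * ((N + N) * (2 * N + 2 * N)))
          + (N * (N * ((N + N) * (N * 2)))
          + N * (N * ((N + N) * ((N + N) * (2 * (a * N)))))))))) := by
            gcongr <;> linarith
        _ = 6 * (N : ℝ) ^ 2 + 20 * N ^ 4 + 8 * a * N ^ 5 := by ring
        _ ≤ _ := by rw [he₅]; linarith
    calc _ ≤ e₅ * (N : ℝ) ^ 5 * (1 / (N : ℝ) ^ 6) := by gcongr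
      _ = e₅ * (1 / N) := by field_simp
      _ ≤ _ := by gcongr; linarith

end GoodSampleProbability

/-! ### Smoothness of the coefficients -/

section Smooth

variable {F : ℝ → ℝ} {C : ℝ}

lemma abs_derivWithin_sub_le (hF : ContDiffOn ℝ 2 F (Set.Icc 0 1))
    (hC : ∀ τ ∈ Set.Icc (0 : ℝ) 1, |iteratedDerivWithin 2 F (Set.Icc 0 1) τ| ≤ C)
    {a b : ℝ} (ha : a ∈ Set.Icc (0 : ℝ) 1) (hb : b ∈ Set.Icc (0 : ℝ) 1) :
    |derivWithin F (Set.Icc 0 1) b - derivWithin F (Set.Icc 0 1) a| ≤ C * |b - a| := by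
  have hu := uniqueDiffOn_Icc (show (0 : ℝ) < 1 by norm_num)
  have h1 : DifferentiableOn ℝ (derivWithin F (Set.Icc 0 1)) (Set.Icc 0 1) :=
    ((hF.derivWithin hu (m := 1) (by norm_num)).differentiableOn (by norm_num))
  refine (convex_Icc (0 : ℝ) 1).norm_image_sub_le_of_norm_derivWithin_le h1 (fun τ hτ => ?_) ha hb
  have := hC τ hτ
  rwa [iteratedDerivWithin_succ, show iteratedDerivWithin 1 F (Set.Icc 0 1)
    = derivWithin F (Set.Icc 0 1) from iteratedDerivWithin_one] at this

/-- The mean value inequality is applied to `F` minus its linear part, whose derivative is at most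
`C |b - a|` between `a` and `b`. Derivatives within the interval make the end points harmless. -/
lemma abs_taylor_le (hF : ContDiffOn ℝ 2 F (Set.Icc 0 1))
    (hC : ∀ τ ∈ Set.Icc (0 : ℝ) 1, |iteratedDerivWithin 2 F (Set.Icc 0 1) τ| ≤ C)
    {a b : ℝ} (ha : a ∈ Set.Icc (0 : ℝ) 1) (hb : b ∈ Set.Icc (0 : ℝ) 1) :
    |F b - F a - (b - a) * derivWithin F (Set.Icc 0 1) a| ≤ C * (b - a) ^ 2 := by
  have hC0 : 0 ≤ C := (abs_nonneg _).trans (hC a ha)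
  have hsub : Set.uIcc a b ⊆ Set.Icc 0 1 := Set.uIcc_subset_Icc ha hb
  have hd : ∀ x ∈ Set.uIcc a b, HasDerivWithinAt
      (fun x => F x - (x - a) * derivWithin F (Set.Icc 0 1) a)
      (derivWithin F (Set.Icc 0 1) x - derivWithin F (Set.Icc 0 1) a) (Set.uIcc a b) x := by
    intro x hx
    have h1 : HasDerivWithinAt F (derivWithin F (Set.Icc 0 1) x) (Set.uIcc a b) x :=
      ((hF.differentiableOn (by norm_num)) x (hsub hx)).hasDerivWithinAt.mono hsub
    have h2 := ((hasDerivWithinAt_id x (Set.uIcc a b)).sub_const a).mul_const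
      (derivWithin F (Set.Icc 0 1) a)
    rw [one_mul] at h2
    exact h1.sub h2
  have := (convex_uIcc a b).norm_image_sub_le_of_norm_hasDerivWithin_le
    (C := C * |b - a|) hd (fun x hx => ?_) Set.left_mem_uIcc Set.right_mem_uIcc
  · rw [sub_self, zero_mul, sub_zero, Real.norm_eq_abs, Real.norm_eq_abs, mul_assoc, ← sq,
      sq_abs] at this
    rwa [sub_right_comm] at this
  · refine (abs_derivWithin_sub_le hF hC ha (hsub hx)).trans ?_
    exact mul_le_mul_of_nonneg_left (Set.abs_sub_left_of_mem_uIcc hx) hC0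

end Smooth

/-! ### The objectives as weighted least squares -/

section Stacked

variable {d : ℕ} {K : ℝ → ℝ} {n : ℕ} {h : ℝ}

lemma gridPt_mem (t : Fin n) : gridPt n t ∈ Set.Icc (0 : ℝ) 1 := by
  refine ⟨by unfold gridPt; positivity, div_le_one_of_le₀ ?_ (Nat.cast_nonneg n)⟩
  exact_mod_cast t.2

lemma gridPt_sub (hn : n ≠ 0) (hh : h ≠ 0) (t l : Fin n) :
    gridPt n l - gridPt n t = h * locW n h t l := by
  unfold gridPt locW
  field_simp
  ring

lemma scaledKernel_gridPt (hn : n ≠ 0) (hh : h ≠ 0) (t l : Fin n) :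
    1 / (n : ℝ) * scaledKernel K h (gridPt n l - gridPt n t) = locK K n h t l := by
  rw [scaledKernel, gridPt_sub hn hh, mul_div_cancel_left₀ _ hh, locK]
  field_simp

/-- Multiplying slopes by `h` moves the bandwidth into the regressors, which then stay on the scale
of `x` inside the window. It also gives both halves of the LASSO penalty the same weight. -/
lemma localLoss_eq_wls (hn : n ≠ 0) (hh : h ≠ 0) (x : ℕ → Fin d → ℝ) (i : Fin d) (t : Fin n)
    (α β : Fin d → ℝ) :
    localLoss n K h x i (gridPt n t) α β = wls (fun l : Fin n => locK K n h t l)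
      (fun l => locF n h x t l) (fun l => x ((l : ℕ) + 1) i) (Sum.elim α fun j => h * β j) := by
  unfold localLoss wls
  rw [Finset.mul_sum]
  refine Finset.sum_congr rfl fun l _ => ?_
  dsimp only
  rw [← scaledKernel_gridPt hn hh, locF_dotProduct]
  have : comb n h t l (Sum.elim α fun j => h * β j) = α + (gridPt n l - gridPt n t) • β := by
    funext j
    simp only [comb_apply, Sum.elim_inl, Sum.elim_inr, Pi.add_apply, Pi.smul_apply, smul_eq_mul,
      gridPt_sub hn hh]
    ring
  rw [this]
  ring

lemma dotProduct_psiBlock (hn : n ≠ 0) (hh : h ≠ 0) (x : ℕ → Fin d → ℝ) (t : Fin n) (k : ℕ)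
    (a b : Fin d → ℝ) :
    a ⬝ᵥ (psiBlock n K h x (gridPt n t) k *ᵥ b)
      = ∑ l : Fin n, locK K n h t l * (locW n h t l ^ k * ((a ⬝ᵥ x l) * (x l ⬝ᵥ b))) := by
  rw [psiBlock, Matrix.smul_mulVec, Matrix.sum_mulVec, dotProduct_smul, dotProduct_sum,
    smul_eq_mul, Finset.mul_sum]
  refine Finset.sum_congr rfl fun l _ => ?_
  rw [Matrix.smul_mulVec, dotProduct_smul, Matrix.vecMulVec_mulVec, ← scaledKernel_gridPt hn hh,
    gridPt_sub hn hh, mul_div_cancel_left₀ _ hh]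
  simp only [dotProduct_smul, smul_eq_mul, op_smul_eq_smul]
  ring

/-- Connects the assumed restricted eigenvalue condition to the quadratic form of the stacked
regression. -/
lemma dotProduct_psi (hn : n ≠ 0) (hh : h ≠ 0) (x : ℕ → Fin d → ℝ) (t : Fin n)
    (u : Fin d ⊕ Fin d → ℝ) :
    u ⬝ᵥ (psi n K h x (gridPt n t) *ᵥ u)
      = energy (fun l : Fin n => locK K n h t l) (fun l => locF n h x t l) u := by
  have e : ∀ v : Fin d ⊕ Fin d → ℝ,
      u ⬝ᵥ v = (u ∘ Sum.inl) ⬝ᵥ (v ∘ Sum.inl) + (u ∘ Sum.inr) ⬝ᵥ (v ∘ Sum.inr) := fun v => by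
    simp [dotProduct]
  rw [psi, Matrix.fromBlocks_mulVec, e]
  simp only [Sum.elim_comp_inl, Sum.elim_comp_inr, dotProduct_add, dotProduct_psiBlock hn hh]
  rw [energy, ← Finset.sum_add_distrib, ← Finset.sum_add_distrib, ← Finset.sum_add_distrib]
  refine Finset.sum_congr rfl fun l _ => ?_
  have : locF n h x t l ⬝ᵥ u
      = x l ⬝ᵥ (u ∘ Sum.inl) + locW n h t l * (x l ⬝ᵥ (u ∘ Sum.inr)) := by
    simp only [dotProduct, locF, Fintype.sum_sum_type, Sum.elim_inl, Sum.elim_inr, Finset.mul_sum,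
      Function.comp]
    congr 1
    exact Finset.sum_congr rfl fun j _ => by ring
  rw [this, dotProduct_comm (u ∘ Sum.inl), dotProduct_comm (u ∘ Sum.inr)]
  ring

/-- The stacked array `(A, hB)`. -/
def stack (h : ℝ) (AB : Arrays n d) (t : Fin n) : Fin d ⊕ Fin d → ℝ :=
  Sum.elim (AB.1 t) fun j => h * AB.2 t j

/-- The inverse of `stack`. -/
def unstack (h : ℝ) (θ : Fin n → Fin d ⊕ Fin d → ℝ) : Arrays n d :=
  (fun t j => θ t (Sum.inl j), fun t j => θ t (Sum.inr j) / h)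

lemma stack_unstack (hh : h ≠ 0) (θ : Fin n → Fin d ⊕ Fin d → ℝ) : stack h (unstack h θ) = θ := by
  funext t q
  cases q with
  | inl j => rfl
  | inr j => simp [stack, unstack, mul_div_cancel₀ _ hh]

lemma stack_injective (hh : h ≠ 0) : Function.Injective (stack (n := n) (d := d) h) := by
  intro AB AB' e
  have e' := fun t q => congrFun (congrFun e t) q
  refine Prod.ext ?_ ?_
  · funext t j
    exact e' t (Sum.inl j)
  · funext t j
    exact mul_left_cancel₀ hh (e' t (Sum.inr j))

/-- The SCAD weights of the stacked coordinates. -/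
def scadWeight (lam2 : ℝ) (pre : Fin n → Fin d → ℝ) : Fin d ⊕ Fin d → ℝ :=
  Sum.elim (fun j => scadDeriv lam2 (l2 fun t => pre t j))
    fun j => scadDeriv lam2 (devNorm fun t => pre t j)

lemma groupLoss_eq_stackedLoss (hn : n ≠ 0) (hh : h ≠ 0) (lam2 : ℝ) (x : ℕ → Fin d → ℝ)
    (i : Fin d) (pre : Fin n → Fin d → ℝ) (AB : Arrays n d) :
    groupLoss n K h lam2 x i pre AB = stackedLoss (fun t l : Fin n => locK K n h t l)
      (fun t l => locF n h x t l) (fun l => x ((l : ℕ) + 1) i) (scadWeight lam2 pre)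
      (stack h AB) := by
  unfold groupLoss stackedLoss
  simp only [localLoss_eq_wls hn hh, Fintype.sum_sum_type, add_assoc]
  rfl

/-- Only the flat pieces of the SCAD derivative matter: the signal gap keeps all preliminary norms
away from the intermediate range. -/
lemma scadDeriv_of_le {lam z : ℝ} (hz : z ≤ lam) : scadDeriv lam z = lam := by
  simp [scadDeriv, hz, not_lt.2 hz]

lemma scadDeriv_of_ge {lam z : ℝ} (hlam : 0 < lam) (hz : a0 * lam ≤ z) : scadDeriv lam z = 0 := by
  have : lam < z := by
    unfold a0 at hz
    linarith
  simp [scadDeriv, not_le.2 this, max_eq_right (sub_nonpos.2 hz)]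

end Stacked

/-! ### Consequences of a good sample -/

section Deterministic

variable {d : ℕ} {K : ℝ → ℝ} {n : ℕ} {h : ℝ} {A : ℝ → Matrix (Fin d) (Fin d) ℝ}

/-- The stacked coordinates of the oracle model. -/
def activePair (n : ℕ) (A : ℝ → Matrix (Fin d) (Fin d) ℝ) (i : Fin d) :
    Finset (Fin d ⊕ Fin d) :=
  (Set.toFinite (active n A i)).toFinset.disjSum (Set.toFinite (activeDeriv n A i)).toFinset

@[simp] lemma inl_mem_activePair {i j : Fin d} :
    Sum.inl j ∈ activePair n A i ↔ j ∈ active n A i := by simp [activePair]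

@[simp] lemma inr_mem_activePair {i j : Fin d} :
    Sum.inr j ∈ activePair n A i ↔ j ∈ activeDeriv n A i := by simp [activePair]

lemma ncard_active_le (i : Fin d) : (active n A i).ncard ≤ sparsity n A :=
  Finset.le_sup (f := fun i : Fin d => (active n A i).ncard) (Finset.mem_univ i)

lemma card_disjSum_toFinset_le {i : Fin d} {s₁ s₂ : Set (Fin d)} (h₁ : s₁ ⊆ active n A i)
    (h₂ : s₂ ⊆ active n A i) :
    (((Set.toFinite s₁).toFinset.disjSum (Set.toFinite s₂).toFinset).card : ℝ)
      ≤ 2 * sparsity n A := by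
  rw [Finset.card_disjSum, ← Set.ncard_eq_toFinset_card, ← Set.ncard_eq_toFinset_card]
  have e₁ := (Set.ncard_le_ncard h₁).trans (ncard_active_le i)
  have e₂ := (Set.ncard_le_ncard h₂).trans (ncard_active_le i)
  exact_mod_cast (add_le_add e₁ e₂).trans (by omega)

lemma card_activePair_le {i : Fin d} (hsub : activeDeriv n A i ⊆ active n A i) :
    ((activePair n A i).card : ℝ) ≤ 2 * sparsity n A :=
  card_disjSum_toFinset_le subset_rfl hsub

lemma apply_eq_zero_of_notMem {i j : Fin d} (hj : j ∉ active n A i) (t : Fin n) :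
    A (gridPt n t) i j = 0 := by
  by_contra hcon
  exact hj (Set.mem_iUnion.2 ⟨t, hcon⟩)

lemma coefDeriv_eq_zero_of_notMem {i j : Fin d} (hj : j ∉ activeDeriv n A i) (t : Fin n) :
    coefDeriv A i j (gridPt n t) = 0 := by
  by_contra hcon
  exact hj (Set.mem_iUnion.2 ⟨t, hcon⟩)

/-- The local linear target `(α_i(τ_t), h α_i'(τ_t))`. -/
def truth (n : ℕ) (A : ℝ → Matrix (Fin d) (Fin d) ℝ) (h : ℝ) (i : Fin d) (t : Fin n) :
    Fin d ⊕ Fin d → ℝ :=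
  Sum.elim (fun j => A (gridPt n t) i j) fun j => h * coefDeriv A i j (gridPt n t)

lemma truth_eq_zero {i : Fin d} (t : Fin n) {q : Fin d ⊕ Fin d} (hq : q ∉ activePair n A i) :
    truth n A h i t q = 0 := by
  cases q with
  | inl j => exact apply_eq_zero_of_notMem (by simpa using hq) t
  | inr j =>
    simp only [truth, Sum.elim_inr, coefDeriv_eq_zero_of_notMem (n := n) (by simpa using hq) t,
      mul_zero]

/-- The transition functions have second derivatives bounded by `C`. -/
structure SmoothCoef (A : ℝ → Matrix (Fin d) (Fin d) ℝ) (C : ℝ) : Prop where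
  contDiffOn : ∀ i j, ContDiffOn ℝ 2 (fun τ => A τ i j) (Set.Icc 0 1)
  bdd : ∀ i j, ∀ τ ∈ Set.Icc (0 : ℝ) 1,
    |iteratedDerivWithin 2 (fun τ => A τ i j) (Set.Icc 0 1) τ| ≤ C

/-- The observations follow the autoregression with transition function `A` and noise `e`. -/
def Recursion (n : ℕ) (A : ℝ → Matrix (Fin d) (Fin d) ℝ) (x e : ℕ → Fin d → ℝ) : Prop :=
  ∀ (l : Fin n) i, x ((l : ℕ) + 1) i = (A (gridPt n l) *ᵥ x l) i + e l i

variable {x e : ℕ → Fin d → ℝ} {b r δ CA : ℝ}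

/-- At the local linear target the residual is noise plus a Taylor remainder. Only active
coordinates contribute, each of order `h² b` inside the window; the inclusion of the derivative
support removes the others completely. -/
lemma Recursion.abs_residual_sub_le (hrec : Recursion n A x e) (hn : n ≠ 0) (hh : h ≠ 0)
    (hK : KernelCond K) (hA : SmoothCoef A CA) {i : Fin d}
    (hsub : activeDeriv n A i ⊆ active n A i) (t l : Fin n) (hx : ∀ j, |x l j| ≤ b)
    (hl : locK K n h t l ≠ 0) :
    |x ((l : ℕ) + 1) i - locF n h x t l ⬝ᵥ truth n A h i t - e l i|
      ≤ sparsity n A * (CA * h ^ 2 * b) := by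
  have hw := abs_locW_le_one hK hl
  have e1 : x ((l : ℕ) + 1) i - locF n h x t l ⬝ᵥ truth n A h i t - e l i
      = ∑ j, (A (gridPt n l) i j - A (gridPt n t) i j
        - (gridPt n l - gridPt n t) * coefDeriv A i j (gridPt n t)) * x l j := by
    rw [hrec l i, locF_dotProduct, add_sub_right_comm, add_sub_cancel_right, Matrix.mulVec,
      ← sub_dotProduct]
    refine Finset.sum_congr rfl fun j _ => ?_
    simp only [Pi.sub_apply, comb_apply, truth, Sum.elim_inl, Sum.elim_inr, gridPt_sub hn hh]
    ring
  have e2 : ∀ j, j ∉ (Set.toFinite (active n A i)).toFinset → (A (gridPt n l) i j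
      - A (gridPt n t) i j - (gridPt n l - gridPt n t) * coefDeriv A i j (gridPt n t)) * x l j
      = 0 := by
    intro j hj
    rw [Set.Finite.mem_toFinset] at hj
    rw [apply_eq_zero_of_notMem hj, apply_eq_zero_of_notMem hj,
      coefDeriv_eq_zero_of_notMem fun h' => hj (hsub h')]
    ring
  have hCA : 0 ≤ CA := (abs_nonneg _).trans (hA.bdd i i 0 (by norm_num))
  have hb : 0 ≤ b := (abs_nonneg _).trans (hx i)
  rw [e1, ← Finset.sum_subset (Finset.subset_univ _) fun j _ hj => e2 j hj]
  refine (Finset.abs_sum_le_sum_abs _ _).trans ?_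
  calc _ ≤ ∑ _j ∈ (Set.toFinite (active n A i)).toFinset, CA * h ^ 2 * b := by
        refine Finset.sum_le_sum fun j _ => ?_
        rw [abs_mul]
        refine mul_le_mul ?_ (hx j) (abs_nonneg _) (by positivity)
        refine (abs_taylor_le (hA.contDiffOn i j) (hA.bdd i j) (gridPt_mem t)
          (gridPt_mem l)).trans ?_
        refine mul_le_mul_of_nonneg_left ?_ hCA
        rw [gridPt_sub hn hh, mul_pow]
        refine mul_le_of_le_one_right (sq_nonneg _) ?_
        rw [← sq_abs]
        exact pow_le_one₀ (abs_nonneg _) hw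
    _ = ((Set.toFinite (active n A i)).toFinset.card : ℝ) * (CA * h ^ 2 * b) := by
        rw [Finset.sum_const, nsmul_eq_mul]
    _ ≤ _ := by
        rw [← Set.ncard_eq_toFinset_card]
        gcongr
        exact ncard_active_le i

lemma Recursion.abs_weighted_residual_le (hrec : Recursion n A x e) (hn : n ≠ 0) (hh : 0 < h)
    (hK : KernelCond K) (hA : SmoothCoef A CA) {i : Fin d}
    (hsub : activeDeriv n A i ⊆ active n A i) (hx : ∀ l < n, ∀ j, |x l j| ≤ b) (t : Fin n)
    {a : ℕ → ℝ} {w : ℝ} (hnoise : |∑ l ∈ Finset.range n, locK K n h t l * (a l * e l i)| ≤ r)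
    (ha : ∑ l ∈ Finset.range n, locK K n h t l * |a l| ≤ w) :
    |∑ l : Fin n, locK K n h t l *
        (a l * (x ((l : ℕ) + 1) i - locF n h x t l ⬝ᵥ truth n A h i t))|
      ≤ r + w * (sparsity n A * (CA * h ^ 2 * b)) := by
  have hCA : 0 ≤ CA := (abs_nonneg _).trans (hA.bdd i i 0 (by norm_num))
  have hb : 0 ≤ b := (abs_nonneg _).trans (hx 0 (Nat.pos_of_ne_zero hn) i)
  have e1 : ∑ l : Fin n, locK K n h t l *
        (a l * (x ((l : ℕ) + 1) i - locF n h x t l ⬝ᵥ truth n A h i t))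
      = ∑ l ∈ Finset.range n, locK K n h t l * (a l * e l i) + ∑ l : Fin n, locK K n h t l *
        (a l * (x ((l : ℕ) + 1) i - locF n h x t l ⬝ᵥ truth n A h i t - e l i)) := by
    rw [← Fin.sum_univ_eq_sum_range (fun l => locK K n h t l * (a l * e l i)),
      ← Finset.sum_add_distrib]
    exact Finset.sum_congr rfl fun l _ => by ring
  rw [e1]
  refine (abs_add_le _ _).trans (add_le_add hnoise ?_)
  refine (Finset.abs_sum_le_sum_abs _ _).trans ?_
  calc _ ≤ ∑ l : Fin n, locK K n h t l * |a l| * (sparsity n A * (CA * h ^ 2 * b)) := by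
        refine Finset.sum_le_sum fun l _ => ?_
        by_cases h0 : locK K n h t l = 0
        · simp [h0]
        rw [abs_mul, abs_mul, abs_of_nonneg (locK_nonneg hK hh t l), ← mul_assoc]
        refine mul_le_mul_of_nonneg_left ?_
          (mul_nonneg (locK_nonneg hK hh t l) (abs_nonneg _))
        exact hrec.abs_residual_sub_le hn hh.ne' hK hA hsub t l (hx l l.2) h0
    _ = (∑ l ∈ Finset.range n, locK K n h t l * |a l|)
          * (sparsity n A * (CA * h ^ 2 * b)) := by
        rw [← Finset.sum_mul, Fin.sum_univ_eq_sum_range (fun l => locK K n h t l * |a l|)]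
    _ ≤ _ := by gcongr

lemma abs_locF_le {t l : ℕ} (hw : |locW n h t l| ≤ 1) (hx : ∀ j, |x l j| ≤ b)
    (q : Fin d ⊕ Fin d) : |locF n h x t l q| ≤ b := by
  rw [locF_apply, abs_mul]
  calc _ ≤ 1 * b := mul_le_mul (abs_locC_le hw q) (hx _) (abs_nonneg _) zero_le_one
    _ = b := one_mul b

/-- The LASSO error of the preliminary estimates. -/
lemma lasso_error (hn : n ≠ 0) (hh : 0 < h) (hK : KernelCond K) {lam1 κ₀ : ℝ} (hκ₀ : 0 < κ₀)
    (hlam1 : 0 < lam1) {i : Fin d} (hsub : activeDeriv n A i ⊆ active n A i) {t : Fin n}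
    (hscore : ∀ q, |score (fun l : Fin n => locK K n h t l) (fun l => locF n h x t l)
      (fun l => x ((l : ℕ) + 1) i) (truth n A h i t) q| ≤ lam1 / 6)
    (hRE : ∀ u ∈ cone A i (gridPt n t), κ₀ ≤ u ⬝ᵥ (psi n K h x (gridPt n t) *ᵥ u))
    {α β : Fin d → ℝ}
    (hmin : IsMinOn (lassoLoss n K h lam1 x i (gridPt n t)) Set.univ (α, β)) (j : Fin d) :
    |α j - A (gridPt n t) i j| ≤ √(32 / 9 * sparsity n A) * lam1 / κ₀ := by
  -- The support at the single time `t` is used rather than the union over times, because the cone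
  -- condition is stated pointwise.
  set S₁ := (Set.toFinite (activeAt A i (gridPt n t))).toFinset with hS₁
  set S₂ := (Set.toFinite (activeDerivAt A i (gridPt n t))).toFinset with hS₂
  have hloss : ∀ ab : (Fin d → ℝ) × (Fin d → ℝ), lassoLoss n K h lam1 x i (gridPt n t) ab
      = wls (fun l : Fin n => locK K n h t l) (fun l => locF n h x t l)
          (fun l => x ((l : ℕ) + 1) i) (Sum.elim ab.1 fun j => h * ab.2 j)
        + lam1 * ∑ q, |(Sum.elim ab.1 fun j => h * ab.2 j : Fin d ⊕ Fin d → ℝ) q| := by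
    intro ab
    rw [lassoLoss, localLoss_eq_wls hn hh.ne', Fintype.sum_sum_type]
    simp only [Sum.elim_inl, Sum.elim_inr, abs_mul, abs_of_pos hh, Finset.mul_sum]
  have h1 := lasso_l2_error (κ := fun l : Fin n => locK K n h t l)
    (fun l => locK_nonneg hK hh t l) (f := fun l => locF n h x t l)
    (y := fun l => x ((l : ℕ) + 1) i) (θ := truth n A h i t)
    (θh := Sum.elim α fun j => h * β j) hκ₀ hlam1 (S₁.disjSum S₂) ?_ ?_ hscore ?_
  · have h2 : (α j - A (gridPt n t) i j) ^ 2 ≤ (√(32 / 9 * sparsity n A) * lam1 / κ₀) ^ 2 := by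
      have h3 := Finset.single_le_sum (f := fun q => ((Sum.elim α fun j => h * β j :
        Fin d ⊕ Fin d → ℝ) q - truth n A h i t q) ^ 2) (fun q _ => sq_nonneg _)
        (Finset.mem_univ (Sum.inl j))
      refine h3.trans (h1.trans ?_)
      rw [div_pow, mul_pow, Real.sq_sqrt (by positivity)]
      have h4 : ((S₁.disjSum S₂).card : ℝ) ≤ 2 * sparsity n A :=
        card_disjSum_toFinset_le (Set.subset_iUnion (fun t => activeAt A i (gridPt n t)) t)
          ((Set.subset_iUnion (fun t => activeDerivAt A i (gridPt n t)) t).trans hsub)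
      refine div_le_div_of_nonneg_right ?_ (sq_nonneg _)
      have := mul_le_mul_of_nonneg_left h4 (show 0 ≤ 16 / 9 * lam1 ^ 2 by positivity)
      linarith
    exact abs_le_of_sq_le_sq h2 (by positivity)
  · intro q hq
    cases q with
    | inl j => simpa [hS₁, activeAt, truth] using hq
    | inr j =>
      have : coefDeriv A i j (gridPt n t) = 0 := by simpa [hS₂, activeDerivAt] using hq
      simp [truth, this]
  · have h2 := hmin (Set.mem_univ ((fun j => A (gridPt n t) i j),
      fun j => coefDeriv A i j (gridPt n t)))
    simp only [Set.mem_ofPred_eq, hloss] at h2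
    exact h2
  · intro u hu hc
    rw [← dotProduct_psi hn hh.ne']
    refine hRE u ⟨?_, ?_⟩
    · rw [← hu, Fintype.sum_sum_type]
    · rw [Finset.sum_add_distrib, ← Fintype.sum_sum_type (fun q => |u q|)]
      refine hc.trans (le_of_eq ?_)
      rw [Finset.sum_disjSum]
      congr 2
      · rw [← Finset.sum_subset (Finset.subset_univ S₁)]
        · exact Finset.sum_congr rfl fun j hj => by
            rw [Set.indicator_of_mem ((Set.Finite.mem_toFinset _).1 hj)]
        · exact fun j _ hj => Set.indicator_of_notMem
            (fun h' => hj ((Set.Finite.mem_toFinset _).2 h')) _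
      · rw [← Finset.sum_subset (Finset.subset_univ S₂)]
        · exact Finset.sum_congr rfl fun j hj => by
            rw [Set.indicator_of_mem ((Set.Finite.mem_toFinset _).1 hj)]
        · exact fun j _ hj => Set.indicator_of_notMem
            (fun h' => hj ((Set.Finite.mem_toFinset _).2 h')) _

/-- A coefficient whose derivative vanishes on the grid hardly varies. -/
lemma devNorm_le_of_notMem (hn : n ≠ 0) (hA : SmoothCoef A CA) {i j : Fin d}
    (hj : j ∉ activeDeriv n A i) : devNorm (fun t : Fin n => A (gridPt n t) i j) ≤ CA := by
  have hCA : 0 ≤ CA := (abs_nonneg _).trans (hA.bdd i i 0 (by norm_num))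
  have hn0 : 0 < n := Nat.pos_of_ne_zero hn
  have hn1 : (1 : ℝ) ≤ n := by exact_mod_cast hn0
  -- The derivative vanishes at every grid point, so consecutive values differ by at most `CA / n²`.
  -- After at most `n` steps the drift is `CA / n`, and the Euclidean norm over the grid multiplies
  -- it by `√n`.
  have hstep : ∀ k (hk : k < n),
      |A (gridPt n ⟨k, hk⟩) i j - A (gridPt n ⟨0, hn0⟩) i j| ≤ k * (CA / n ^ 2) := by
    intro k
    induction k with
    | zero => simp
    | succ k ih =>
      intro hk
      have hk' : k < n := by omega
      have h1 := ih hk'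
      have h2 := abs_taylor_le (hA.contDiffOn i j) (hA.bdd i j) (gridPt_mem ⟨k, hk'⟩)
        (gridPt_mem ⟨k + 1, hk⟩)
      have h3 : derivWithin (fun τ => A τ i j) (Set.Icc 0 1) (gridPt n ⟨k, hk'⟩) = 0 :=
        coefDeriv_eq_zero_of_notMem hj _
      have h4 : gridPt n ⟨k + 1, hk⟩ - gridPt n ⟨k, hk'⟩ = 1 / n := by
        simp only [gridPt]
        push_cast
        ring
      rw [h3, mul_zero, sub_zero, h4, one_div, inv_pow, ← div_eq_mul_inv] at h2
      have h5 := (abs_sub_le _ (A (gridPt n ⟨k, hk'⟩) i j) _).trans (add_le_add h2 h1)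
      refine h5.trans (le_of_eq ?_)
      push_cast
      ring
  refine (devNorm_le_l2_sub _ (A (gridPt n ⟨0, hn0⟩) i j)).trans
    ((l2_le_of_abs_le (c := CA / n) (by positivity) fun t => (hstep t t.2).trans ?_).trans ?_)
  · have : ((t : ℕ) : ℝ) ≤ n := by exact_mod_cast t.2.le
    calc _ ≤ n * (CA / n ^ 2) := by gcongr
      _ = CA / n := by field_simp
  · rw [mul_div_assoc', div_le_iff₀ (by positivity), mul_comm]
    refine mul_le_mul_of_nonneg_left (Real.sqrt_le_iff.2 ⟨by positivity, ?_⟩) hCA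
    nlinarith

/-- The stacked sup-norm bound on the score at the truth. -/
def scoreBound (n : ℕ) (A : ℝ → Matrix (Fin d) (Fin d) ℝ) (h CA k₁ b r : ℝ) : ℝ :=
  r + (k₁ + 1) * b * (sparsity n A * (CA * h ^ 2 * b))

/-- The three smallness conditions serve different ends: `hz₁` feeds the LASSO inequality, `hpre₂`
with `hCA₂` separates the SCAD weights, and `hkkt` is the dual condition off the oracle model. The
candidate is the restricted least squares fit at each time, whose strict optimality replaces any
compactness argument for existence. -/
theorem GoodSample.oracle {k₁ κ₀ lam1 lam2 : ℝ} (hn : n ≠ 0) (hh : 0 < h) (hK : KernelCond K)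
    (hA : SmoothCoef A CA) (hk₁ : ∀ t, ∑ l ∈ Finset.range n, locK K n h t l ≤ k₁)
    (hsub : ∀ i, activeDeriv n A i ⊆ active n A i) (hrec : Recursion n A x e)
    (G : GoodSample K n h x e (activePair n A) b r δ) (hr : 0 ≤ r)
    (hδ : 2 * sparsity n A * δ ≤ 1 / 2) (hδ0 : 0 ≤ δ)
    (hκ₀ : 0 < κ₀) (hlam1 : 0 < lam1) (hlam2 : 0 < lam2)
    (hRE : ∀ i (t : Fin n), ∀ u ∈ cone A i (gridPt n t),
      κ₀ ≤ u ⬝ᵥ (psi n K h x (gridPt n t) *ᵥ u))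
    (hz₁ : scoreBound n A h CA k₁ b r ≤ lam1 / 6)
    (hpre₂ : √n * (√(32 / 9 * sparsity n A) * lam1 / κ₀) ≤ lam2 / 2) (hCA₂ : CA ≤ lam2 / 2)
    (hkkt : √n * (scoreBound n A h CA k₁ b r
      + k₁ * (b * (2 * sparsity n A * (b * (2 * scoreBound n A h CA k₁ b r))))) ≤ lam2 / 4)
    (hsig : ∀ i, ∀ j ∈ active n A i,
      (a0 + 1) * lam2 ≤ l2 fun t : Fin n => A (gridPt n t) i j)
    (hsigd : ∀ i, ∀ j ∈ activeDeriv n A i,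
      (a0 + 1) * lam2 ≤ devNorm fun t : Fin n => A (gridPt n t) i j)
    (i : Fin d) {preA preB : Fin n → Fin d → ℝ}
    (hpre : ∀ t, IsMinOn (lassoLoss n K h lam1 x i (gridPt n t)) Set.univ (preA t, preB t)) :
    ∃ AB₀ ∈ oracleSet n A i,
      (∀ AB, AB ≠ AB₀ →
        groupLoss n K h lam2 x i preA AB₀ < groupLoss n K h lam2 x i preA AB) ∧
      avgSqError n A i AB₀.1 ≤ sparsity n A * (2 * scoreBound n A h CA k₁ b r) ^ 2 := by
  set z := scoreBound n A h CA k₁ b r with hz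
  set S := activePair n A i with hS
  have hn0 : 0 < n := Nat.pos_of_ne_zero hn
  have hcard : (S.card : ℝ) ≤ 2 * sparsity n A := card_activePair_le (hsub i)
  have hCA : 0 ≤ CA := (abs_nonneg _).trans (hA.bdd i i 0 (by norm_num))
  have hb : 0 ≤ b := (abs_nonneg _).trans (G.bdd 0 hn0 i)
  have hκ := fun t l => locK_nonneg (n := n) hK hh t l
  have hk₁0 : 0 ≤ k₁ := (Finset.sum_nonneg fun l _ => hκ 0 l).trans (hk₁ 0)
  have hbias : 0 ≤ sparsity n A * (CA * h ^ 2 * b) := by positivity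
  have hz0 : 0 ≤ z := by rw [hz, scoreBound]; positivity
  have hFb : ∀ (t l : Fin n), locK K n h t l ≠ 0 → ∀ q, |locF n h x t l q| ≤ b :=
    fun t l h0 q => abs_locF_le (abs_locW_le_one hK h0) (G.bdd l l.2) q
  have hκF : ∀ (t : Fin n) q, ∑ l : Fin n, locK K n h t l * |locF n h x t l q| ≤ k₁ * b := by
    intro t q
    calc _ ≤ ∑ l : Fin n, locK K n h t l * b := by
          refine Finset.sum_le_sum fun l _ => ?_
          by_cases h0 : locK K n h t l = 0
          · simp [h0]
          · exact mul_le_mul_of_nonneg_left (hFb t l h0 q) (hκ t l)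
      _ = (∑ l ∈ Finset.range n, locK K n h t l) * b := by
          rw [← Finset.sum_mul, Fin.sum_univ_eq_sum_range (fun l => locK K n h t l)]
      _ ≤ _ := by gcongr; exact hk₁ t
  -- the score at the truth
  have hscore : ∀ (t : Fin n) q, |score (fun l : Fin n => locK K n h t l)
      (fun l => locF n h x t l) (fun l => x ((l : ℕ) + 1) i) (truth n A h i t) q| ≤ z := by
    intro t q
    refine (hrec.abs_weighted_residual_le hn hh hK hA (hsub i) G.bdd t (w := k₁ * b)
      (a := fun l => locF n h x t l q) (G.noise i t t.2 q) ?_).trans ?_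
    · rw [← Fin.sum_univ_eq_sum_range (fun l => locK K n h t l * |locF n h x t l q|)]
      exact hκF t q
    · rw [hz, scoreBound]
      -- The bias is weighted by `k₁ * b` for a single regressor and by `b` for a dual combination.
      -- The factor `k₁ + 1` in `scoreBound` covers both.
      have : 0 ≤ b * (sparsity n A * (CA * h ^ 2 * b)) := by positivity
      linarith
  -- the oracle estimate
  have horacle : ∀ t : Fin n, ∃ θh : Fin d ⊕ Fin d → ℝ, (∀ q, q ∉ S → θh q = 0) ∧
      (∀ q ∈ S, score (fun l : Fin n => locK K n h t l) (fun l => locF n h x t l)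
        (fun l => x ((l : ℕ) + 1) i) θh q = 0) ∧
      (∀ q ∈ S, |θh q - truth n A h i t q| ≤ 2 * z) ∧
      ∀ u : Fin d ⊕ Fin d → ℝ, (∀ q, q ∉ S → u q = 0) →
        energy (fun l : Fin n => locK K n h t l) (fun l => locF n h x t l) u = 0 → u = 0 := by
    intro t
    obtain ⟨g, hg⟩ := G.dual i t t.2
    have hδ' : S.card * δ ≤ 1 / 2 := (mul_le_mul_of_nonneg_right hcard hδ0).trans hδ
    have hgram : ∀ q ∈ S, ∀ q' ∈ S, |gram (fun l : Fin n => locK K n h t l)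
        (fun l => locF n h x t l) (g q) q' - if q = q' then 1 else 0| ≤ δ := by
      intro q hq q' hq'
      have := (hg q hq).2.2.2 q' hq'
      rwa [← Fin.sum_univ_eq_sum_range (fun l =>
        locK K n h t l * (locF n h x t l q' * (locF n h x t l ⬝ᵥ g q)))] at this
    obtain ⟨θh, h1, h2, h3⟩ := exists_restricted_lsq (y := fun l : Fin n => x ((l : ℕ) + 1) i)
      hδ' (fun q hq => (hg q hq).1) hgram (θ := truth n A h i t)
      (fun q hq => truth_eq_zero t hq) (z := z) fun q hq => by
        rw [sum_mul_score]
        refine (hrec.abs_weighted_residual_le hn hh hK hA (hsub i) G.bdd t (w := b)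
          (a := fun l => locF n h x t l ⬝ᵥ g q) (hg q hq).2.1 (hg q hq).2.2.1).trans ?_
        rw [hz, scoreBound]
        have : 0 ≤ k₁ * b * (sparsity n A * (CA * h ^ 2 * b)) := by positivity
        linarith
    exact ⟨θh, h1, h2, h3, fun u hu h0 =>
      eq_zero_of_energy_eq_zero (fun l : Fin n => hκ t l) hδ' hgram hu h0⟩
  choose θh hsupp hzero herr hinj using horacle
  have herr' : ∀ t q, |θh t q - truth n A h i t q| ≤ 2 * z := by
    intro t q
    by_cases hq : q ∈ S
    · exact herr t q hq
    · rw [hsupp t q hq, truth_eq_zero t hq]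
      simp [hz0]
  -- the preliminary estimates
  have hlasso : ∀ j, l2 (fun t => preA t j - A (gridPt n t) i j) ≤ lam2 / 2 := fun j =>
    (l2_le_of_abs_le (by positivity) fun t => lasso_error hn hh hK hκ₀ hlam1 (hsub i)
      (fun q => (hscore t q).trans hz₁) (hRE i t) (hpre t) j).trans hpre₂
  -- A signal of `(a0 + 1) * lam2` less an error of `lam2 / 2` still exceeds `a0 * lam2`, where the
  -- SCAD derivative is zero.
  have hw0 : ∀ q ∈ S, scadWeight lam2 preA q = 0 := by
    intro q hq
    cases q with
    | inl j =>
      refine scadDeriv_of_ge hlam2 ?_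
      have h1 := hsig i j (by simpa [hS] using hq)
      have h2 := (abs_le.1 ((abs_l2_sub_l2_le (fun t => preA t j)
        (fun t => A (gridPt n t) i j)).trans (hlasso j))).1
      linarith
    | inr j =>
      refine scadDeriv_of_ge hlam2 ?_
      have h1 := hsigd i j (by simpa [hS] using hq)
      have h2 := (abs_le.1 ((abs_devNorm_sub_devNorm_le (fun t => preA t j)
        (fun t => A (gridPt n t) i j)).trans (hlasso j))).1
      linarith
  -- An inactive level has norm at most `lam2 / 2`. An inactive slope may add the residual drift `CA
  -- ≤ lam2 / 2`, which still reaches at most `lam2`.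
  have hw1 : ∀ q, q ∉ S → scadWeight lam2 preA q = lam2 := by
    intro q hq
    cases q with
    | inl j =>
      refine scadDeriv_of_le ?_
      have h1 : ∀ t, A (gridPt n t) i j = 0 := apply_eq_zero_of_notMem (by simpa [hS] using hq)
      have h2 := hlasso j
      simp only [h1, sub_zero] at h2
      linarith
    | inr j =>
      refine scadDeriv_of_le ?_
      have h1 := devNorm_le_of_notMem hn hA (i := i) (j := j) (by simpa [hS] using hq)
      have h2 := (abs_le.1 ((abs_devNorm_sub_devNorm_le (fun t => preA t j)
        (fun t => A (gridPt n t) i j)).trans (hlasso j))).2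
      linarith
  -- optimality off the oracle model
  have hgramu : ∀ (t : Fin n) q, |gram (fun l : Fin n => locK K n h t l) (fun l => locF n h x t l)
      (θh t - truth n A h i t) q| ≤ k₁ * (b * (2 * sparsity n A * (b * (2 * z)))) := by
    intro t q
    have hdot : ∀ l : Fin n, locK K n h t l ≠ 0 →
        |locF n h x t l ⬝ᵥ (θh t - truth n A h i t)| ≤ 2 * sparsity n A * (b * (2 * z)) := by
      intro l h0
      rw [dotProduct, ← Finset.sum_subset (Finset.subset_univ S) fun q _ hq => by
        simp [hsupp t q hq, truth_eq_zero t hq]]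
      refine (Finset.abs_sum_le_sum_abs _ _).trans ?_
      calc _ ≤ ∑ _q ∈ S, b * (2 * z) := Finset.sum_le_sum fun q _ => by
            rw [abs_mul]
            exact mul_le_mul (hFb t l h0 q) (herr' t q) (abs_nonneg _) hb
        _ = S.card * (b * (2 * z)) := by rw [Finset.sum_const, nsmul_eq_mul]
        _ ≤ _ := by gcongr
    refine (Finset.abs_sum_le_sum_abs _ _).trans ?_
    calc _ ≤ ∑ l : Fin n, locK K n h t l * |locF n h x t l q|
          * (2 * sparsity n A * (b * (2 * z))) := by
          refine Finset.sum_le_sum fun l _ => ?_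
          by_cases h0 : locK K n h t l = 0
          · simp [h0]
          rw [abs_mul, abs_mul, abs_of_nonneg (hκ t l), ← mul_assoc]
          exact mul_le_mul_of_nonneg_left (hdot l h0) (mul_nonneg (hκ t l) (abs_nonneg _))
      _ ≤ k₁ * b * (2 * sparsity n A * (b * (2 * z))) := by
          rw [← Finset.sum_mul]
          exact mul_le_mul_of_nonneg_right (hκF t q) (by positivity)
      _ = _ := by ring
  have hkkt' : ∀ q, q ∉ S → l2 (fun t => score (fun l : Fin n => locK K n h t l)
      (fun l => locF n h x t l) (fun l => x ((l : ℕ) + 1) i) (θh t) q) ≤ lam2 / 4 := by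
    intro q _
    refine (l2_le_of_abs_le (by positivity) fun t => ?_).trans hkkt
    -- The score at the fit is the score at the truth minus the Gram image of the error, and the
    -- latter costs one factor `s` because the error has at most `2 s` nonzero coordinates.
    have e1 : θh t = truth n A h i t + (θh t - truth n A h i t) := by simp
    rw [e1, score_add]
    exact (abs_sub _ _).trans (add_le_add (hscore t q) (hgramu t q))
  have hst := stack_unstack hh.ne' θh
  refine ⟨unstack h θh, ⟨fun t j hj => hsupp t _ (by simpa [hS] using hj), fun t j hj => ?_⟩,
    fun AB hAB => ?_, ?_⟩
  · change θh t (Sum.inr j) / h = 0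
    rw [hsupp t _ (by simpa [hS] using hj), zero_div]
  · rw [groupLoss_eq_stackedLoss hn hh.ne', groupLoss_eq_stackedLoss hn hh.ne', hst]
    refine stackedLoss_strict_min (fun t l : Fin n => hκ t l) hlam2 hw0 hw1 hsupp hzero hkkt'
      hinj _ ?_
    intro hcon
    rw [← hst] at hcon
    exact hAB (stack_injective hh.ne' hcon)
  · have hsum : ∀ t : Fin n, ∑ j, ((unstack h θh).1 t j - A (gridPt n t) i j) ^ 2
        ≤ sparsity n A * (2 * z) ^ 2 := by
      intro t
      rw [← Finset.sum_subset (Finset.subset_univ (Set.toFinite (active n A i)).toFinset)]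
      · calc _ ≤ ∑ _j ∈ (Set.toFinite (active n A i)).toFinset, (2 * z) ^ 2 := by
              refine Finset.sum_le_sum fun j _ => ?_
              rw [← sq_abs]
              exact pow_le_pow_left₀ (abs_nonneg _) (herr' t (Sum.inl j)) 2
          _ = ((Set.toFinite (active n A i)).toFinset.card : ℝ) * (2 * z) ^ 2 := by
              rw [Finset.sum_const, nsmul_eq_mul]
          _ ≤ _ := by
              rw [← Set.ncard_eq_toFinset_card]
              gcongr
              exact ncard_active_le i
      · intro j _ hj
        rw [Set.Finite.mem_toFinset] at hj
        have e1 : (unstack h θh).1 t j = 0 := hsupp t (Sum.inl j) (by simpa [hS] using hj)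
        rw [e1, apply_eq_zero_of_notMem hj]
        norm_num
    rw [avgSqError]
    calc _ ≤ 1 / (n : ℝ) * ∑ _t : Fin n, sparsity n A * (2 * z) ^ 2 := by
          gcongr with t _
          exact hsum t
      _ = _ := by
          rw [Finset.sum_const, Finset.card_univ, Fintype.card_fin, nsmul_eq_mul]
          field_simp

end Deterministic

/-! ### Calculus of events with probability approaching one. -/

section Wpa1

variable {Ω : ℕ → Type*} [∀ n, MeasurableSpace (Ω n)] {P : ∀ n, Measure (Ω n)}
  {E F : ∀ n, Ω n → Prop}

lemma Wpa1.and (hE : Wpa1 P E) (hF : Wpa1 P F) : Wpa1 P fun n ω => E n ω ∧ F n ω := by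
  have h := hE.add hF
  rw [add_zero] at h
  exact tendsto_of_tendsto_of_tendsto_of_le_of_le tendsto_const_nhds h (fun _ => zero_le)
    fun n => measure_not_and_le le_rfl le_rfl

lemma Wpa1.mono (hE : Wpa1 P E) (h : ∀ᶠ n in atTop, ∀ ω, E n ω → F n ω) : Wpa1 P F :=
  tendsto_of_tendsto_of_tendsto_of_le_of_le' tendsto_const_nhds hE
    (Eventually.of_forall fun _ => zero_le)
    (h.mono fun _ hn => measure_mono fun ω hω hE' => hω (hn ω hE'))

lemma Wpa1.of_ae (h : ∀ n, ∀ᵐ ω ∂(P n), E n ω) : Wpa1 P E := by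
  unfold Wpa1
  simp only [fun n => ae_iff.1 (h n)]
  exact tendsto_const_nhds

/-- A bound on events with probability approaching one permits the same constant at every level `ε`.
-/
lemma Wpa1.isBigOP (hE : Wpa1 P E) {Z : ∀ n, Ω n → ℝ} {r : ℕ → ℝ} {C : ℝ} (hC : 0 < C)
    (h : ∀ᶠ n in atTop, ∀ ω, E n ω → |Z n ω| ≤ C * r n) : IsBigOP P Z r := by
  intro ε hε
  refine ⟨C, hC, ?_⟩
  filter_upwards [h, hE.eventually_le_const (ENNReal.ofReal_pos.2 hε)] with n hn hle
  exact (measure_mono fun ω hω hE' => (not_lt.2 (hn ω hE')) hω).trans hle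

end Wpa1

/-! ### Consequences of the rate and signal conditions. -/

section Rates

variable {d : ℕ → ℕ} {Ω : ℕ → Type*} [∀ n, MeasurableSpace (Ω n)] {P : ∀ n, Measure (Ω n)}
  {M : Model d Ω P} {h lam1 lam2 : ℕ → ℝ} {K : ℝ → ℝ}

lemma tendsto_logDim (d : ℕ → ℕ) : Tendsto (logDim d) atTop atTop := by
  refine tendsto_atTop_mono' _ ?_ (Real.tendsto_log_atTop.comp tendsto_natCast_atTop_atTop)
  filter_upwards [eventually_gt_atTop 0] with n hn
  refine Real.log_le_log (by exact_mod_cast hn) ?_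
  exact_mod_cast le_max_left n (d n)

lemma sparsity_le (n : ℕ) {d : ℕ} (A : ℝ → Matrix (Fin d) (Fin d) ℝ) : sparsity n A ≤ d := by
  refine Finset.sup_le fun i _ => ?_
  have := Set.ncard_le_ncard (Set.subset_univ (active n A i))
  simpa using this

lemma exists_mem_active {n d : ℕ} {A : ℝ → Matrix (Fin d) (Fin d) ℝ} (hs : 1 ≤ sparsity n A) :
    ∃ i j, j ∈ active n A i := by
  by_contra hcon
  push Not at hcon
  have : sparsity n A ≤ 0 := Finset.sup_le fun i _ => by
    rw [Set.eq_empty_iff_forall_notMem.2 (hcon i), Set.ncard_empty]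
  omega

/-- Once `s ≥ 1` and `log (n ∨ d) ≥ 1`, the quantity `s h² log (n ∨ d)` dominates `h²`. -/
lemma BandwidthCond.tendsto_zero (hh : BandwidthCond M h)
    (hs : ∀ᶠ n in atTop, 1 ≤ sparsity n (M.A n)) : Tendsto h atTop (𝓝 0) := by
  have h1 : Tendsto (fun n => h n ^ 2) atTop (𝓝 0) := by
    refine tendsto_of_tendsto_of_tendsto_of_le_of_le' tendsto_const_nhds hh.small
      (Eventually.of_forall fun n => sq_nonneg _) ?_
    filter_upwards [hs, (tendsto_logDim d).eventually_ge_atTop 1] with n hs hL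
    have hs' : (1 : ℝ) ≤ sparsity n (M.A n) := by exact_mod_cast hs
    calc h n ^ 2 = 1 * h n ^ 2 * 1 := by ring
      _ ≤ _ := by gcongr
  have h2 := h1.sqrt
  simpa only [Real.sqrt_zero, fun n => Real.sqrt_sq (hh.pos n).le] using h2

lemma BandwidthCond.tendsto_atTop (hh : BandwidthCond M h) :
    Tendsto (fun n : ℕ => n * h n) atTop atTop := by
  refine tendsto_atTop_mono' _ ?_ hh.effective_size
  filter_upwards [(tendsto_logDim d).eventually_ge_atTop 1] with n hL
  have := (hh.pos n).le
  exact div_le_self (by positivity) (one_le_pow₀ hL)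

lemma RegularModel.exists_abs_le (hM : RegularModel M) : ∃ C : ℝ, 0 < C ∧
    (∀ n, SmoothCoef (M.A n) C) ∧ ∀ n i j, ∀ τ ∈ Set.Icc (0 : ℝ) 1, |M.A n τ i j| ≤ C := by
  obtain ⟨C, hC⟩ := hM.A_smooth.2
  refine ⟨max C 1, by positivity, fun n => ⟨hM.A_smooth.1 n, fun i j τ hτ =>
    (hC n i j 2 le_rfl τ hτ).trans (le_max_left _ _)⟩, fun n i j τ hτ => ?_⟩
  have := hC n i j 0 (by norm_num) τ hτ
  rw [iteratedDerivWithin_zero] at this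
  exact this.trans (le_max_left _ _)

/-- Since `s ≥ 1`, some coefficient is active. Its entries are bounded, so its norm over the grid is
at most `C √n`, while the signal condition makes it at least `lam2`. -/
lemma ScadCond.lam2_le (hlam2 : ScadCond M h lam1 lam2) (hM : RegularModel M)
    (hs : ∀ᶠ n in atTop, 1 ≤ sparsity n (M.A n)) :
    ∃ C : ℝ, 0 < C ∧ ∀ᶠ n : ℕ in atTop, lam2 n ≤ C * √n := by
  obtain ⟨C, hC, -, hA⟩ := hM.exists_abs_le
  refine ⟨C, hC, ?_⟩
  filter_upwards [hs, hlam2.signal] with n hs hsig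
  obtain ⟨i, j, hj⟩ := exists_mem_active hs
  have h1 := (hsig i j hj).trans (l2_le_of_abs_le hC.le fun t => hA n i j _ (gridPt_mem t))
  have h2 : lam2 n ≤ (a0 + 1) * lam2 n := by
    unfold a0
    linarith [hlam2.pos n]
  linarith

/-- A coefficient that vanishes at all grid points has zero deviation norm, so the signal condition
forbids it from having an active derivative. -/
lemma ScadCond.activeDeriv_subset (hlam2 : ScadCond M h lam1 lam2) :
    ∀ᶠ n in atTop, ∀ i, activeDeriv n (M.A n) i ⊆ active n (M.A n) i := by
  filter_upwards [hlam2.signal_deriv] with n hsig i j hj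
  by_contra hcon
  have h1 := hsig i j hj
  simp only [apply_eq_zero_of_notMem hcon] at h1
  have h2 : devNorm (fun _ : Fin n => (0 : ℝ)) = 0 := by simp [devNorm, l2]
  rw [h2] at h1
  have h3 : 0 < (a0 + 1) * lam2 n := mul_pos (by unfold a0; norm_num) (hlam2.pos n)
  linarith

lemma zeta_nonneg (M : Model d Ω P) (h : ℕ → ℝ) (n : ℕ) : 0 ≤ zeta M h n := by
  unfold zeta logDim
  have := Real.log_natCast_nonneg (max n (d n))
  positivity

lemma le_zeta (M : Model d Ω P) (h : ℕ → ℝ) (n : ℕ) :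
    logDim d n / √(n * h n) ≤ zeta M h n := by
  have : 0 ≤ logDim d n := Real.log_natCast_nonneg (max n (d n))
  rw [zeta, div_eq_mul_one_div]
  exact mul_le_mul_of_nonneg_left (le_add_of_nonneg_right (by positivity)) this

lemma ScadCond.rate_le (hlam2 : ScadCond M h lam1 lam2) (hlam1 : ∀ n, 0 < lam1 n) {ε : ℝ}
    (hε : 0 < ε) : ∀ᶠ n : ℕ in atTop,
      √n * sparsity n (M.A n) * logDim d n * zeta M h n ≤ ε * lam2 n ∧
      √(n * sparsity n (M.A n)) * lam1 n ≤ ε * lam2 n := by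
  filter_upwards [hlam2.rate.def hε] with n hn
  rw [Real.norm_eq_abs, Real.norm_eq_abs, abs_of_pos (hlam2.pos n)] at hn
  have h1 := (le_abs_self _).trans hn
  have h2 : 0 ≤ √n * sparsity n (M.A n) * logDim d n * zeta M h n := by
    have := Real.log_natCast_nonneg (max n (d n))
    have := zeta_nonneg M h n
    unfold logDim
    positivity
  have h3 : 0 ≤ √(n * sparsity n (M.A n)) * lam1 n := by
    have := (hlam1 n).le
    positivity
  constructor <;> linarith

lemma LassoCond.zeta_le (hlam1 : LassoCond M K h lam1) {ε : ℝ} (hε : 0 < ε) :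
    ∀ᶠ n : ℕ in atTop, zeta M h n ≤ ε * lam1 n := by
  filter_upwards [hlam1.rate.def hε] with n hn
  rw [Real.norm_eq_abs, Real.norm_eq_abs, abs_of_pos (hlam1.pos n)] at hn
  exact (le_abs_self _).trans hn

/-- The minimal signal strength forces `s log² (n ∨ d) = o(√(n h))`. -/
lemma ScadCond.sparsity_small (hlam2 : ScadCond M h lam1 lam2) (hlam1 : ∀ n, 0 < lam1 n)
    (hM : RegularModel M) (hs : ∀ᶠ n in atTop, 1 ≤ sparsity n (M.A n)) {ε : ℝ} (hε : 0 < ε) :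
    ∀ᶠ n : ℕ in atTop, sparsity n (M.A n) * logDim d n ^ 2 / √(n * h n) ≤ ε := by
  obtain ⟨C, hC, hle⟩ := hlam2.lam2_le hM hs
  filter_upwards [hlam2.rate_le hlam1 (show 0 < ε / C by positivity), hle,
    eventually_gt_atTop 0] with n hrate hle hn
  have hn' : (0 : ℝ) < √n := Real.sqrt_pos.2 (by exact_mod_cast hn)
  have hL : 0 ≤ logDim d n := Real.log_natCast_nonneg (max n (d n))
  -- The tuning condition is divided by `√n`, which is allowed because `lam2` is at most a multiple
  -- of `√n`.
  have h1 : √n * (sparsity n (M.A n) * logDim d n * zeta M h n) ≤ √n * ε := by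
    calc _ = √n * sparsity n (M.A n) * logDim d n * zeta M h n := by ring
      _ ≤ ε / C * lam2 n := hrate.1
      _ ≤ ε / C * (C * √n) := by gcongr
      _ = √n * ε := by field_simp
  have h2 := le_of_mul_le_mul_left h1 hn'
  calc _ = sparsity n (M.A n) * logDim d n * (logDim d n / √(n * h n)) := by ring
    _ ≤ sparsity n (M.A n) * logDim d n * zeta M h n := by
        gcongr
        exact le_zeta M h n
    _ ≤ ε := h2

/-- Since `h ≤ 1` eventually, `√n ζ ≥ log (n ∨ d)`. Hence `lam2` diverges and eventually exceeds any
fixed smoothness constant. -/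
lemma ScadCond.le_lam2 (hlam2 : ScadCond M h lam1 lam2) (hlam1 : ∀ n, 0 < lam1 n)
    (hh : BandwidthCond M h) (hs : ∀ᶠ n in atTop, 1 ≤ sparsity n (M.A n)) :
    ∀ᶠ n : ℕ in atTop, logDim d n ≤ lam2 n := by
  filter_upwards [hlam2.rate_le hlam1 one_pos, hs, (tendsto_logDim d).eventually_ge_atTop 1,
    (hh.tendsto_zero hs).eventually_le_const one_pos, eventually_gt_atTop 0]
    with n hrate hs hL hh1 hn
  have hn' : (0 : ℝ) < n := by exact_mod_cast hn
  have hs' : (1 : ℝ) ≤ sparsity n (M.A n) := by exact_mod_cast hs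
  have hpos : 0 < √(n * h n) := Real.sqrt_pos.2 (mul_pos hn' (hh.pos n))
  have hle : √(n * h n) ≤ √n := Real.sqrt_le_sqrt (mul_le_of_le_one_right hn'.le hh1)
  have h1 : logDim d n ≤ √n * zeta M h n := by
    calc logDim d n = √(n * h n) * (logDim d n / √(n * h n)) := by field_simp
      _ ≤ √n * zeta M h n := by
          gcongr
          exact le_zeta M h n
  have h0 : 0 ≤ √n * zeta M h n := mul_nonneg (Real.sqrt_nonneg _) (zeta_nonneg M h n)
  calc logDim d n ≤ √n * zeta M h n := h1
    _ = 1 * 1 * (√n * zeta M h n) := by ring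
    _ ≤ sparsity n (M.A n) * logDim d n * (√n * zeta M h n) := by gcongr
    _ = √n * sparsity n (M.A n) * logDim d n * zeta M h n := by ring
    _ ≤ 1 * lam2 n := hrate.1
    _ = lam2 n := one_mul _

lemma Model.ae_recursion (M : Model d Ω P) (n : ℕ) : ∀ᵐ ω ∂(P n),
    Recursion n (M.A n) (fun l => M.X n l ω) fun l => noiseAt M n l ω := by
  have h1 : ∀ᵐ ω ∂(P n), ∀ l : Fin n, M.X n ((l : ℕ) + 1) ω
      = M.A n (scaledTime n (((l : ℕ) : ℤ) + 1)) *ᵥ M.X n l ω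
      + innovation n (M.Sigma n) (((l : ℕ) : ℤ) + 1) (M.eps n (((l : ℕ) : ℤ) + 1) ω) :=
    ae_all_iff.2 fun l => M.X_recursion n l l.2
  filter_upwards [h1] with ω hω l i
  have e : scaledTime n (((l : ℕ) : ℤ) + 1) = gridPt n l := by
    simp [scaledTime, gridPt]
  dsimp only
  rw [hω l, Pi.add_apply, innovation_apply, e]
  rfl

end Rates

/-! ### The good event and the oracle property. -/

section Main

variable {d : ℕ → ℕ} {Ω : ℕ → Type*} [∀ n, MeasurableSpace (Ω n)] {P : ∀ n, Measure (Ω n)}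
  [∀ n, IsProbabilityMeasure (P n)] {M : Model d Ω P} {h lam1 lam2 : ℕ → ℝ} {K : ℝ → ℝ}

theorem RegularModel.wpa1_goodSample (hM : RegularModel M) (hK : KernelCond K)
    (hh : BandwidthCond M h) (hlam1 : ∀ n, 0 < lam1 n) (hlam2 : ScadCond M h lam1 lam2)
    (hs : ∀ᶠ n in atTop, 1 ≤ sparsity n (M.A n)) :
    ∃ C : ℝ, 0 < C ∧ Wpa1 P fun n ω => GoodSample K n (h n) (fun l => M.X n l ω)
      (fun l => noiseAt M n l ω) (activePair n (M.A n)) (C * √(logDim d n))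
      (C * (logDim d n / √(n * h n))) (1 / (4 * sparsity n (M.A n))) := by
  obtain ⟨B, hB⟩ := hM.subGInnov
  obtain ⟨D, ρ, hD, hρ, hρ1, hb⟩ := hM.coefBounds
  obtain ⟨c, M₀, hc, hM₀, hlow⟩ := hK.local_linear_lower
  obtain ⟨CK, hCK⟩ := hK.bdd
  obtain ⟨C, hC, hmain⟩ := exists_measure_not_goodSample_le (hB 0).pos hD hρ hρ1 hc
    (show 0 < max CK 1 by positivity) hK fun x => (hCK x).trans (le_max_left _ _)
  refine ⟨C, hC, ?_⟩
  have hlim : Tendsto (fun n => ENNReal.ofReal (C * Real.exp (-logDim d n))) atTop (𝓝 0) := by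
    have h1 := (Real.tendsto_exp_neg_atTop_nhds_zero.comp (tendsto_logDim d)).const_mul C
    rw [mul_zero] at h1
    simpa using ENNReal.tendsto_ofReal h1
  refine tendsto_of_tendsto_of_tendsto_of_le_of_le' tendsto_const_nhds hlim
    (Eventually.of_forall fun _ => zero_le) ?_
  have hh0 := hh.tendsto_zero hs
  filter_upwards [hs, (tendsto_logDim d).eventually_ge_atTop 1,
    hh.tendsto_atTop.eventually_ge_atTop (max M₀ 1), hh0.eventually_le_const one_pos,
    hh0.eventually_le_const (show 0 < 1 / M₀ by positivity),
    hlam2.sparsity_small hlam1 hM hs (show 0 < 1 / C by positivity), hlam2.activeDeriv_subset,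
    eventually_gt_atTop 0] with n hs hL hnh hh1 hhM hψ hsub hn
  have hn1 : (1 : ℝ) ≤ n := by exact_mod_cast hn
  refine hmain M n (max n (d n)) (hB n) (hb n) (h n) (hh.pos n) ((le_max_right _ _).trans hnh)
    (hlow n (h n) (hh.pos n) ((le_max_left _ _).trans hnh) ?_) (activePair n (M.A n))
    (sparsity n (M.A n)) (logDim d n) (fun i => card_activePair_le (hsub i)) (by exact_mod_cast hs)
    ?_ rfl hL (le_max_left _ _) (le_max_right _ _) ?_ ?_
  · rwa [le_div_iff₀ hM₀, mul_comm] at hhM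
  · exact_mod_cast (sparsity_le n (M.A n)).trans (le_max_right _ _)
  · refine Real.sqrt_le_iff.2 ⟨Nat.cast_nonneg _, ?_⟩
    have h1 : (n : ℝ) ≤ (max n (d n) : ℕ) := by exact_mod_cast le_max_left n (d n)
    calc n * h n ≤ n * 1 := by gcongr
      _ = (n : ℝ) := mul_one _
      _ ≤ (n : ℝ) ^ 2 := le_self_pow₀ hn1 two_ne_zero
      _ ≤ _ := by gcongr
  · rwa [le_div_iff₀ hC, mul_comm] at hψ

/-- The oracle property, with strict optimality and the error bound. -/
theorem RegularModel.wpa1_oracle (hM : RegularModel M) (hK : KernelCond K)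
    (hh : BandwidthCond M h) (hlam1 : LassoCond M K h lam1) (hlam2 : ScadCond M h lam1 lam2)
    (hs : ∀ᶠ n in atTop, 1 ≤ sparsity n (M.A n))
    {preA preB : ∀ n, Ω n → Fin (d n) → Fin n → Fin (d n) → ℝ}
    (hpre : IsPrelim M K h lam1 preA preB) :
    ∃ C : ℝ, 0 < C ∧ Wpa1 P fun n ω => ∀ i, ∃ AB₀ ∈ oracleSet n (M.A n) i,
      (∀ AB, AB ≠ AB₀ →
        objective M K h lam2 preA n ω i AB₀ < objective M K h lam2 preA n ω i AB) ∧
      avgSqError n (M.A n) i AB₀.1 ≤ C * (sparsity n (M.A n) * zeta M h n ^ 2) := by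
  obtain ⟨C, hC, hgood⟩ := hM.wpa1_goodSample hK hh hlam1.pos hlam2 hs
  obtain ⟨κ₀, hκ₀, hRE⟩ := hlam1.restricted_eigenvalue
  obtain ⟨CA, hCA, hA, -⟩ := hM.exists_abs_le
  obtain ⟨CK₀, hCK₀⟩ := hK.bdd
  set CK := max CK₀ 1 with hCKdef
  have hCK : ∀ x, K x ≤ CK := fun x => (hCK₀ x).trans (le_max_left _ _)
  have hCK0 : 0 < CK := by positivity
  set k₁ := 3 * CK with hk₁
  have hk₁0 : 0 < k₁ := by positivity
  -- The two terms are noise and bias. The squared sample bound `C² log (n ∨ d)` gives the bias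
  -- exactly the logarithm that appears in `ζ`.
  set Cz := C + (k₁ + 1) * C ^ 2 * CA with hCz
  have hCz0 : 0 < Cz := by positivity
  have hzeta : ∀ n, scoreBound n (M.A n) (h n) CA k₁ (C * √(logDim d n))
      (C * (logDim d n / √(n * h n))) ≤ Cz * zeta M h n := by
    intro n
    have hL : 0 ≤ logDim d n := Real.log_natCast_nonneg (max n (d n))
    have h1 : scoreBound n (M.A n) (h n) CA k₁ (C * √(logDim d n))
        (C * (logDim d n / √(n * h n))) = C * (logDim d n / √(n * h n))
          + (k₁ + 1) * C ^ 2 * CA * (logDim d n * (sparsity n (M.A n) * h n ^ 2)) := by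
      rw [scoreBound]
      linear_combination ((k₁ + 1) * C ^ 2 * CA * (sparsity n (M.A n) * h n ^ 2))
        * Real.sq_sqrt hL
    have h2 : zeta M h n = logDim d n / √(n * h n)
        + logDim d n * (sparsity n (M.A n) * h n ^ 2) := by
      rw [zeta]
      ring
    rw [h1, h2, hCz]
    have e1 : 0 ≤ (k₁ + 1) * C ^ 2 * CA * (logDim d n / √(n * h n)) := by positivity
    have e2 : 0 ≤ C * (logDim d n * (sparsity n (M.A n) * h n ^ 2)) := by positivity
    linarith
  refine ⟨4 * Cz ^ 2, by positivity, (hgood.and (hRE.and (Wpa1.of_ae M.ae_recursion))).mono ?_⟩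
  -- The three `o`-conditions are used at the tolerances that produce `lam1 / 6`, `lam2 / 4` and
  -- `lam2 / 2` respectively.
  set c₁ := 1 / (6 * Cz) with hc₁
  set c₂ := 1 / (4 * (Cz * (1 + 4 * k₁ * C ^ 2))) with hc₂
  set c₃ := κ₀ / (2 * √(32 / 9)) with hc₃
  filter_upwards [hs, (tendsto_logDim d).eventually_ge_atTop (max 1 (2 * CA)),
    hh.tendsto_atTop.eventually_ge_atTop 1, hlam1.zeta_le (show 0 < c₁ by positivity),
    hlam2.rate_le hlam1.pos (show 0 < c₂ by positivity),
    hlam2.rate_le hlam1.pos (show 0 < c₃ by positivity), hlam2.le_lam2 hlam1.pos hh hs,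
    hlam2.activeDeriv_subset, hlam2.signal, hlam2.signal_deriv, eventually_gt_atTop 0]
    with n hs hL hnh hrate1 hrate2 hrate3 hlarge hsub hsig hsigd hn
  rintro ω ⟨hG, hRE', hrec⟩ i
  have hL1 : 1 ≤ logDim d n := (le_max_left _ _).trans hL
  have hLA : 2 * CA ≤ logDim d n := (le_max_right _ _).trans hL
  have hs' : (1 : ℝ) ≤ sparsity n (M.A n) := by exact_mod_cast hs
  have hs0 : (0 : ℝ) < sparsity n (M.A n) := by linarith
  have hζ0 := zeta_nonneg M h n
  have hr0 : 0 ≤ C * (logDim d n / √(n * h n)) := by positivity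
  have hz0 : 0 ≤ scoreBound n (M.A n) (h n) CA k₁ (C * √(logDim d n))
      (C * (logDim d n / √(n * h n))) := by
    unfold scoreBound
    positivity
  have hz₁ : scoreBound n (M.A n) (h n) CA k₁ (C * √(logDim d n))
      (C * (logDim d n / √(n * h n))) ≤ lam1 n / 6 := by
    refine (hzeta n).trans ?_
    calc Cz * zeta M h n ≤ Cz * (c₁ * lam1 n) := by gcongr
      _ = lam1 n / 6 := by
          rw [hc₁]
          field_simp
  have hpre₂ : √n * (√(32 / 9 * sparsity n (M.A n)) * lam1 n / κ₀) ≤ lam2 n / 2 := by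
    have e1 : √n * (√(32 / 9 * sparsity n (M.A n)) * lam1 n / κ₀)
        = √(32 / 9) / κ₀ * (√(n * sparsity n (M.A n)) * lam1 n) := by
      rw [Real.sqrt_mul (by norm_num), Real.sqrt_mul (Nat.cast_nonneg n)]
      ring
    rw [e1]
    calc _ ≤ √(32 / 9) / κ₀ * (c₃ * lam2 n) :=
          mul_le_mul_of_nonneg_left hrate3.2 (by positivity)
      _ = lam2 n / 2 := by
          rw [hc₃]
          field_simp
  -- The two factors `√(log (n ∨ d))` combine with the number of relevant coordinates to `s log (n ∨
  -- d)`, matching the first part of the SCAD rate.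
  have hkkt : ∀ z, 0 ≤ z → z ≤ Cz * zeta M h n → √n * (z + k₁ * (C * √(logDim d n)
      * (2 * sparsity n (M.A n) * (C * √(logDim d n) * (2 * z))))) ≤ lam2 n / 4 := by
    intro z hz hzle
    have e1 : √n * (z + k₁ * (C * √(logDim d n) * (2 * sparsity n (M.A n)
        * (C * √(logDim d n) * (2 * z)))))
        = √n * ((1 + 4 * k₁ * C ^ 2 * (sparsity n (M.A n) * logDim d n)) * z) := by
      linear_combination (√n * (4 * k₁ * C ^ 2 * sparsity n (M.A n) * z))
        * Real.sq_sqrt (show 0 ≤ logDim d n by linarith)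
    rw [e1]
    have e2 : 1 ≤ sparsity n (M.A n) * logDim d n := one_le_mul_of_one_le_of_one_le hs' hL1
    calc _ ≤ √n * (((1 + 4 * k₁ * C ^ 2) * (sparsity n (M.A n) * logDim d n))
          * (Cz * zeta M h n)) := by
          gcongr
          linarith
      _ = Cz * (1 + 4 * k₁ * C ^ 2)
          * (√n * sparsity n (M.A n) * logDim d n * zeta M h n) := by ring
      _ ≤ Cz * (1 + 4 * k₁ * C ^ 2) * (c₂ * lam2 n) :=
          mul_le_mul_of_nonneg_left hrate2.1 (by positivity)
      _ = lam2 n / 4 := by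
          rw [hc₂]
          field_simp
  obtain ⟨AB₀, h1, h2, h3⟩ := hG.oracle (k₁ := k₁) (κ₀ := κ₀) (lam1 := lam1 n) (lam2 := lam2 n)
    hn.ne' (hh.pos n) hK (hA n) (fun t => sum_locK_le hK hCK (hh.pos n) hnh t) hsub hrec hr0
    (le_of_eq (by field_simp; norm_num)) (by positivity) hκ₀ (hlam1.pos n) (hlam2.pos n) hRE'
    hz₁ hpre₂ (by linarith) (hkkt _ hz0 (hzeta n)) hsig hsigd i (hpre n ω i)
  refine ⟨AB₀, h1, h2, h3.trans ?_⟩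
  calc _ ≤ sparsity n (M.A n) * (2 * (Cz * zeta M h n)) ^ 2 := by
          gcongr
          exact hzeta n
      _ = _ := by ring

end Main

end

end TvVAR

/-! ### From strict optimality to an arbitrary selection of minimisers. -/

theorem theorem4p2 {Ω : ℕ → Type*} [∀ n, MeasurableSpace (Ω n)] (P : ∀ n, Measure (Ω n))
    [∀ n, IsProbabilityMeasure (P n)] (d : ℕ → ℕ) (M : TvVAR.Model d Ω P)
    (K : ℝ → ℝ) (h lam1 lam2 : ℕ → ℝ)
    (hM : TvVAR.RegularModel M) (hK : TvVAR.KernelCond K) (hh : TvVAR.BandwidthCond M h)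
    (hlam1 : TvVAR.LassoCond M K h lam1) (hlam2 : TvVAR.ScadCond M h lam1 lam2)
    (hs : ∀ᶠ n in atTop, 1 ≤ TvVAR.sparsity n (M.A n))
    (preA preB : ∀ n, Ω n → Fin (d n) → Fin n → Fin (d n) → ℝ)
    (hpre : TvVAR.IsPrelim M K h lam1 preA preB)
    (est : ∀ n, Ω n → Fin (d n) → TvVAR.Arrays n (d n))
    (hest : ∀ n ω i, (∃ AB, IsMinOn (TvVAR.objective M K h lam2 preA n ω i) Set.univ AB) →
      IsMinOn (TvVAR.objective M K h lam2 preA n ω i) Set.univ (est n ω i)) :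
    TvVAR.Wpa1 P (fun n ω => ∀ i : Fin (d n),
      (∀ AB, IsMinOn (TvVAR.objective M K h lam2 preA n ω i) Set.univ AB ↔
        AB = est n ω i) ∧
      (∀ AB, (AB ∈ TvVAR.oracleSet n (M.A n) i ∧
          IsMinOn (TvVAR.objective M K h lam2 preA n ω i) (TvVAR.oracleSet n (M.A n) i) AB) ↔
        AB = est n ω i)) ∧
    TvVAR.IsBigOP P
      (fun n ω => ⨆ i : Fin (d n), TvVAR.avgSqError n (M.A n) i (est n ω i).1)
      (fun n => (TvVAR.sparsity n (M.A n) : ℝ) * TvVAR.zeta M h n ^ 2) := by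
  obtain ⟨C, hC, hW⟩ := hM.wpa1_oracle hK hh hlam1 hlam2 hs hpre
  have hW' : TvVAR.Wpa1 P (fun n ω => ∀ i : Fin (d n),
      est n ω i ∈ TvVAR.oracleSet n (M.A n) i ∧
      (∀ AB, AB ≠ est n ω i → TvVAR.objective M K h lam2 preA n ω i (est n ω i)
        < TvVAR.objective M K h lam2 preA n ω i AB) ∧
      TvVAR.avgSqError n (M.A n) i (est n ω i).1
        ≤ C * (TvVAR.sparsity n (M.A n) * TvVAR.zeta M h n ^ 2)) := by
    refine hW.mono (Eventually.of_forall fun n ω hω i => ?_)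
    obtain ⟨AB₀, h₁, h₂, h₃⟩ := hω i
    have hmin : IsMinOn (TvVAR.objective M K h lam2 preA n ω i) Set.univ AB₀ := by
      intro AB _
      by_cases hAB : AB = AB₀
      · exact (congrArg (TvVAR.objective M K h lam2 preA n ω i) hAB).ge
      · exact (h₂ AB hAB).le
    -- `est` is constrained only where a minimiser exists. Strict optimality of `AB₀` provides one
    -- and forces the selection to equal it.
    have heq : est n ω i = AB₀ := by
      by_contra hne
      exact not_lt.2 (hest n ω i ⟨AB₀, hmin⟩ (Set.mem_univ AB₀)) (h₂ _ hne)
    rw [heq]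
    exact ⟨h₁, h₂, h₃⟩
  refine ⟨hW'.mono (Eventually.of_forall fun n ω hω i => ?_), hW'.isBigOP hC
    (Eventually.of_forall fun n ω hω => ?_)⟩
  · obtain ⟨h₁, h₂, -⟩ := hω i
    -- A global minimiser is minimal over every set. As it lies in the oracle set, strictness also
    -- rules out any other oracle minimiser.
    have hmin : ∀ s, IsMinOn (TvVAR.objective M K h lam2 preA n ω i) s (est n ω i) := by
      intro s AB _
      by_cases hAB : AB = est n ω i
      · exact (congrArg (TvVAR.objective M K h lam2 preA n ω i) hAB).ge
      · exact (h₂ AB hAB).le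
    refine ⟨fun AB => ⟨fun hAB => ?_, fun hAB => hAB ▸ hmin _⟩,
      fun AB => ⟨fun hAB => ?_, fun hAB => hAB ▸ ⟨h₁, hmin _⟩⟩⟩
    · by_contra hne
      exact not_lt.2 (hAB (Set.mem_univ (est n ω i))) (h₂ AB hne)
    · by_contra hne
      exact not_lt.2 (hAB.2 h₁) (h₂ AB hne)
  · have h0 : 0 ≤ ⨆ i : Fin (d n), TvVAR.avgSqError n (M.A n) i (est n ω i).1 :=
      Real.iSup_nonneg fun i => by
        unfold TvVAR.avgSqError
        positivity
    rw [abs_of_nonneg h0]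
    exact Real.iSup_le (fun i => (hω i).2.2) (by positivity)
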